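/- **Theorem.** Let $k\ge 3$ and let $A_k=\langle a,b\mid \Pi(a,b;k)=\Pi(b,a;k)\rangle$, where $\Pi(s,t;n)=sts\cdots$ ($n$ factors). Put $\Delta=\Pi(a,b;k)$ and $M^+=\{\Pi(a,b;n),\Pi(b,a;n) : 1\le n\le k-1\}$; the elements $\Pi(a,b;n)$ and $\Pi(b,a;n)$ are said to have length $n$. Let $d$ be the word metric on $A_k$ for the generators $a^{\pm1},b^{\pm1}$, with $d(y,x)=d(e,y^{-1}x)$, and let $\mathcal M$ be the closure of $\mathcal D=\{d(\cdot,x)-d(e,x): x\in A_k\}$ in the space of real-valued functions on the discrete space $A_k$ with the topology of uniform convergence on compact sets (that is, of pointwise convergence). Every $x\in A_k$ has a unique expression $x=\Delta^r w_1\cdots w_n$ with $r\in\mathbb Z$, all $w_j\in M^+$ and $n$ minimal. Let $m_k(x)=r$, let $m_i(x)$ be the number of factors $w_j$ of length $i$ for $1\le i\le k-1$, and let $\pi(x)=(m_k,\,m_k+m_{k-1},\dots,m_k+\cdots+m_1)\in\mathbb Z^k$, with coordinates indexed by $0,\dots,k-1$. For $w,x\in A_k$ put $\phi(w,x)=\pi(w^{-1}x)-\pi(x)$.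 Let $Z$ be the set of finite or infinite words in the letters $a,b$ having no product of consecutive letters equal to $\Delta$, with the topology of letterwise convergence (the end of a word counting as a letter). Every $z\in Z$ is uniquely a concatenation of nonempty finite substrings such that the product of the letters of each substring is in $M^+$ and the combined product of any two consecutive substrings is not; let $m_i(z)\in\mathbb N\cup\{\infty\}$ be the number of these substrings of length $i$. For $w\in A_k$, let $\phi(w,z)$ be defined as above, with $z$ read as an element of $A_k$, if $z$ is finite, and let $\phi(w,z)=\lim_n\phi(w,z_1\cdots z_n)$, which exists, if $z=z_1z_2\cdots$ is infinite. Let $\Omega'$ be the set of $(p,z)\in(\mathbb Z\cup\{\pm\infty\})^k\times Z$, with the product topology, such that for every $i\in\{1,\dots,k-1\}$ for which $p_i,p_{i-1}$ are not both $-\infty$ and not both $+\infty$ we have $p_i-p_{i-1}\ge m_{k-i}(z)$, with equality if $z$ is finite. Let $\Omega$ be the quotient space of $\Omega'$ in which all $(p,z)$ with $p=(+\infty,\dots,+\infty)$ are identified with each other, and likewise all those with $p=(-\infty,\dots,-\infty)$. Let $\Omega_0\subset\Omega$ be the set of (classes of) pairs $(p,z)$ with $p\in\mathbb Z^k$, $z$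 finite, and $p_i-p_{i-1}=m_{k-i}(z)$ for all $i\in\{1,\dots,k-1\}$. For $(p,z)\in\Omega'$ and $w\in A_k$ put $$\psi_{p,z}(w)=\sum_{i=0}^{k-1}|p_i+\phi_i(w,z)|-\sum_{i=0}^{k-1}|p_i|,$$ where the infinite parts cancel, so that $|p_i+\phi_i|-|p_i|$ is read as $\phi_i$ if $p_i=+\infty$ and as $-\phi_i$ if $p_i=-\infty$. Then $\psi$ is constant on the classes of $\Omega$, the induced map $(p,z)\mapsto\psi_{p,z}$ is a homeomorphism from $\Omega$ onto $\mathcal M$, and it maps $\Omega_0$ onto $\mathcal D$. -/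

import Mathlib

noncomputable section

namespace DihedralArtin

open Filter Topology

/-! ### The Artin groups of dihedral type

The two generators `a`, `b` are indexed by `Bool`. -/

/-- The alternating word `s t s t ⋯` with `n` letters, starting with `s`, where `t` is the other
letter. -/
def altWord : Bool → ℕ → List Bool
  | _, 0 => []
  | s, n + 1 => s :: altWord (!s) n

/-- The single relator expressing `abab⋯ = baba⋯`, with `k` factors on each side. -/
def rels (k : ℕ) : Set (FreeGroup Bool) :=
  {((altWord false k).map FreeGroup.of).prod * ((altWord true k).map FreeGroup.of).prod⁻¹}

/-- The Artin group of dihedral type `A_k = ⟨a, b ∣ abab⋯ = baba⋯⟩`. -/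
abbrev Artin (k : ℕ) : Type := PresentedGroup (rels k)

/-- The Artin generators `a` and `b`. -/
def gen (k : ℕ) (s : Bool) : Artin k := PresentedGroup.of s

/-- The product in `A_k` of the letters of a positive word. -/
def wordProd (k : ℕ) (l : List Bool) : Artin k := (l.map (gen k)).prod

/-- `Π(s,t;n) = s t s ⋯` with `n` factors, as an element of `A_k`. -/
def alt (k : ℕ) (s : Bool) (n : ℕ) : Artin k := wordProd k (altWord s n)

/-- The Garside element. -/
def garside (k : ℕ) : Artin k := alt k false k

/-- `x` is one of the two elements `Π(a,b;n)`, `Π(b,a;n)`. -/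
def IsAlt (k : ℕ) (x : Artin k) (n : ℕ) : Prop := ∃ s : Bool, x = alt k s n

/-- `M⁺ = {a, b, ab, ba, …, Π(a,b;k-1), Π(b,a;k-1)}`. -/
def Mplus (k : ℕ) : Set (Artin k) := {x | ∃ n, 1 ≤ n ∧ n < k ∧ IsAlt k x n}

/-! ### The word metric and the horofunction compactification -/

/-- The Artin generators and their inverses. -/
def genSet (k : ℕ) : Set (Artin k) := {x | ∃ s : Bool, x = gen k s ∨ x = (gen k s)⁻¹}

/-- Word length: the least length of a word in the generators and their inverses that represents
`x`. -/
def wordLength (k : ℕ) (x : Artin k) : ℕ :=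
  sInf {n | ∃ l : List (Artin k), l.length = n ∧ (∀ g ∈ l, g ∈ genSet k) ∧ l.prod = x}

/-- The word metric, invariant under left multiplication. -/
def wordDist (k : ℕ) (x y : Artin k) : ℕ := wordLength k (x⁻¹ * y)

/-- The word metric takes its values in `ℕ`, so it induces the discrete topology. -/
instance instTopologicalSpaceArtin (k : ℕ) : TopologicalSpace (Artin k) := ⊥

instance instDiscreteTopologyArtin (k : ℕ) : DiscreteTopology (Artin k) := ⟨rfl⟩

/-- The function `d(·, x) - d(e, x)`. -/
def distFun (k : ℕ) (x : Artin k) : C(Artin k, ℝ) where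
  toFun y := (wordDist k y x : ℝ) - (wordDist k 1 x : ℝ)
  continuous_toFun := continuous_of_discreteTopology

/-- The horofunction compactification with basepoint the identity: the closure of the set of all
functions `d(·, x) - d(e, x)` in the space of continuous functions, with the topology of uniform
convergence on compact sets (the compact-open topology). -/
def horoCompactification (k : ℕ) : Set C(Artin k, ℝ) := closure (Set.range (distFun k))

/-! ### Left normal form, and the maps `π` and `φ` -/

/-- `x = Δ^r w₁ ⋯ wₙ` with all `wᵢ` in `M⁺`; here `f = (r, [w₁, …, wₙ])`. -/
def IsGarsideExpr (k : ℕ) (x : Artin k) (f : ℤ × List (Artin k)) : Prop :=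
  (∀ y ∈ f.2, y ∈ Mplus k) ∧ x = garside k ^ f.1 * f.2.prod

/-- The left normal form: such an expression with the least possible number of factors. -/
def IsLeftNormalForm (k : ℕ) (x : Artin k) (f : ℤ × List (Artin k)) : Prop :=
  IsGarsideExpr k x f ∧ ∀ f', IsGarsideExpr k x f' → f.2.length ≤ f'.2.length

/-- The left normal form of `x` (which exists and is unique). -/
def leftNormalForm (k : ℕ) (x : Artin k) : ℤ × List (Artin k) :=
  Classical.epsilon (IsLeftNormalForm k x)

open Classical in
/-- The number of canonical factors of length `n` of `x`, for `1 ≤ n ≤ k - 1`. -/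
def numFactors (k : ℕ) (x : Artin k) (n : ℕ) : ℕ :=
  (leftNormalForm k x).2.countP (fun y => IsAlt k y n)

/-- `π(x) = (m_k, m_k + m_{k-1}, …, m_k + ⋯ + m_1)`, where `m_k` is the exponent of `Δ` and `m_n`,
for `n < k`, is the number of canonical factors of length `n`. -/
def piVec (k : ℕ) (x : Artin k) (i : Fin k) : ℤ :=
  (leftNormalForm k x).1 + ∑ j ∈ Finset.Icc 1 (i : ℕ), (numFactors k x (k - j) : ℤ)

/-- `φ(w, x) = π(w⁻¹ x) - π(x)` for group elements `w` and `x`. -/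
def phiElt (k : ℕ) (w x : Artin k) : Fin k → ℤ := piVec k (w⁻¹ * x) - piVec k x

/-! ### Possibly infinite words without `Δ` -/

/-- The product of the letters of `z` in the positions `m, …, n - 1`. -/
def segProd (k : ℕ) (z : Stream'.Seq Bool) (m n : ℕ) : Artin k :=
  wordProd k ((z.drop m).take (n - m))

/-- The set `Z` of possibly infinite positive words in which no product of consecutive letters
equals `Δ`. -/
structure DeltaFree (k : ℕ) where
  word : Stream'.Seq Bool
  ne_garside : ∀ m n : ℕ, segProd k word m n ≠ garside k

/-- The topology of `Z`: letterwise convergence, the end of a finite word being treated as an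
additional letter. -/
instance instTopologicalSpaceDeltaFree (k : ℕ) : TopologicalSpace (DeltaFree k) :=
  TopologicalSpace.induced (fun z (n : ℕ) => z.word.get? n)
    (@Pi.topologicalSpace ℕ (fun _ => Option Bool) (fun _ => ⊥))

/-- The decomposition of `z` into nonempty substrings, the `j`-th substring occupying the positions
`c j, …, c (j + 1) - 1`: the product of every substring is in `M⁺`, and the combined product of two
consecutive substrings is not. Once the end of a finite word is reached, `c` stays constant. -/
def IsDecomposition (k : ℕ) (z : DeltaFree k) (c : ℕ → ℕ) : Prop :=
  c 0 = 0 ∧ ∀ j,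
    (z.word.get? (c j) = none → c (j + 1) = c j) ∧
    (z.word.get? (c j) ≠ none →
      c j < c (j + 1) ∧ z.word.get? (c (j + 1) - 1) ≠ none ∧
      segProd k z.word (c j) (c (j + 1)) ∈ Mplus k ∧
      (z.word.get? (c (j + 1)) ≠ none → segProd k z.word (c j) (c (j + 2)) ∉ Mplus k))

/-- The decomposition of `z` (which exists and is unique). -/
def decomposition (k : ℕ) (z : DeltaFree k) : ℕ → ℕ := Classical.epsilon (IsDecomposition k z)

/-- `m_n(z)`: the number, possibly infinite, of substrings of length `n` in the decomposition
of `z`. -/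
def numSub (k : ℕ) (z : DeltaFree k) (n : ℕ) : ℕ∞ :=
  Set.encard {j : ℕ | z.word.get? (decomposition k z j) ≠ none ∧
    decomposition k z (j + 1) - decomposition k z j = n}

/-- `φ(w, z)` for `z` in `Z`: the limit of `φ(w, z₁ ⋯ zₙ)`. For a finite word the sequence is
eventually constant, with value `φ(w, z)`. -/
def phi (k : ℕ) (w : Artin k) (z : DeltaFree k) : Fin k → ℤ :=
  limUnder atTop (fun n => phiElt k w (wordProd k (z.word.take n)))

/-! ### The space `Ω` -/

/-- `ℤ ∪ {-∞, +∞}`, with its usual topology as a subspace of the extended reals. -/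
abbrev ExtInt : Type := {x : EReal // x = ⊥ ∨ x = ⊤ ∨ ∃ n : ℤ, x = ((n : ℝ) : EReal)}

/-- A natural number or `∞` as an extended real. -/
def enatToEReal (m : ℕ∞) : EReal := ((m : ENNReal) : EReal)

/-- The defining conditions of `Ω'`. The difference of extended reals used here is the usual one in
all cases except `(+∞) - (+∞)` and `(-∞) - (-∞)`, which are excluded. -/
def OmegaCond (k : ℕ) (x : (Fin k → ExtInt) × DeltaFree k) : Prop :=
  ∀ (i : ℕ) (hi : i + 1 < k),
    ¬ ((x.1 ⟨i, by omega⟩).1 = ⊥ ∧ (x.1 ⟨i + 1, hi⟩).1 = ⊥) →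
    ¬ ((x.1 ⟨i, by omega⟩).1 = ⊤ ∧ (x.1 ⟨i + 1, hi⟩).1 = ⊤) →
      enatToEReal (numSub k x.2 (k - (i + 1))) ≤
        (x.1 ⟨i + 1, hi⟩).1 - (x.1 ⟨i, by omega⟩).1 ∧
      (x.2.word.Terminates →
        (x.1 ⟨i + 1, hi⟩).1 - (x.1 ⟨i, by omega⟩).1 =
          enatToEReal (numSub k x.2 (k - (i + 1))))

/-- The space `Ω'`, with the topology induced from the product topology. -/
abbrev OmegaPre (k : ℕ) : Type := {x : (Fin k → ExtInt) × DeltaFree k // OmegaCond k x}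

/-- `p = (c, …, c)`. -/
def IsConst (k : ℕ) (c : EReal) (x : OmegaPre k) : Prop := ∀ i, (x.1.1 i).1 = c

/-- The equivalence relation that identifies all `(p, z)` with `p = (+∞, …, +∞)`, and all `(p, z)`
with `p = (-∞, …, -∞)`. -/
instance omegaSetoid (k : ℕ) : Setoid (OmegaPre k) where
  r x y := x = y ∨ (x.1.1 = y.1.1 ∧ (IsConst k ⊤ x ∨ IsConst k ⊥ x))
  iseqv :=
    { refl := fun _ => Or.inl rfl
      symm := by
        rintro x y (rfl | ⟨h, h'⟩)
        · exact Or.inl rfl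
        · refine Or.inr ⟨h.symm, ?_⟩
          simpa only [IsConst, h] using h'
      trans := by
        rintro x y z (rfl | ⟨h, h'⟩) hyz
        · exact hyz
        · rcases hyz with rfl | ⟨h2, _⟩
          · exact Or.inr ⟨h, h'⟩
          · exact Or.inr ⟨h.trans h2, h'⟩ }

/-- The quotient space `Ω` of `Ω'`. -/
abbrev Omega (k : ℕ) : Type := Quotient (omegaSetoid k)

/-- The subset `Ω₀` of `Ω`: the classes of the pairs `(p, z)` with `p` in `ℤ^k`, with `z` a finite
word, and with `p_i - p_{i-1} = m_{k-i}(z)` for `1 ≤ i ≤ k - 1`. -/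
def Omega0 (k : ℕ) : Set (Omega k) :=
  {q | ∃ x : OmegaPre k, q = Quotient.mk (omegaSetoid k) x ∧
    (∀ i, ∃ n : ℤ, (x.1.1 i).1 = ((n : ℝ) : EReal)) ∧ x.1.2.word.Terminates ∧
    ∀ (i : ℕ) (hi : i + 1 < k),
      (x.1.1 ⟨i + 1, hi⟩).1 - (x.1.1 ⟨i, by omega⟩).1 =
        enatToEReal (numSub k x.1.2 (k - (i + 1)))}

/-! ### The map `ψ` -/

open Classical in
/-- `|p + b| - |p|` for an extended integer `p` and an integer `b`: this is `b` for `p = +∞`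
(since `|∞ + b| = ∞ + b`) and `-b` for `p = -∞` (since `|-∞ + b| = ∞ - b`). -/
def absDiff (p : ExtInt) (b : ℤ) : ℝ :=
  if p.1 = ⊤ then b else if p.1 = ⊥ then -b else |p.1.toReal + b| - |p.1.toReal|

/-- `ψ_{p,z}(w) = ∑ |p_i + φ_i(w, z)| - ∑ |p_i|`, where the infinite parts cancel term by term. -/
def psi (k : ℕ) (x : OmegaPre k) (w : Artin k) : ℝ :=
  ∑ i : Fin k, absDiff (x.1.1 i) (phi k w x.1.2 i)

end DihedralArtin

end

open DihedralArtin Filter Topology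

noncomputable section

namespace DihedralArtin

open Filter Topology

/-! ### Alternating words and runs -/

/-! Every element of A_k is uniquely `l Δ^r` with `l` a positive word all of whose maximal
alternating runs have fewer than `k` letters. Uniqueness comes from an action of A_k on such pairs:
a generator or its inverse changes a pair by an explicit rule (`stepGen`, `stepInv`), and the two
words for Δ act alike (`genPerm_altWord`). The factors of the left normal form are the runs of `l`,
up to conjugation by Δ, so that π_i is `r` plus the number of runs of length at least `k - i`
(`piVec_eq`).

Left multiplication by a generator raises exactly one coordinate of π by one (`piVec_gen_mul`), and
some generator or inverse always moves a nonzero π towards 0 (`exists_gen_decreasing`). Hence word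
length is the ℓ¹ norm of π (`wordLength_eq`), and `distFun` has the form of ψ with p = π(x). The
change of π under multiplication by a fixed element depends on finitely many letters of `l`
(`exists_stable`); this extends φ to infinite words and makes ψ continuous.

The conditions defining Ω' can be tested on finite prefixes (`omegaCond_iff`), so Ω' is closed in a
compact space. Group elements give points of Ω', and the image of Ω' is compact, so ψ reaches all of
the compactification. Conversely each ψ is a limit of distance functions: cut `z` at a break between
runs, replace infinite coordinates of p by large integers, and append runs until the counts fit
(`exists_near`).

For injectivity, replacing `w` by `w Δ^n` subtracts `n` from every coordinate of φ. The increments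
of ψ in `n` therefore count the coordinates of q = p + φ(w,z) that are at most `n`, and this
determines q whenever q is monotone, as it is for every prefix `w` of `z` (`sum_sign_eq`,
`eq_of_sum_sign_eq`). The empty prefix gives p. Suppose the words first differ after a common
prefix. If q is not constant there, moving along the next run of one word lowers the last L
coordinates for that word but the first L for the other, and ψ sees the difference
(`psi_ne_of_first_letters`). If q is a finite constant, both words have ended; if it is an infinite
constant, so is p, which is the case identified in Ω. A continuous bijection from a compact space to
a Hausdorff space is a homeomorphism. -/

/-- The length of the longest alternating prefix of a word whose first letter is `s`. -/
def leadRun : Bool → List Bool → ℕ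
  | _, [] => 0
  | s, t :: l => if t = s then leadRun (!s) l + 1 else 0

/-- The number of letters whose distance to the end of their run is `n`; this is the number of
maximal alternating runs of length at least `n`. -/
def runCount (n : ℕ) : List Bool → ℕ
  | [] => 0
  | s :: l => runCount n l + if leadRun (!s) l + 1 = n then 1 else 0

/-- All alternating runs have fewer than `k` letters. -/
def RunsLT (k : ℕ) : List Bool → Prop
  | [] => True
  | s :: l => leadRun (!s) l + 1 < k ∧ RunsLT k l

/-- Conjugation by the Garside element, on words. -/
def twist (k : ℕ) (l : List Bool) : List Bool := l.map (· ^^ k.bodd)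

@[simp] theorem leadRun_nil (s : Bool) : leadRun s [] = 0 := rfl

@[simp] theorem leadRun_cons_self (s : Bool) (l : List Bool) :
    leadRun s (s :: l) = leadRun (!s) l + 1 := by simp [leadRun]

@[simp] theorem leadRun_not_cons (s : Bool) (l : List Bool) : leadRun (!s) (s :: l) = 0 := by
  simp [leadRun]

@[simp] theorem runCount_nil (n : ℕ) : runCount n [] = 0 := rfl

theorem runCount_cons (n : ℕ) (s : Bool) (l : List Bool) :
    runCount n (s :: l) = runCount n l + if leadRun (!s) l + 1 = n then 1 else 0 := rfl

@[simp] theorem altWord_zero (s : Bool) : altWord s 0 = [] := rfl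

theorem altWord_succ (s : Bool) (n : ℕ) : altWord s (n + 1) = s :: altWord (!s) n := rfl

@[simp] theorem length_altWord (s : Bool) (n : ℕ) : (altWord s n).length = n := by
  induction n generalizing s with
  | zero => rfl
  | succ n ih => simp [altWord_succ, ih]

theorem altWord_add (s : Bool) (m n : ℕ) :
    altWord s (m + n) = altWord s m ++ altWord (s ^^ m.bodd) n := by
  induction m generalizing s with
  | zero => simp
  | succ m ih =>
    rw [show m + 1 + n = (m + n) + 1 by ring, altWord_succ, ih, altWord_succ]
    cases s <;> cases h : m.bodd <;> simp [h]

theorem altWord_succ' (s : Bool) (n : ℕ) :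
    altWord s (n + 1) = altWord s n ++ [s ^^ n.bodd] := by
  rw [altWord_add]; rfl

theorem leadRun_altWord_append (s : Bool) (m : ℕ) (l : List Bool) :
    leadRun s (altWord s m ++ l) = m + leadRun (s ^^ m.bodd) l := by
  induction m generalizing s with
  | zero => simp
  | succ m ih =>
    rw [altWord_succ, List.cons_append, leadRun_cons_self, ih]
    cases s <;> cases h : m.bodd <;> simp [h] <;> ring

theorem take_leadRun (s : Bool) (l : List Bool) :
    ∀ m ≤ leadRun s l, l.take m = altWord s m := by
  induction l generalizing s with
  | nil => intro m hm; simp at hm; subst hm; rfl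
  | cons t l ih =>
    intro m hm
    rcases m with _ | m
    · simp
    · by_cases h : t = s
      · subst h
        simp only [leadRun_cons_self] at hm
        simp [altWord_succ, ih (!t) m (by omega)]
      · simp [leadRun, h] at hm

theorem eq_altWord_append_drop {s : Bool} {l : List Bool} {m : ℕ} (h : m ≤ leadRun s l) :
    l = altWord s m ++ l.drop m := by
  rw [← take_leadRun s l m h, List.take_append_drop]

theorem leadRun_drop {s : Bool} {l : List Bool} {m : ℕ} (h : m ≤ leadRun s l) :
    leadRun (s ^^ m.bodd) (l.drop m) = leadRun s l - m := by
  conv_rhs => rw [eq_altWord_append_drop h, leadRun_altWord_append]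
  omega

theorem le_leadRun_iff {s : Bool} {l : List Bool} {m : ℕ} :
    m ≤ leadRun s l ↔ altWord s m <+: l := by
  constructor
  · intro h
    exact ⟨_, (eq_altWord_append_drop h).symm⟩
  · rintro ⟨t, rfl⟩
    rw [leadRun_altWord_append]; omega

theorem leadRun_eq_zero_or (s : Bool) (l : List Bool) : leadRun s l = 0 ∨ leadRun (!s) l = 0 := by
  rcases l with _ | ⟨t, l⟩
  · simp
  · cases s <;> cases t <;> simp [leadRun]

theorem exists_cons_of_leadRun_pos {s : Bool} {l : List Bool} (h : leadRun s l ≠ 0) :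
    ∃ l', l = s :: l' := by
  rcases l with _ | ⟨t, l⟩
  · simp at h
  · by_cases hts : t = s
    · exact ⟨l, by rw [hts]⟩
    · simp [leadRun, hts] at h

theorem runsLT_append_right {k : ℕ} {l l' : List Bool} (h : RunsLT k (l ++ l')) : RunsLT k l' := by
  induction l with
  | nil => exact h
  | cons s l ih => exact ih h.2

theorem RunsLT.leadRun_lt {k : ℕ} {l : List Bool} (hk : 0 < k) (h : RunsLT k l) (s : Bool) :
    leadRun s l < k := by
  rcases l with _ | ⟨t, l⟩
  · simpa
  · by_cases hts : t = s
    · subst hts; simpa using h.1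
    · simpa [leadRun, hts] using hk

theorem RunsLT.drop {k : ℕ} {l : List Bool} (h : RunsLT k l) (m : ℕ) : RunsLT k (l.drop m) := by
  rw [← List.take_append_drop m l] at h
  exact runsLT_append_right h

theorem runsLT_altWord_append {k : ℕ} {s : Bool} {m : ℕ} {l : List Bool} (hm : m < k)
    (hl : leadRun (s ^^ m.bodd) l = 0) (h : RunsLT k l) : RunsLT k (altWord s m ++ l) := by
  induction m generalizing s with
  | zero => simpa
  | succ m ih =>
    have hl' : leadRun ((!s) ^^ m.bodd) l = 0 := by
      rw [← hl]; congr 1; cases s <;> cases h : m.bodd <;> simp [h]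
    rw [altWord_succ, List.cons_append]
    refine ⟨?_, ih (by omega) hl'⟩
    rw [leadRun_altWord_append, hl']; omega

theorem leadRun_twist (k : ℕ) (s : Bool) (l : List Bool) :
    leadRun (s ^^ k.bodd) (twist k l) = leadRun s l := by
  induction l generalizing s with
  | nil => rfl
  | cons t l ih =>
    have := ih (!s)
    simp only [twist, List.map_cons, leadRun] at this ⊢
    rw [← this]
    cases s <;> cases t <;> cases h : k.bodd <;> simp

theorem leadRun_twist' (k : ℕ) (s : Bool) (l : List Bool) :
    leadRun s (twist k l) = leadRun (s ^^ k.bodd) l := by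
  conv_rhs => rw [← leadRun_twist k]
  simp

@[simp] theorem twist_twist (k : ℕ) (l : List Bool) : twist k (twist k l) = l := by
  simp only [twist, List.map_map]
  conv_rhs => rw [← List.map_id l]
  congr 1
  ext1 s
  simp

@[simp] theorem twist_nil (k : ℕ) : twist k [] = [] := rfl

theorem twist_cons (k : ℕ) (s : Bool) (l : List Bool) :
    twist k (s :: l) = (s ^^ k.bodd) :: twist k l := rfl

theorem twist_append (k : ℕ) (l l' : List Bool) : twist k (l ++ l') = twist k l ++ twist k l' := by
  simp [twist]

theorem twist_altWord (k : ℕ) (s : Bool) (n : ℕ) :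
    twist k (altWord s n) = altWord (s ^^ k.bodd) n := by
  induction n generalizing s with
  | zero => rfl
  | succ n ih => rw [altWord_succ, twist_cons, ih, altWord_succ]; simp

theorem RunsLT.twist {k n : ℕ} {l : List Bool} (h : RunsLT k l) : RunsLT k (twist n l) := by
  induction l with
  | nil => trivial
  | cons s l ih =>
    rw [twist_cons]
    refine ⟨?_, ih h.2⟩
    rw [← Bool.not_xor, leadRun_twist]; exact h.1

theorem runCount_twist (k n : ℕ) (l : List Bool) : runCount n (twist k l) = runCount n l := by
  induction l with
  | nil => rfl
  | cons s l ih => rw [twist_cons, runCount_cons, runCount_cons, ih, ← Bool.not_xor, leadRun_twist]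

/-- Since `l` does not continue the alternation, the block is a complete run and has one letter at
each distance 1, …, `m` from its end. -/
theorem runCount_altWord_append {s : Bool} {m : ℕ} {l : List Bool} (n : ℕ)
    (hl : leadRun (s ^^ m.bodd) l = 0) :
    runCount n (altWord s m ++ l) = runCount n l + if 1 ≤ n ∧ n ≤ m then 1 else 0 := by
  induction m generalizing s with
  | zero => rw [if_neg (by omega)]; rfl
  | succ m ih =>
    have hl' : leadRun ((!s) ^^ m.bodd) l = 0 := by
      rw [← hl]; congr 1; cases s <;> cases h : m.bodd <;> simp [h]
    rw [altWord_succ, List.cons_append, runCount_cons, ih hl', leadRun_altWord_append, hl']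
    split_ifs <;> omega

theorem RunsLT.runCount_eq_zero {k n : ℕ} {l : List Bool} (h : RunsLT k l) (hn : k ≤ n) :
    runCount n l = 0 := by
  induction l with
  | nil => rfl
  | cons s l ih =>
    rw [runCount_cons, ih h.2, if_neg]
    have := h.1
    omega

/-- A leading run of length exactly `n` is counted on one side only. This strict half is part of the
induction because prepending a letter to such a run creates one of length `n + 1`. -/
theorem runCount_succ_le {l : List Bool} {n : ℕ} (hn : 1 ≤ n) :
    runCount (n + 1) l ≤ runCount n l ∧
      ∀ s, leadRun s l = n → runCount (n + 1) l + 1 ≤ runCount n l := by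
  induction l with
  | nil => simp; omega
  | cons s l ih =>
    obtain ⟨h1, h2⟩ := ih
    constructor
    · rw [runCount_cons, runCount_cons]
      split_ifs with h h' h' <;> first | omega | skip
      have := h2 (!s) (by omega); omega
    · intro t ht
      have hts : t = s := by
        by_contra hne
        have : s ≠ t := fun h => hne h.symm
        simp [leadRun, this] at ht; omega
      subst hts
      rw [leadRun_cons_self] at ht
      rw [runCount_cons, runCount_cons, if_pos ht, if_neg (by omega)]
      omega

theorem runCount_anti {l : List Bool} {m n : ℕ} (hm : 1 ≤ m) (hmn : m ≤ n) :
    runCount n l ≤ runCount m l := by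
  induction n, hmn using Nat.le_induction with
  | base => exact le_rfl
  | succ n hn ih => exact (runCount_succ_le (by omega)).1.trans ih

/-! ### The action on normal forms -/

/-- Left multiplication of the normal form `l Δ^r` by the generator `s`. -/
def stepGen (k : ℕ) (s : Bool) (x : List Bool × ℤ) : List Bool × ℤ :=
  if leadRun (!s) x.1 + 1 = k then (twist k (x.1.drop (k - 1)), x.2 + 1) else (s :: x.1, x.2)

/-- Left multiplication of the normal form `l Δ^r` by the inverse of the generator `s`. -/
def stepInv (k : ℕ) (s : Bool) (x : List Bool × ℤ) : List Bool × ℤ :=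
  if leadRun s x.1 = 0 then (altWord (!s) (k - 1) ++ twist k x.1, x.2 - 1) else (x.1.tail, x.2)

theorem runsLT_stepGen {k : ℕ} (hk : 0 < k) (s : Bool) {x : List Bool × ℤ} (hx : RunsLT k x.1) :
    RunsLT k (stepGen k s x).1 := by
  unfold stepGen
  split_ifs with h
  · exact (hx.drop _).twist
  · refine ⟨?_, hx⟩
    have := hx.leadRun_lt hk (!s)
    omega

/-- The letter that would continue an alternating block of `k - 1` letters starting with `!s` is the
image of `s` under conjugation by Δ. -/
theorem not_xor_pred_bodd {k : ℕ} (hk : 0 < k) (s : Bool) :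
    ((!s) ^^ (k - 1).bodd) = (s ^^ k.bodd) := by
  obtain ⟨k, rfl⟩ : ∃ m, k = m + 1 := ⟨k - 1, by omega⟩
  cases s <;> cases h : k.bodd <;> simp [h]

theorem runsLT_stepInv {k : ℕ} (hk : 0 < k) (s : Bool) {x : List Bool × ℤ} (hx : RunsLT k x.1) :
    RunsLT k (stepInv k s x).1 := by
  unfold stepInv
  split_ifs with h
  · refine runsLT_altWord_append (by omega) ?_ hx.twist
    rw [not_xor_pred_bodd hk, leadRun_twist, h]
  · simpa using hx.drop 1

theorem stepInv_stepGen {k : ℕ} (hk : 0 < k) (s : Bool) (x : List Bool × ℤ) :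
    stepInv k s (stepGen k s x) = x := by
  unfold stepGen
  split_ifs with h
  · have h1 : k - 1 ≤ leadRun (!s) x.1 := by omega
    have h2 := leadRun_drop h1
    rw [not_xor_pred_bodd hk] at h2
    -- The removed run had exactly `k - 1` letters, so the twisted remainder does not begin with `s`
    -- and the inverse step puts the run back.
    rw [stepInv, if_pos]
    · refine Prod.ext ?_ (by simp)
      simp only [twist_twist]
      exact (eq_altWord_append_drop h1).symm
    · rw [leadRun_twist', h2]; omega
  · simp [stepInv]

/-- The bound on runs matters when a leading `s` is deleted: fewer than `k - 1` letters of its run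
are left, so restoring `s` does not complete Δ. -/
theorem stepGen_stepInv {k : ℕ} (hk : 0 < k) (s : Bool) {x : List Bool × ℤ} (hx : RunsLT k x.1) :
    stepGen k s (stepInv k s x) = x := by
  unfold stepInv
  split_ifs with h
  · rw [stepGen, if_pos]
    · refine Prod.ext ?_ (by simp)
      simp
    · rw [leadRun_altWord_append, not_xor_pred_bodd hk, leadRun_twist, h]; omega
  · obtain ⟨l, hl⟩ := exists_cons_of_leadRun_pos h
    obtain ⟨l', r⟩ := x
    simp only at hl
    subst hl
    have := hx.1
    rw [stepGen, if_neg]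
    · simp
    · simp; omega

/-- The set of pairs `(l, r)` for which `l Δ^r` is in normal form. -/
abbrev NF (k : ℕ) : Type := {x : List Bool × ℤ // RunsLT k x.1}

/-- The permutation of normal forms induced by a generator. -/
def genPerm {k : ℕ} (hk : 0 < k) (s : Bool) : Equiv.Perm (NF k) where
  toFun x := ⟨stepGen k s x.1, runsLT_stepGen hk s x.2⟩
  invFun x := ⟨stepInv k s x.1, runsLT_stepInv hk s x.2⟩
  left_inv x := Subtype.ext (stepInv_stepGen hk s x.1)
  right_inv x := Subtype.ext (stepGen_stepInv hk s x.2)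

/-- A short block that does not merge with the run after it is simply prepended, because no
intermediate step completes Δ. -/
theorem genPerm_pile {k : ℕ} (hk : 0 < k) {s : Bool} {n : ℕ} (hn : n < k) {x : NF k}
    (hx : leadRun (s ^^ n.bodd) x.1.1 = 0) :
    ((((altWord s n).map (genPerm hk)).prod x).1) = (altWord s n ++ x.1.1, x.1.2) := by
  induction n generalizing s with
  | zero => simp
  | succ n ih =>
    have hl' : leadRun ((!s) ^^ n.bodd) x.1.1 = 0 := by
      rw [← hx]; congr 1; cases s <;> cases h : n.bodd <;> simp [h]
    have := ih (by omega) hl'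
    rw [altWord_succ, List.map_cons, List.prod_cons, Equiv.Perm.mul_apply]
    simp only [genPerm, Equiv.coe_fn_mk] at this ⊢
    rw [this, stepGen, if_neg]
    · rfl
    · rw [leadRun_altWord_append, hl']; omega

/-- The last `k - 1` letters pile up as a run, and the first letter completes it to Δ. -/
theorem genPerm_altWord_aux {k : ℕ} (hk : 0 < k) {s : Bool} {x : NF k}
    (hx : leadRun (s ^^ k.bodd) x.1.1 = 0) :
    ((((altWord s k).map (genPerm hk)).prod x).1) = (twist k x.1.1, x.1.2 + 1) := by
  obtain ⟨n, rfl⟩ : ∃ m, k = m + 1 := ⟨k - 1, by omega⟩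
  have hl' : leadRun ((!s) ^^ n.bodd) x.1.1 = 0 := by
    rw [← hx]; congr 1; cases s <;> cases h : n.bodd <;> simp [h]
  have := genPerm_pile hk (by omega) hl'
  rw [altWord_succ, List.map_cons, List.prod_cons, Equiv.Perm.mul_apply]
  simp only [genPerm, Equiv.coe_fn_mk] at this ⊢
  rw [this, stepGen, if_pos]
  · simp
  · rw [leadRun_altWord_append, hl']

/-- The result does not depend on `s`, which is the relation of A_k. When the leading run of `x`
would continue the block, it is first stripped off to reach the case without merging. -/
theorem genPerm_altWord {k : ℕ} (hk : 0 < k) (s : Bool) (x : NF k) :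
    ((((altWord s k).map (genPerm hk)).prod x).1) = (twist k x.1.1, x.1.2 + 1) := by
  set t := s ^^ k.bodd with ht
  set m := leadRun t x.1.1 with hm
  have hmk : m < k := x.2.leadRun_lt hk t
  have hsplit := eq_altWord_append_drop hm.le
  set y : NF k := ⟨(x.1.1.drop m, x.1.2), x.2.drop m⟩ with hy
  have hy0 : leadRun (t ^^ m.bodd) y.1.1 = 0 := by
    have := leadRun_drop hm.le
    rw [Nat.sub_eq_zero_of_le hm.ge] at this
    exact this
  have hxy : x = ((altWord t m).map (genPerm hk)).prod y := by
    apply Subtype.ext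
    rw [genPerm_pile hk hmk hy0]
    exact Prod.ext hsplit rfl
  -- Both sides are the alternating word of length `k + m`; reading it as `m` letters followed by
  -- `k` lets Δ act on the stripped form `y`.
  have hw : altWord s k ++ altWord t m = altWord s m ++ altWord (s ^^ m.bodd) k := by
    rw [ht, ← altWord_add, ← altWord_add, add_comm]
  have h1 : leadRun ((s ^^ m.bodd) ^^ k.bodd) y.1.1 = 0 := by
    rw [← hy0, ht]; congr 1; cases s <;> cases m.bodd <;> cases k.bodd <;> rfl
  have h2 := genPerm_altWord_aux hk h1
  set y' := ((altWord (s ^^ m.bodd) k).map (genPerm hk)).prod y with hy'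
  have h3 : leadRun (s ^^ m.bodd) y'.1.1 = 0 := by
    rw [h2]; simp only; rw [leadRun_twist', h1]
  rw [hxy, ← Equiv.Perm.mul_apply, ← List.prod_append, ← List.map_append, hw, List.map_append,
    List.prod_append, Equiv.Perm.mul_apply, ← hy', genPerm_pile hk hmk h3, h2,
    genPerm_pile hk hmk hy0, twist_append, twist_altWord, ht]
  simp

/-- The action of `A_k` on normal forms. -/
def actHom {k : ℕ} (hk : 0 < k) : Artin k →* Equiv.Perm (NF k) :=
  PresentedGroup.toGroup (f := genPerm hk) (by
    intro r hr
    rw [rels, Set.mem_singleton_iff] at hr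
    subst hr
    simp only [map_mul, map_inv, map_list_prod, List.map_map]
    rw [mul_inv_eq_one]
    have : (⇑(FreeGroup.lift (genPerm hk)) ∘ FreeGroup.of) = genPerm hk := by
      ext1 s; simp
    rw [this]
    ext1 x
    apply Subtype.ext
    rw [genPerm_altWord, genPerm_altWord])

theorem actHom_gen {k : ℕ} (hk : 0 < k) (s : Bool) : actHom hk (gen k s) = genPerm hk s :=
  PresentedGroup.toGroup.of _

theorem actHom_wordProd {k : ℕ} (hk : 0 < k) (l : List Bool) :
    actHom hk (wordProd k l) = (l.map (genPerm hk)).prod := by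
  rw [wordProd, map_list_prod, List.map_map]
  congr 1

/-! ### Positive words in the group, and the existence and uniqueness of normal forms. -/

@[simp] theorem wordProd_nil (k : ℕ) : wordProd k [] = 1 := rfl

theorem wordProd_cons (k : ℕ) (s : Bool) (l : List Bool) :
    wordProd k (s :: l) = gen k s * wordProd k l := by simp [wordProd]

theorem wordProd_append (k : ℕ) (l l' : List Bool) :
    wordProd k (l ++ l') = wordProd k l * wordProd k l' := by simp [wordProd]

theorem alt_eq_garside (k : ℕ) (s : Bool) : alt k s k = garside k := by
  cases s
  · rfl
  · have : (PresentedGroup.mk (rels k)) (((altWord false k).map FreeGroup.of).prod *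
        ((altWord true k).map FreeGroup.of).prod⁻¹) = 1 :=
      PresentedGroup.one_of_mem (by simp [rels])
    rw [map_mul, map_inv, mul_inv_eq_one, map_list_prod, map_list_prod, List.map_map,
      List.map_map] at this
    exact this.symm

theorem garside_mul_gen (k : ℕ) (s : Bool) :
    garside k * gen k s = gen k (s ^^ k.bodd) * garside k := by
  have h : alt k (s ^^ k.bodd) (k + 1) = garside k * gen k s := by
    rw [← alt_eq_garside k (s ^^ k.bodd), alt, altWord_succ', wordProd_append, alt]
    simp [wordProd]
  have h' : alt k (s ^^ k.bodd) (k + 1) = gen k (s ^^ k.bodd) * garside k := by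
    rw [alt, altWord_succ, wordProd_cons, ← alt_eq_garside k (!(s ^^ k.bodd)), alt]
  rw [← h, h']

theorem garside_mul_wordProd (k : ℕ) (l : List Bool) :
    garside k * wordProd k l = wordProd k (twist k l) * garside k := by
  induction l with
  | nil => simp
  | cons s l ih =>
    rw [wordProd_cons, ← mul_assoc, garside_mul_gen, mul_assoc, ih, twist_cons, wordProd_cons,
      mul_assoc]

theorem gen_mul_alt {k : ℕ} (hk : 0 < k) (s : Bool) :
    gen k s * alt k (!s) (k - 1) = garside k := by
  rw [← alt_eq_garside k s, alt, alt, ← wordProd_cons, ← altWord_succ]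
  congr 2; omega

/-- Induction along left multiplication by generators and their inverses. -/
theorem artin_induction {k : ℕ} {p : Artin k → Prop} (one : p 1)
    (mul : ∀ s x, p x → p (gen k s * x)) (inv_mul : ∀ s x, p x → p ((gen k s)⁻¹ * x))
    (x : Artin k) : p x := by
  have key : ∀ x y : Artin k, p y → p (x * y) := by
    intro x
    induction x using PresentedGroup.induction_on with
    | _ z =>
      induction z using FreeGroup.induction_on with
      | C1 => intro y hy; simpa using hy
      | of s => intro y hy; exact mul s y hy
      | inv_of s _ => intro y hy; rw [map_inv]; exact inv_mul s y hy
      | mul a b ha hb => intro y hy; rw [map_mul, mul_assoc]; exact ha _ (hb _ hy)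
  simpa using key x 1 one

/-- The group element `l Δ^r`. -/
def ofNF (k : ℕ) (x : List Bool × ℤ) : Artin k := wordProd k x.1 * garside k ^ x.2

theorem ofNF_stepGen {k : ℕ} (hk : 0 < k) (s : Bool) (x : List Bool × ℤ) :
    ofNF k (stepGen k s x) = gen k s * ofNF k x := by
  unfold stepGen
  split_ifs with h
  · have h1 : k - 1 ≤ leadRun (!s) x.1 := by omega
    unfold ofNF
    conv_rhs => rw [eq_altWord_append_drop h1]
    rw [wordProd_append, ← mul_assoc, ← mul_assoc, ← alt, gen_mul_alt hk, garside_mul_wordProd,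
      mul_assoc, ← zpow_one_add, add_comm]
  · simp [ofNF, wordProd_cons, mul_assoc]

theorem ofNF_actHom {k : ℕ} (hk : 0 < k) (g : Artin k) (x : NF k) :
    ofNF k (actHom hk g x).1 = g * ofNF k x.1 := by
  induction g using artin_induction generalizing x with
  | one => simp
  | mul s g ih =>
    rw [map_mul, Equiv.Perm.mul_apply, actHom_gen, mul_assoc, ← ih, ← ofNF_stepGen hk]; rfl
  | inv_mul s g ih =>
    rw [map_mul, Equiv.Perm.mul_apply, map_inv, actHom_gen, mul_assoc, ← ih, eq_inv_mul_iff_mul_eq,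
      ← ofNF_stepGen hk]
    congr 1
    exact congrArg Subtype.val (Equiv.apply_symm_apply (genPerm hk s) _)

/-- The normal form `(l, r)` of a group element `l Δ^r`. -/
def nf {k : ℕ} (hk : 0 < k) (g : Artin k) : List Bool × ℤ :=
  (actHom hk g ⟨([], 0), trivial⟩).1

theorem runsLT_nf {k : ℕ} (hk : 0 < k) (g : Artin k) : RunsLT k (nf hk g).1 :=
  (actHom hk g ⟨([], 0), trivial⟩).2

theorem ofNF_nf {k : ℕ} (hk : 0 < k) (g : Artin k) : ofNF k (nf hk g) = g := by
  rw [nf, ofNF_actHom]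
  simp [ofNF]

theorem nf_gen_mul {k : ℕ} (hk : 0 < k) (s : Bool) (g : Artin k) :
    nf hk (gen k s * g) = stepGen k s (nf hk g) := by
  rw [nf, map_mul, Equiv.Perm.mul_apply, actHom_gen]; rfl

theorem nf_gen_inv_mul {k : ℕ} (hk : 0 < k) (s : Bool) (g : Artin k) :
    nf hk ((gen k s)⁻¹ * g) = stepInv k s (nf hk g) := by
  rw [nf, map_mul, Equiv.Perm.mul_apply, map_inv, actHom_gen]; rfl

theorem nf_garside_mul {k : ℕ} (hk : 0 < k) (g : Artin k) :
    nf hk (garside k * g) = (twist k (nf hk g).1, (nf hk g).2 + 1) := by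
  rw [nf, map_mul, Equiv.Perm.mul_apply, garside, alt, actHom_wordProd, genPerm_altWord]; rfl

theorem nf_garside_zpow {k : ℕ} (hk : 0 < k) (r : ℤ) : nf hk (garside k ^ r) = ([], r) := by
  induction r using Int.induction_on with
  | zero => simp [nf]
  | succ n ih => rw [add_comm, zpow_one_add, nf_garside_mul, ih]; simp [add_comm]
  | pred n ih =>
    have h := nf_garside_mul hk (garside k ^ (-(n : ℤ) - 1))
    rw [← zpow_one_add, add_sub_cancel, ih] at h
    rw [Prod.ext_iff] at h
    refine Prod.ext ?_ (by simp only; linarith [h.2])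
    have := congrArg (twist k) h.1
    simpa using this.symm

/-- Building a word with short runs letter by letter from its end never completes Δ, so each letter
is merely prepended. With `ofNF_nf` this gives uniqueness of the normal form. -/
theorem nf_ofNF {k : ℕ} (hk : 0 < k) {x : List Bool × ℤ} (hx : RunsLT k x.1) :
    nf hk (ofNF k x) = x := by
  obtain ⟨l, r⟩ := x
  induction l with
  | nil => simp [ofNF, nf_garside_zpow]
  | cons s l ih =>
    have h := ih hx.2
    rw [ofNF] at h ⊢
    simp only at h ⊢
    rw [wordProd_cons, mul_assoc, nf_gen_mul, h, stepGen, if_neg]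
    have := hx.1
    simp only; omega

theorem nf_wordProd {k : ℕ} (hk : 0 < k) {l : List Bool} (hl : RunsLT k l) :
    nf hk (wordProd k l) = (l, 0) := by
  simpa [ofNF] using nf_ofNF hk (x := (l, 0)) hl

/-! ### Decomposition of a word into runs -/

/-- The concatenation of the alternating words `altWord s n`, for `(s, n)` in a list. -/
def flat : List (Bool × ℕ) → List Bool
  | [] => []
  | p :: ps => altWord p.1 p.2 ++ flat ps

/-- The alternating words given by the list are the maximal runs of their concatenation, and they
have fewer than `k` letters. -/
def IsRunList (k : ℕ) : List (Bool × ℕ) → Prop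
  | [] => True
  | p :: ps => 1 ≤ p.2 ∧ p.2 < k ∧ leadRun (p.1 ^^ p.2.bodd) (flat ps) = 0 ∧ IsRunList k ps

theorem IsRunList.runsLT {k : ℕ} {ps : List (Bool × ℕ)} (h : IsRunList k ps) :
    RunsLT k (flat ps) := by
  induction ps with
  | nil => trivial
  | cons p ps ih => exact runsLT_altWord_append h.2.1 h.2.2.1 (ih h.2.2.2)

theorem IsRunList.runCount {k n : ℕ} (hn : 1 ≤ n) {ps : List (Bool × ℕ)} (h : IsRunList k ps) :
    runCount n (flat ps) = runCount (n + 1) (flat ps) + ps.countP (fun p => p.2 = n) := by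
  induction ps with
  | nil => rfl
  | cons p ps ih =>
    rw [flat, runCount_altWord_append _ h.2.2.1, runCount_altWord_append _ h.2.2.1,
      List.countP_cons, ih h.2.2.2]
    simp only [decide_eq_true_eq]
    split_ifs <;> omega

theorem IsRunList.length_eq {k : ℕ} {ps : List (Bool × ℕ)} (h : IsRunList k ps) :
    DihedralArtin.runCount 1 (flat ps) = ps.length := by
  induction ps with
  | nil => rfl
  | cons p ps ih =>
    rw [flat, runCount_altWord_append _ h.2.2.1, ih h.2.2.2, if_pos ⟨le_rfl, h.1⟩, List.length_cons]

theorem IsRunList.eq_of_flat_eq {k : ℕ} {ps qs : List (Bool × ℕ)} (h : IsRunList k ps)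
    (h' : IsRunList k qs) (e : flat ps = flat qs) : ps = qs := by
  induction ps generalizing qs with
  | nil =>
    rcases qs with _ | ⟨⟨s, n⟩, qs⟩
    · rfl
    · have h1 := h'.1
      have := congrArg List.length e
      simp [flat] at this
      omega
  | cons p ps ih =>
    rcases qs with _ | ⟨⟨t, n⟩, qs⟩
    · have h1 := h.1
      have := congrArg List.length e
      simp [flat] at this
      omega
    · obtain ⟨s, m⟩ := p
      have h1 : 1 ≤ m := h.1
      have h2 : 1 ≤ n := h'.1
      have e1 : leadRun s (flat ((s, m) :: ps)) = m := by
        rw [flat, leadRun_altWord_append, h.2.2.1, add_zero]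
      have e2 : leadRun t (flat ((t, n) :: qs)) = n := by
        rw [flat, leadRun_altWord_append, h'.2.2.1, add_zero]
      have hst : s = t := by
        by_contra hne
        have : t = !s := by cases s <;> cases t <;> simp_all
        rcases leadRun_eq_zero_or s (flat ((s, m) :: ps)) with h0 | h0
        · omega
        · rw [← this, e] at h0; omega
      subst hst
      have hmn : m = n := by rw [← e1, e, e2]
      subst hmn
      rw [ih h.2.2.2 h'.2.2.2 (List.append_cancel_left e)]

theorem exists_runList {k : ℕ} (hk : 0 < k) {l : List Bool} (hl : RunsLT k l) :
    ∃ ps, IsRunList k ps ∧ flat ps = l := by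
  induction hn : l.length using Nat.strong_induction_on generalizing l with
  | _ n ih =>
    rcases l with _ | ⟨s, l'⟩
    · exact ⟨[], trivial, rfl⟩
    · set l := s :: l' with hl'
      set m := leadRun s l with hm
      have hm1 : 1 ≤ m := by rw [hm, hl', leadRun_cons_self]; omega
      obtain ⟨ps, h1, h2⟩ := ih (l.drop m).length (by
        have : 1 ≤ l.length := by rw [hl']; simp
        rw [List.length_drop]; omega)
        (hl.drop m) rfl
      refine ⟨(s, m) :: ps, ⟨hm1, hl.leadRun_lt hk s, ?_, h1⟩, ?_⟩
      · rw [h2, leadRun_drop hm.le]; exact Nat.sub_eq_zero_of_le hm.ge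
      · rw [flat, h2]; exact (eq_altWord_append_drop hm.le).symm

/-! ### The left normal form -/

theorem wordProd_flat (k : ℕ) (ps : List (Bool × ℕ)) :
    wordProd k (flat ps) = (ps.map fun p => alt k p.1 p.2).prod := by
  induction ps with
  | nil => rfl
  | cons p ps ih => rw [flat, wordProd_append, ih]; rfl

theorem nf_alt_mul {k : ℕ} (hk : 0 < k) {s : Bool} {m : ℕ} (hm : m < k) {g : Artin k}
    (h : leadRun (s ^^ m.bodd) (nf hk g).1 = 0) :
    nf hk (alt k s m * g) = (altWord s m ++ (nf hk g).1, (nf hk g).2) := by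
  rw [nf, map_mul, Equiv.Perm.mul_apply, alt, actHom_wordProd, genPerm_pile hk hm h]; rfl

/-- The new factor continues the leading run. The merged block either is still shorter than Δ, or
splits off one Δ and leaves at most one run in place of the old one. -/
theorem runCount_one_alt_mul_le {k : ℕ} (hk : 0 < k) {s : Bool} {m : ℕ} (hm : m < k) {g : Artin k}
    (h : leadRun (s ^^ m.bodd) (nf hk g).1 ≠ 0) :
    runCount 1 (nf hk (alt k s m * g)).1 ≤ runCount 1 (nf hk g).1 := by
  set l := (nf hk g).1 with hl
  set t := s ^^ m.bodd with ht
  set c := leadRun t l with hc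
  have hlk := runsLT_nf hk g
  have hck : c < k := hlk.leadRun_lt hk t
  have hsplit := eq_altWord_append_drop hc.le
  have hrest : leadRun (t ^^ c.bodd) (l.drop c) = 0 := by
    rw [leadRun_drop hc.le]; exact Nat.sub_eq_zero_of_le hc.ge
  have hcount : runCount 1 l = runCount 1 (l.drop c) + 1 := by
    conv_lhs => rw [hsplit]
    rw [runCount_altWord_append _ hrest, if_pos ⟨le_rfl, by omega⟩]
  set g' := ofNF k (l.drop c, (nf hk g).2) with hg'
  have hnf' : nf hk g' = (l.drop c, (nf hk g).2) := nf_ofNF hk (hlk.drop c)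
  have hg : g = alt k t c * g' := by
    conv_lhs => rw [← ofNF_nf hk g]
    rw [hg', ofNF, ofNF, ← mul_assoc, alt, ← wordProd_append, ← hsplit]
  have hprod : alt k s m * g = alt k s (m + c) * g' := by
    conv_lhs => rw [hg]
    rw [← mul_assoc, alt, alt, ← wordProd_append, ← altWord_add, alt]
  rw [hprod, hcount]
  have hrest' : leadRun (s ^^ (m + c).bodd) (l.drop c) = 0 := by
    rw [← hrest, ht, Nat.bodd_add]; simp
  rcases lt_or_ge (m + c) k with hlt | hge
  · rw [nf_alt_mul hk hlt (by rw [hnf']; exact hrest'), hnf', runCount_altWord_append _ hrest']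
    split_ifs <;> omega
  -- The last `k` letters of the merged block form Δ; the other `d < k` letters meet the twisted
  -- remainder without merging.
  · obtain ⟨d, hd⟩ := Nat.exists_eq_add_of_le' hge
    have e : alt k s (m + c) * g' = alt k s d * (garside k * g') := by
      rw [← alt_eq_garside k (s ^^ d.bodd), ← mul_assoc, hd, alt, altWord_add, wordProd_append]
      rfl
    have hrest'' : leadRun (s ^^ d.bodd) (nf hk (garside k * g')).1 = 0 := by
      rw [nf_garside_mul, leadRun_twist', hnf', ← hrest', hd, Nat.bodd_add]; simp
    rw [e, nf_alt_mul hk (by omega) hrest'', runCount_altWord_append _ hrest'', nf_garside_mul,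
      runCount_twist, hnf']
    split_ifs <;> simp

/-- A factor adds a run only if it does not merge with what follows. Hence the number of runs bounds
the number of factors from below, and equality means that no factor ever merges. -/
theorem runCount_one_nf_le {k : ℕ} (hk : 0 < k) {ps : List (Bool × ℕ)}
    (hps : ∀ p ∈ ps, 1 ≤ p.2 ∧ p.2 < k) :
    runCount 1 (nf hk (wordProd k (flat ps))).1 ≤ ps.length ∧
      (runCount 1 (nf hk (wordProd k (flat ps))).1 = ps.length → IsRunList k ps) := by
  induction ps with
  | nil => simp [flat, IsRunList, nf]
  | cons p ps ih =>
    obtain ⟨h1, h2⟩ := ih fun q hq => hps q (List.mem_cons_of_mem _ hq)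
    obtain ⟨hp, hpk⟩ := hps p List.mem_cons_self
    rw [flat, wordProd_append, ← alt, List.length_cons]
    by_cases h : leadRun (p.1 ^^ p.2.bodd) (nf hk (wordProd k (flat ps))).1 = 0
    · rw [nf_alt_mul hk hpk h, runCount_altWord_append _ h, if_pos ⟨le_rfl, hp⟩]
      refine ⟨by omega, fun he => ?_⟩
      have h3 := h2 (by omega)
      rw [nf_wordProd hk h3.runsLT] at h
      exact ⟨hp, hpk, h, h3⟩
    · have := runCount_one_alt_mul_le hk hpk h
      exact ⟨by omega, fun he => by omega⟩

/-- Conjugation by a power of the Garside element, on words. -/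
def twistPow (k : ℕ) (r : ℤ) (l : List Bool) : List Bool := if Even r then l else twist k l

theorem twistPow_twistPow (k : ℕ) (r : ℤ) (l : List Bool) :
    twistPow k r (twistPow k r l) = l := by
  unfold twistPow; split_ifs <;> simp

theorem runCount_twistPow (k n : ℕ) (r : ℤ) (l : List Bool) :
    runCount n (twistPow k r l) = runCount n l := by
  unfold twistPow; split_ifs <;> simp [runCount_twist]

theorem RunsLT.twistPow {k : ℕ} {l : List Bool} (h : RunsLT k l) (r : ℤ) :
    RunsLT k (twistPow k r l) := by
  unfold DihedralArtin.twistPow; split_ifs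
  exacts [h, h.twist]

theorem twist_twistPow (k : ℕ) (r : ℤ) (l : List Bool) :
    twist k (twistPow k r l) = twistPow k (r + 1) l := by
  unfold twistPow
  by_cases h : Even r
  · rw [if_pos h, if_neg (by simpa [Int.even_add_one] using h)]
  · rw [if_neg h, if_pos (by simpa [Int.even_add_one] using h), twist_twist]

theorem nf_garside_zpow_mul {k : ℕ} (hk : 0 < k) (r : ℤ) (g : Artin k) :
    nf hk (garside k ^ r * g) = (twistPow k r (nf hk g).1, (nf hk g).2 + r) := by
  induction r using Int.induction_on with
  | zero => simp [twistPow]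
  | succ n ih =>
    rw [add_comm, zpow_one_add, mul_assoc, nf_garside_mul, ih]
    simp only [twist_twistPow]
    rw [add_comm 1, add_assoc]
  | pred n ih =>
    have h := nf_garside_mul hk (garside k ^ (-(n : ℤ) - 1) * g)
    rw [← mul_assoc, ← zpow_one_add, add_sub_cancel, ih, Prod.ext_iff] at h
    refine Prod.ext ?_ (by have := h.2; simp only at this ⊢; linarith)
    have := congrArg (twist k) h.1
    simp only [twist_twist, twist_twistPow] at this
    rw [← this]
    unfold twistPow
    simp only [Int.even_add, Int.even_sub]

theorem exists_map_alt {k : ℕ} {ys : List (Artin k)} (h : ∀ y ∈ ys, y ∈ Mplus k) :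
    ∃ ps : List (Bool × ℕ), (∀ p ∈ ps, 1 ≤ p.2 ∧ p.2 < k) ∧
      ys = ps.map fun p => alt k p.1 p.2 := by
  induction ys with
  | nil => exact ⟨[], by simp, rfl⟩
  | cons y ys ih =>
    obtain ⟨ps, h1, h2⟩ := ih fun z hz => h z (List.mem_cons_of_mem _ hz)
    obtain ⟨n, hn1, hn2, s, hs⟩ := h y List.mem_cons_self
    refine ⟨(s, n) :: ps, ?_, by rw [hs, h2]; rfl⟩
    intro p hp
    rcases List.mem_cons.1 hp with rfl | hp
    exacts [⟨hn1, hn2⟩, h1 p hp]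

theorem IsRunList.bounds {k : ℕ} {ps : List (Bool × ℕ)} (h : IsRunList k ps) :
    ∀ p ∈ ps, 1 ≤ p.2 ∧ p.2 < k := by
  induction ps with
  | nil => simp
  | cons p ps ih =>
    intro q hq
    rcases List.mem_cons.1 hq with rfl | hq
    exacts [⟨h.1, h.2.1⟩, ih h.2.2.2 q hq]

/-- The least number of factors is the number of runs. The left normal form has its power of Δ on
the left while `nf` has it on the right; moving it across conjugates the letters, whence `twistPow`.
-/
theorem isLeftNormalForm_iff {k : ℕ} (hk : 0 < k) {x : Artin k} {f : ℤ × List (Artin k)} :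
    IsLeftNormalForm k x f ↔ f.1 = (nf hk x).2 ∧ ∃ ps, IsRunList k ps ∧
      flat ps = twistPow k f.1 (nf hk x).1 ∧ f.2 = ps.map fun p => alt k p.1 p.2 := by
  have expr : ∀ ps, IsRunList k ps → flat ps = twistPow k (nf hk x).2 (nf hk x).1 →
      IsGarsideExpr k x ((nf hk x).2, ps.map fun p => alt k p.1 p.2) := by
    intro ps hps hfl
    constructor
    · intro y hy
      obtain ⟨p, hp, rfl⟩ := List.mem_map.1 hy
      exact ⟨p.2, (hps.bounds p hp).1, (hps.bounds p hp).2, p.1, rfl⟩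
    · rw [← ofNF_nf hk (garside k ^ _ * _), nf_garside_zpow_mul]
      simp only
      rw [← wordProd_flat, nf_wordProd hk hps.runsLT, hfl, twistPow_twistPow, zero_add]
      exact (ofNF_nf hk x).symm
  have lower : ∀ f, IsGarsideExpr k x f → runCount 1 (nf hk x).1 ≤ f.2.length ∧
      (runCount 1 (nf hk x).1 = f.2.length → f.1 = (nf hk x).2 ∧ ∃ ps, IsRunList k ps ∧
      flat ps = twistPow k f.1 (nf hk x).1 ∧ f.2 = ps.map fun p => alt k p.1 p.2) := by
    rintro ⟨r, ys⟩ ⟨hM, hx⟩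
    obtain ⟨ps, hb, rfl⟩ := exists_map_alt hM
    rw [← wordProd_flat] at hx
    have hnf := nf_garside_zpow_mul hk r (wordProd k (flat ps))
    simp only at hx
    rw [← hx] at hnf
    obtain ⟨h1, h2⟩ := runCount_one_nf_le hk hb
    rw [hnf]
    simp only [runCount_twistPow, List.length_map]
    refine ⟨h1, fun he => ?_⟩
    have h3 := h2 he
    rw [nf_wordProd hk h3.runsLT]
    exact ⟨by simp, ps, h3, by rw [twistPow_twistPow], rfl⟩
  obtain ⟨ps, hps, hfl⟩ := exists_runList hk ((runsLT_nf hk x).twistPow (nf hk x).2)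
  have hlen : ps.length = runCount 1 (nf hk x).1 := by
    rw [← hps.length_eq, hfl, runCount_twistPow]
  constructor
  · rintro ⟨h1, h2⟩
    refine (lower f h1).2 (le_antisymm (lower f h1).1 ?_)
    have := h2 _ (expr ps hps hfl)
    simpa [hlen] using this
  · obtain ⟨r, ys⟩ := f
    rintro ⟨h1, qs, hqs, hq, rfl⟩
    simp only at h1 hq ⊢
    subst h1
    refine ⟨expr qs hqs hq, fun f' hf' => ?_⟩
    have := (lower f' hf').1
    simp only [List.length_map]
    rwa [← hqs.length_eq, hq, runCount_twistPow]

theorem existsUnique_leftNormalForm {k : ℕ} (hk : 0 < k) (x : Artin k) :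
    ∃! f, IsLeftNormalForm k x f := by
  simp only [isLeftNormalForm_iff hk]
  obtain ⟨ps, hps, hfl⟩ := exists_runList hk ((runsLT_nf hk x).twistPow (nf hk x).2)
  refine ⟨((nf hk x).2, ps.map fun p => alt k p.1 p.2), ⟨rfl, ps, hps, hfl, rfl⟩, ?_⟩
  rintro ⟨r, ys⟩ ⟨h1, qs, hqs, hq, h2⟩
  simp only at h1 h2 hq
  subst h1
  rw [h2, hqs.eq_of_flat_eq hps (hq.trans hfl.symm)]

theorem isAlt_alt_iff {k : ℕ} (s : Bool) {m n : ℕ} (hm : m < k) (hn : n < k) :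
    IsAlt k (alt k s m) n ↔ m = n := by
  constructor
  · rintro ⟨t, ht⟩
    have hk : 0 < k := by omega
    have key : ∀ (u : Bool) (c : ℕ), c < k → (nf hk (alt k u c)).1.length = c := by
      intro u c hc
      have : RunsLT k (altWord u c) := by
        simpa using runsLT_altWord_append (s := u) (l := []) hc rfl trivial
      rw [alt, nf_wordProd hk this, length_altWord]
    rw [← key s m hm, ht, key t n hn]
  · rintro rfl
    exact ⟨s, rfl⟩

theorem leftNormalForm_spec {k : ℕ} (hk : 0 < k) (x : Artin k) :
    IsLeftNormalForm k x (leftNormalForm k x) :=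
  Classical.epsilon_spec (existsUnique_leftNormalForm hk x).exists

theorem runCount_eq_add_numFactors {k : ℕ} (hk : 0 < k) (x : Artin k) {n : ℕ} (h1 : 1 ≤ n)
    (hn : n < k) :
    runCount n (nf hk x).1 = runCount (n + 1) (nf hk x).1 + numFactors k x n := by
  obtain ⟨-, ps, hps, hfl, h⟩ := (isLeftNormalForm_iff hk).1 (leftNormalForm_spec hk x)
  have := hps.runCount h1
  rw [hfl, runCount_twistPow, runCount_twistPow] at this
  rw [this, numFactors, h, List.countP_map]
  congr 1
  apply List.countP_congr
  intro p hp
  simp [isAlt_alt_iff p.1 (hps.bounds p hp).2 hn]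

/-- The vector `π` in terms of the normal form. -/
theorem piVec_eq {k : ℕ} (hk : 0 < k) (x : Artin k) (i : Fin k) :
    piVec k x i = (nf hk x).2 + runCount (k - i) (nf hk x).1 := by
  have h1 := ((isLeftNormalForm_iff hk).1 (leftNormalForm_spec hk x)).1
  rw [piVec, h1]
  congr 1
  obtain ⟨i, hi⟩ := i
  simp only
  induction i with
  | zero => simp [(runsLT_nf hk x).runCount_eq_zero]
  | succ i ih =>
    rw [← Finset.insert_Icc_right_eq_Icc_add_one (by omega), Finset.sum_insert (by simp),
      ih (by omega)]
    have := runCount_eq_add_numFactors hk x (n := k - (i + 1)) (by omega) (by omega)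
    rw [show k - (i + 1) + 1 = k - i by omega] at this
    rw [this]; push_cast; ring

/-! ### The effect of a generator on `π`, and the length formula -/

/-- A prepended letter has distance `leadRun + 1` from the end of its run, so one run count grows.
If it completes Δ, the loss of a run of length `k - 1` cancels the gain in the exponent in all
coordinates except 0. -/
theorem piVec_gen_mul {k : ℕ} (hk : 0 < k) (s : Bool) (x : Artin k) :
    piVec k (gen k s * x) = piVec k x +
      Pi.single (⟨k - 1 - leadRun (!s) (nf hk x).1, by omega⟩ : Fin k) 1 := by
  have hlt := (runsLT_nf hk x).leadRun_lt hk (!s)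
  ext i
  obtain ⟨i, hi⟩ := i
  rw [Pi.add_apply, piVec_eq hk, piVec_eq hk, nf_gen_mul, Pi.single_apply]
  simp only [Fin.mk.injEq]
  unfold stepGen
  split_ifs with h h' h'
  · simp only [runCount_twist]
    conv_rhs => rw [eq_altWord_append_drop (show k - 1 ≤ leadRun (!s) (nf hk x).1 by omega)]
    rw [runCount_altWord_append, if_neg (by omega)]
    · push_cast; ring
    · rw [leadRun_drop (by omega)]; omega
  · simp only [runCount_twist]
    conv_rhs => rw [eq_altWord_append_drop (show k - 1 ≤ leadRun (!s) (nf hk x).1 by omega)]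
    rw [runCount_altWord_append, if_pos (by omega)]
    · push_cast; ring
    · rw [leadRun_drop (by omega)]; omega
  · rw [runCount_cons, if_pos (by omega)]; push_cast; ring
  · rw [runCount_cons, if_neg (by omega)]; push_cast; ring

/-- The `ℓ¹` norm. -/
def absSum {k : ℕ} (v : Fin k → ℤ) : ℤ := ∑ i, |v i|

theorem absSum_add_single {k : ℕ} (v : Fin k → ℤ) (j : Fin k) (c : ℤ) :
    absSum (v + Pi.single j c) = absSum v - |v j| + |v j + c| := by
  have : absSum (v + Pi.single j c) - absSum v = |v j + c| - |v j| := by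
    rw [absSum, absSum, ← Finset.sum_sub_distrib, Finset.sum_eq_single j]
    · simp
    · intro i _ hi
      simp [Pi.single_eq_of_ne hi]
    · simp
  linarith

theorem absSum_nonneg {k : ℕ} (v : Fin k → ℤ) : 0 ≤ absSum v :=
  Finset.sum_nonneg fun _ _ => abs_nonneg _

theorem piVec_garside_zpow {k : ℕ} (hk : 0 < k) (r : ℤ) (i : Fin k) :
    piVec k (garside k ^ r) i = r := by
  rw [piVec_eq hk, nf_garside_zpow]; simp

theorem piVec_one {k : ℕ} (hk : 0 < k) : piVec k (1 : Artin k) = 0 := by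
  ext i
  simpa using piVec_garside_zpow hk 0 i

theorem absSum_piVec_le {k : ℕ} (hk : 0 < k) {l : List (Artin k)} (hl : ∀ g ∈ l, g ∈ genSet k) :
    absSum (piVec k l.prod) ≤ l.length := by
  induction l with
  | nil => simp [piVec_one hk, absSum]
  | cons g l ih =>
    have h1 := ih fun g hg => hl g (List.mem_cons_of_mem _ hg)
    obtain ⟨s, rfl | rfl⟩ := hl g List.mem_cons_self
    · rw [List.prod_cons, piVec_gen_mul hk, absSum_add_single, List.length_cons]
      have := abs_add_le (piVec k l.prod ⟨k - 1 - leadRun (!s) (nf hk l.prod).1, by omega⟩) 1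
      simp only [abs_one] at this
      push_cast
      linarith
    · rw [List.prod_cons, List.length_cons]
      set x := (gen k s)⁻¹ * l.prod with hx
      have hx' : l.prod = gen k s * x := by rw [hx]; group
      rw [hx', piVec_gen_mul hk, absSum_add_single] at h1
      set j : Fin k := ⟨k - 1 - leadRun (!s) (nf hk x).1, by omega⟩
      have := abs_sub_abs_le_abs_sub (piVec k x j) (piVec k x j + 1)
      have e : |piVec k x j - (piVec k x j + 1)| = 1 := by ring_nf; simp
      rw [e] at this
      push_cast
      linarith

/-- A leading run of length L makes π jump between the coordinates `k - L - 1` and `k - L`. Deleting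
its first letter lowers the upper one and extending the run raises the lower one; by the jump, the
upper is positive or the lower negative. -/
theorem exists_gen_decreasing {k : ℕ} (hk : 1 < k) {x : Artin k} (hx : piVec k x ≠ 0) :
    ∃ s, absSum (piVec k (gen k s * x)) = absSum (piVec k x) - 1 ∨
      absSum (piVec k ((gen k s)⁻¹ * x)) = absSum (piVec k x) - 1 := by
  have hk0 : 0 < k := by omega
  rcases hl : (nf hk0 x).1 with _ | ⟨s, l⟩
  · have hpi : ∀ i, piVec k x i = (nf hk0 x).2 := fun i => by rw [piVec_eq hk0, hl]; simp
    have hr : (nf hk0 x).2 ≠ 0 := fun h => hx (by ext i; rw [hpi, h]; rfl)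
    rcases lt_or_gt_of_ne hr with hr | hr
    · refine ⟨false, Or.inl ?_⟩
      rw [piVec_gen_mul hk0, absSum_add_single, hpi, abs_of_neg hr, abs_of_nonpos (by omega)]
      ring
    · refine ⟨false, Or.inr ?_⟩
      set y := (gen k false)⁻¹ * x with hy
      have hxy : x = gen k false * y := by rw [hy]; group
      have h := piVec_gen_mul hk0 false y
      rw [← hxy] at h
      set j : Fin k := ⟨k - 1 - leadRun (!false) (nf hk0 y).1, by omega⟩
      have hj := congrFun h j
      rw [hpi] at hj
      simp only [Pi.add_apply, Pi.single_eq_same] at hj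
      rw [h, absSum_add_single, abs_of_nonneg (by omega), abs_of_nonneg (by omega)]
      ring
  · set L := leadRun s (nf hk0 x).1 with hL
    have hLk : L < k := (runsLT_nf hk0 x).leadRun_lt hk0 s
    have hL1 : L = leadRun (!s) l + 1 := by rw [hL, hl, leadRun_cons_self]
    have hjump : piVec k x ⟨k - L - 1, by omega⟩ + 1 ≤ piVec k x ⟨k - L, by omega⟩ := by
      rw [piVec_eq hk0, piVec_eq hk0]
      have := (runCount_succ_le (l := (nf hk0 x).1) (n := L) (by omega)).2 s hL.symm
      simp only
      rw [show k - (k - L - 1) = L + 1 by omega, show k - (k - L) = L by omega]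
      have : ((runCount (L + 1) (nf hk0 x).1 : ℕ) : ℤ) + 1 ≤ (runCount L (nf hk0 x).1 : ℕ) := by
        exact_mod_cast this
      linarith
    by_cases hpos : 0 < piVec k x ⟨k - L, by omega⟩
    · refine ⟨s, Or.inr ?_⟩
      set y := (gen k s)⁻¹ * x with hy
      have hxy : x = gen k s * y := by rw [hy]; group
      have hny : (nf hk0 y).1 = l := by
        rw [hy, nf_gen_inv_mul, stepInv, if_neg (by omega)]; simp [hl]
      have h := piVec_gen_mul hk0 s y
      rw [← hxy] at h
      simp only [hny] at h
      have e : (⟨k - 1 - leadRun (!s) l, by omega⟩ : Fin k) = ⟨k - L, by omega⟩ := by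
        ext; simp only; omega
      rw [e] at h
      have hj := congrFun h ⟨k - L, by omega⟩
      simp only [Pi.add_apply, Pi.single_eq_same] at hj
      rw [h, absSum_add_single, abs_of_nonneg (by omega), abs_of_nonneg (by omega)]
      ring
    · refine ⟨!s, Or.inl ?_⟩
      have e : (⟨k - 1 - leadRun (!!s) (nf hk0 x).1, by omega⟩ : Fin k) =
          ⟨k - L - 1, by omega⟩ := by
        ext; simp only [Bool.not_not]; omega
      rw [piVec_gen_mul hk0, e, absSum_add_single, abs_of_nonpos (by omega),
        abs_of_nonpos (by omega)]
      ring

/-- Coordinate 0 is the exponent of Δ, and coordinate `k - 1` exceeds it by the total number of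
runs. -/
theorem eq_one_of_piVec_eq_zero {k : ℕ} (hk : 1 < k) {x : Artin k} (hx : piVec k x = 0) :
    x = 1 := by
  have hk0 : 0 < k := by omega
  have h0 := congrFun hx ⟨0, hk0⟩
  have h1 := congrFun hx ⟨k - 1, by omega⟩
  rw [piVec_eq hk0] at h0 h1
  simp only [tsub_zero, (runsLT_nf hk0 x).runCount_eq_zero le_rfl, Pi.zero_apply, Nat.cast_zero,
    add_zero] at h0
  simp only [h0, show k - (k - 1) = 1 by omega, Pi.zero_apply, zero_add, Nat.cast_eq_zero] at h1
  rw [← ofNF_nf hk0 x]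
  rcases hl : (nf hk0 x).1 with _ | ⟨s, l⟩
  · simp [ofNF, hl, h0]
  · have := (runCount_succ_le (l := (nf hk0 x).1) (n := leadRun s (nf hk0 x).1)
      (by rw [hl]; simp)).2 s rfl
    have h2 := runCount_anti (l := (nf hk0 x).1) (m := 1) le_rfl
      (show 1 ≤ leadRun s (nf hk0 x).1 by rw [hl]; simp)
    omega

theorem exists_word_length {k : ℕ} (hk : 1 < k) (x : Artin k) :
    ∃ l : List (Artin k), (l.length : ℤ) = absSum (piVec k x) ∧ (∀ g ∈ l, g ∈ genSet k) ∧
      l.prod = x := by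
  have key : ∀ (n : ℕ) (x : Artin k), absSum (piVec k x) = n →
      ∃ l : List (Artin k), l.length = n ∧ (∀ g ∈ l, g ∈ genSet k) ∧ l.prod = x := by
    intro n
    induction n with
    | zero =>
      intro x hx
      refine ⟨[], rfl, by simp, ?_⟩
      rw [eq_one_of_piVec_eq_zero hk (x := x)]
      · rfl
      · ext i
        have := (Finset.sum_eq_zero_iff_of_nonneg (fun i _ => abs_nonneg (piVec k x i))).1 hx i
          (Finset.mem_univ i)
        simpa using this
    | succ n ih =>
      intro x hx
      have hne : piVec k x ≠ 0 := by
        intro h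
        rw [h] at hx
        simp [absSum] at hx
        omega
      obtain ⟨s, h | h⟩ := exists_gen_decreasing hk hne
      · obtain ⟨l, h1, h2, h3⟩ := ih (gen k s * x) (by rw [h, hx]; push_cast; ring)
        refine ⟨(gen k s)⁻¹ :: l, by simp [h1], ?_, by simp [h3]⟩
        intro g hg
        rcases List.mem_cons.1 hg with rfl | hg
        exacts [⟨s, Or.inr rfl⟩, h2 g hg]
      · obtain ⟨l, h1, h2, h3⟩ := ih ((gen k s)⁻¹ * x) (by rw [h, hx]; push_cast; ring)
        refine ⟨gen k s :: l, by simp [h1], ?_, by simp [h3]⟩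
        intro g hg
        rcases List.mem_cons.1 hg with rfl | hg
        exacts [⟨s, Or.inl rfl⟩, h2 g hg]
  obtain ⟨n, hn⟩ := Int.eq_ofNat_of_zero_le (absSum_nonneg (piVec k x))
  obtain ⟨l, h1, h2⟩ := key n x hn
  exact ⟨l, by rw [h1, hn], h2⟩

/-- The word length is the `ℓ¹` norm of `π`. -/
theorem wordLength_eq {k : ℕ} (hk : 1 < k) (x : Artin k) :
    (wordLength k x : ℤ) = absSum (piVec k x) := by
  obtain ⟨l, h1, h2, h3⟩ := exists_word_length hk x
  have hmem : l.length ∈ {n | ∃ l : List (Artin k), l.length = n ∧ (∀ g ∈ l, g ∈ genSet k) ∧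
      l.prod = x} := ⟨l, rfl, h2, h3⟩
  apply le_antisymm
  · rw [← h1]
    exact_mod_cast Nat.sInf_le hmem
  · obtain ⟨l', h1', h2', h3'⟩ := Nat.sInf_mem ⟨_, hmem⟩
    rw [wordLength, ← h1', ← h3']
    exact absSum_piVec_le (by omega) h2'

theorem distFun_apply {k : ℕ} (hk : 1 < k) (x w : Artin k) :
    distFun k x w = ∑ i, (|(piVec k x i + phiElt k w x i : ℝ)| - |(piVec k x i : ℝ)|) := by
  have h1 : (wordLength k (w⁻¹ * x) : ℝ) = ((absSum (piVec k (w⁻¹ * x)) : ℤ) : ℝ) := by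
    rw [← wordLength_eq hk]; simp
  have h2 : (wordLength k (1⁻¹ * x) : ℝ) = ((absSum (piVec k x) : ℤ) : ℝ) := by
    rw [← wordLength_eq hk]; simp
  change ((wordDist k w x : ℝ) - (wordDist k 1 x : ℝ)) = _
  rw [wordDist, wordDist, h1, h2, absSum, absSum]
  push_cast
  rw [← Finset.sum_sub_distrib]
  apply Finset.sum_congr rfl
  intro i _
  simp [phiElt]

/-! ### Stability of `φ` -/

theorem leadRun_take (s : Bool) (n : ℕ) (l : List Bool) :
    leadRun s (l.take n) = min n (leadRun s l) := by
  induction l generalizing s n with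
  | nil => simp
  | cons t l ih =>
    rcases n with _ | n
    · simp
    · simp only [List.take_succ_cons, leadRun, ih]
      split_ifs <;> omega

theorem leadRun_eq_of_take_eq {k n : ℕ} (hk : 0 < k) {l l' : List Bool} (hl : RunsLT k l)
    (hl' : RunsLT k l') (hn : k ≤ n) (h : l.take n = l'.take n) (s : Bool) :
    leadRun s l = leadRun s l' := by
  have h1 := leadRun_take s n l
  have h2 := leadRun_take s n l'
  have := hl.leadRun_lt hk s
  have := hl'.leadRun_lt hk s
  rw [h] at h1
  omega

theorem take_twist (k n : ℕ) (l : List Bool) : (twist k l).take n = twist k (l.take n) := by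
  simp [twist, List.map_take]

/-- The first `k` letters determine the leading run and thus the case of the rule; at most `k - 1`
letters are removed. -/
theorem stepGen_take {k : ℕ} (hk : 0 < k) (s : Bool) {x y : List Bool × ℤ} (hx : RunsLT k x.1)
    (hy : RunsLT k y.1) {n : ℕ} (h : x.1.take (k + n) = y.1.take (k + n)) :
    (stepGen k s x).1.take n = (stepGen k s y).1.take n := by
  have hr := leadRun_eq_of_take_eq hk hx hy (by omega) h (!s)
  have hd : ∀ j, j ≤ k + n → x.1.take j = y.1.take j := by
    intro j hj
    have := congrArg (List.take j) h
    rwa [List.take_take, List.take_take, min_eq_left hj] at this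
  unfold stepGen
  rw [hr]
  split_ifs with h1
  · simp only
    rw [take_twist, take_twist, List.take_drop, List.take_drop, hd _ (by omega)]
  · simp only
    rcases n with _ | n
    · simp
    · rw [List.take_succ_cons, List.take_succ_cons, hd _ (by omega)]

theorem stepInv_take {k : ℕ} (hk : 0 < k) (s : Bool) {x y : List Bool × ℤ} (hx : RunsLT k x.1)
    (hy : RunsLT k y.1) {n : ℕ} (h : x.1.take (k + n) = y.1.take (k + n)) :
    (stepInv k s x).1.take n = (stepInv k s y).1.take n := by
  have hr := leadRun_eq_of_take_eq hk hx hy (by omega) h s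
  have hd : ∀ j, j ≤ k + n → x.1.take j = y.1.take j := by
    intro j hj
    have := congrArg (List.take j) h
    rwa [List.take_take, List.take_take, min_eq_left hj] at this
  unfold stepInv
  rw [hr]
  split_ifs with h1
  · simp only
    rw [List.take_append, List.take_append, take_twist, take_twist, hd _ (by omega)]
  · simp only
    rw [← List.drop_one, ← List.drop_one, List.take_drop, List.take_drop, hd _ (by omega)]

theorem piVec_gen_inv_mul {k : ℕ} (hk : 0 < k) (s : Bool) (x : Artin k) :
    piVec k ((gen k s)⁻¹ * x) = piVec k x -
      Pi.single (⟨k - 1 - leadRun (!s) (nf hk ((gen k s)⁻¹ * x)).1, by omega⟩ : Fin k) 1 := by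
  rw [eq_sub_iff_add_eq, ← piVec_gen_mul, mul_inv_cancel_left]

/-- Left multiplication by a group element depends only on finitely many letters, up to the tail,
and so does its effect on `π`. -/
theorem exists_stable {k : ℕ} (hk : 0 < k) (g : Artin k) :
    ∃ N : ℕ, ∀ (x y : Artin k) (n : ℕ), (nf hk x).1.take (N + n) = (nf hk y).1.take (N + n) →
      (nf hk (g * x)).1.take n = (nf hk (g * y)).1.take n ∧
      piVec k (g * x) - piVec k x = piVec k (g * y) - piVec k y := by
  induction g using artin_induction with
  | one => exact ⟨0, fun x y n h => by simpa using h⟩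
  | mul s g ih =>
    obtain ⟨N, hN⟩ := ih
    refine ⟨N + k, fun x y n h => ?_⟩
    rw [add_assoc] at h
    obtain ⟨h1, h2⟩ := hN x y _ h
    rw [mul_assoc, mul_assoc, nf_gen_mul, nf_gen_mul]
    refine ⟨stepGen_take hk s (runsLT_nf hk _) (runsLT_nf hk _) h1, ?_⟩
    rw [piVec_gen_mul hk, piVec_gen_mul hk]
    have := leadRun_eq_of_take_eq hk (runsLT_nf hk (g * x)) (runsLT_nf hk (g * y))
      (show k ≤ k + n by omega) h1 (!s)
    simp only [this]
    rw [add_sub_right_comm, h2, add_sub_right_comm]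
  | inv_mul s g ih =>
    obtain ⟨N, hN⟩ := ih
    -- One `k` pays for the step itself, the other for reading the leading run of the result, which
    -- decides the coordinate of π that drops.
    refine ⟨N + k + k, fun x y n h => ?_⟩
    rw [add_assoc, add_assoc] at h
    obtain ⟨h1, h2⟩ := hN x y _ h
    have h3 := stepInv_take hk s (runsLT_nf hk _) (runsLT_nf hk _) h1
    rw [← nf_gen_inv_mul, ← nf_gen_inv_mul] at h3
    rw [mul_assoc, mul_assoc]
    constructor
    · have := congrArg (List.take n) h3
      rwa [List.take_take, List.take_take, min_eq_left (by omega)] at this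
    · rw [piVec_gen_inv_mul hk, piVec_gen_inv_mul hk]
      have := leadRun_eq_of_take_eq hk (runsLT_nf hk _) (runsLT_nf hk _)
        (show k ≤ k + n by omega) h3 (!s)
      simp only [this]
      rw [sub_right_comm, h2, sub_right_comm]

/-! ### The cocycle identity for φ, and powers of Δ. -/

theorem phiElt_mul (k : ℕ) (u w x : Artin k) :
    phiElt k (u * w) x = phiElt k u x + phiElt k w (u⁻¹ * x) := by
  simp [phiElt, mul_assoc]

theorem phiElt_one (k : ℕ) (x : Artin k) : phiElt k 1 x = 0 := by simp [phiElt]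

theorem nf_mul_garside_zpow {k : ℕ} (hk : 0 < k) (r : ℤ) (x : Artin k) :
    nf hk (x * garside k ^ r) = ((nf hk x).1, (nf hk x).2 + r) := by
  conv_lhs => rw [← ofNF_nf hk x, ofNF, mul_assoc, ← zpow_add]
  exact nf_ofNF hk (x := ((nf hk x).1, (nf hk x).2 + r)) (runsLT_nf hk x)

theorem piVec_mul_garside_zpow {k : ℕ} (hk : 0 < k) (r : ℤ) (x : Artin k) (i : Fin k) :
    piVec k (x * garside k ^ r) i = piVec k x i + r := by
  rw [piVec_eq hk, piVec_eq hk, nf_mul_garside_zpow]; simp only; ring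

theorem piVec_garside_zpow_mul {k : ℕ} (hk : 0 < k) (r : ℤ) (x : Artin k) (i : Fin k) :
    piVec k (garside k ^ r * x) i = piVec k x i + r := by
  rw [piVec_eq hk, piVec_eq hk, nf_garside_zpow_mul]; simp only [runCount_twistPow]; ring

theorem phiElt_garside_zpow {k : ℕ} (hk : 0 < k) (r : ℤ) (x : Artin k) (i : Fin k) :
    phiElt k (garside k ^ r) x i = -r := by
  rw [phiElt, ← zpow_neg, Pi.sub_apply, piVec_garside_zpow_mul hk]; ring

theorem phiElt_mul_garside_zpow {k : ℕ} (hk : 0 < k) (w : Artin k) (r : ℤ) (x : Artin k)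
    (i : Fin k) : phiElt k (w * garside k ^ r) x i = phiElt k w x i - r := by
  rw [phiElt_mul, Pi.add_apply, phiElt_garside_zpow hk]; ring

theorem phiElt_right_mul_garside_zpow {k : ℕ} (hk : 0 < k) (w : Artin k) (r : ℤ) (x : Artin k) :
    phiElt k w (x * garside k ^ r) = phiElt k w x := by
  ext i
  rw [phiElt, phiElt, ← mul_assoc, Pi.sub_apply, Pi.sub_apply, piVec_mul_garside_zpow hk,
    piVec_mul_garside_zpow hk]
  ring

/-! ### Words without `Δ` -/

theorem runsLT_append_left {k : ℕ} {l l' : List Bool} (h : RunsLT k (l ++ l')) : RunsLT k l := by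
  induction l with
  | nil => trivial
  | cons s l ih =>
    refine ⟨lt_of_le_of_lt ?_ h.1, ih h.2⟩
    have h1 : leadRun (!s) l ≤ leadRun (!s) (l ++ l') :=
      le_leadRun_iff.2 ((le_leadRun_iff.1 le_rfl).trans (List.prefix_append l l'))
    exact Nat.succ_le_succ h1

theorem runsLT_of_forall_drop {k : ℕ} {l : List Bool}
    (h : ∀ m s, ¬ altWord s k <+: l.drop m) : RunsLT k l := by
  induction l with
  | nil => trivial
  | cons s l ih =>
    refine ⟨?_, ih fun m t => h (m + 1) t⟩
    by_contra hlt
    refine h 0 s (le_leadRun_iff.1 ?_)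
    rw [List.drop_zero, leadRun_cons_self]
    omega

theorem getElem?_altWord (s : Bool) (n i : ℕ) :
    (altWord s n)[i]? = if i < n then some (s ^^ i.bodd) else none := by
  induction n generalizing s i with
  | zero => simp
  | succ n ih =>
    rw [altWord_succ]
    rcases i with _ | i
    · simp
    · rw [List.getElem?_cons_succ, ih]
      cases s <;> cases h : i.bodd <;> simp [h]

theorem take_eq_altWord_iff (z : Stream'.Seq Bool) (a n : ℕ) (s : Bool) :
    (z.drop a).take n = altWord s n ↔ ∀ i < n, z.get? (a + i) = some (s ^^ i.bodd) := by
  constructor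
  · intro h i hi
    have := congrArg (fun l => l[i]?) h
    simpa only [Stream'.Seq.getElem?_take, getElem?_altWord, if_pos hi, Stream'.Seq.drop_get?]
      using this
  · intro h
    apply List.ext_getElem?
    intro i
    rw [Stream'.Seq.getElem?_take, getElem?_altWord, Stream'.Seq.drop_get?]
    split_ifs with hi
    exacts [h i hi, rfl]

theorem DeltaFree.not_take_drop_eq {k : ℕ} (z : DeltaFree k) (a : ℕ) (s : Bool) :
    (z.word.drop a).take k ≠ altWord s k := by
  intro h
  apply z.ne_garside a (a + k)
  rw [segProd, add_tsub_cancel_left, h]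
  exact alt_eq_garside k s

theorem runsLT_take_of_forall {k : ℕ} {z : Stream'.Seq Bool}
    (h : ∀ a s, (z.drop a).take k ≠ altWord s k) (n : ℕ) : RunsLT k (z.take n) := by
  apply runsLT_of_forall_drop
  rintro m s ⟨t, ht⟩
  apply h m s
  rw [take_eq_altWord_iff]
  intro i hi
  have := congrArg (fun l => l[i]?) ht
  simp only [List.getElem?_drop, Stream'.Seq.getElem?_take] at this
  rw [List.getElem?_append_left (by simpa), getElem?_altWord, if_pos hi] at this
  split_ifs at this
  exact this.symm

theorem DeltaFree.runsLT_take {k : ℕ} (z : DeltaFree k) (n : ℕ) : RunsLT k (z.word.take n) :=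
  runsLT_take_of_forall z.not_take_drop_eq n

theorem wordProd_ne_garside {k : ℕ} (hk : 0 < k) {l : List Bool} (hl : RunsLT k l) :
    wordProd k l ≠ garside k := by
  intro h
  have h2 := nf_wordProd hk hl
  rw [h, ← zpow_one (garside k), nf_garside_zpow] at h2
  simp at h2

theorem take_ofList (l : List Bool) (n : ℕ) : (Stream'.Seq.ofList l).take n = l.take n := by
  apply List.ext_getElem?
  intro i
  rw [Stream'.Seq.getElem?_take, Stream'.Seq.ofList_get?, List.getElem?_take]

theorem take_drop_eq (z : Stream'.Seq Bool) (a n : ℕ) :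
    (z.drop a).take n = (z.take (a + n)).drop a := by
  apply List.ext_getElem?
  intro i
  rw [Stream'.Seq.getElem?_take, List.getElem?_drop, Stream'.Seq.getElem?_take,
    Stream'.Seq.drop_get?]
  simp

theorem take_add (z : Stream'.Seq Bool) (a n : ℕ) :
    z.take (a + n) = z.take a ++ (z.drop a).take n := by
  rw [take_drop_eq]
  conv_lhs => rw [← List.take_append_drop a (z.take (a + n))]
  congr 1
  apply List.ext_getElem?
  intro i
  rw [List.getElem?_take, Stream'.Seq.getElem?_take, Stream'.Seq.getElem?_take]
  split_ifs <;> first | rfl | omega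

theorem DeltaFree.runsLT_drop_take {k : ℕ} (z : DeltaFree k) (a n : ℕ) :
    RunsLT k ((z.word.drop a).take n) := by
  rw [take_drop_eq]
  exact (z.runsLT_take _).drop a

/-- A finite word as a point of `Z`. -/
def finiteWord {k : ℕ} (hk : 0 < k) (l : List Bool) (hl : RunsLT k l) : DeltaFree k where
  word := Stream'.Seq.ofList l
  ne_garside m n := by
    apply wordProd_ne_garside hk
    rw [take_drop_eq, take_ofList]
    refine RunsLT.drop ?_ m
    rw [← List.take_append_drop (m + (n - m)) l] at hl
    exact runsLT_append_left hl

/-- A word in which no `k` consecutive letters alternate, as a point of `Z`. -/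
def DeltaFree.ofForall {k : ℕ} (hk : 0 < k) (z : Stream'.Seq Bool)
    (h : ∀ a s, (z.drop a).take k ≠ altWord s k) : DeltaFree k where
  word := z
  ne_garside m n := by
    apply wordProd_ne_garside hk
    rw [take_drop_eq]
    exact (runsLT_take_of_forall h _).drop m

theorem finiteWord_terminates {k : ℕ} (hk : 0 < k) (l : List Bool) (hl : RunsLT k l) :
    (finiteWord hk l hl).word.Terminates :=
  ⟨l.length, by simp [Stream'.Seq.TerminatedAt, finiteWord]⟩

theorem exists_phiElt_stable {k : ℕ} (hk : 0 < k) (w : Artin k) :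
    ∃ N : ℕ, ∀ x y : Artin k, (nf hk x).1.take N = (nf hk y).1.take N →
      phiElt k w x = phiElt k w y := by
  obtain ⟨N, hN⟩ := exists_stable hk w⁻¹
  exact ⟨N, fun x y h => (hN x y 0 h).2⟩

theorem tendsto_phiElt {k : ℕ} {w : Artin k} {z : DeltaFree k} {v : Fin k → ℤ}
    (h : ∀ᶠ n in atTop, phiElt k w (wordProd k (z.word.take n)) = v) :
    Tendsto (fun n => phiElt k w (wordProd k (z.word.take n))) atTop (𝓝 v) :=
  (tendsto_congr' h).2 tendsto_const_nhds

theorem take_take (z : Stream'.Seq Bool) {m n : ℕ} (h : m ≤ n) : (z.take n).take m = z.take m := by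
  apply List.ext_getElem?
  intro i
  rw [List.getElem?_take, Stream'.Seq.getElem?_take, Stream'.Seq.getElem?_take]
  split_ifs <;> first | rfl | omega

/-- `φ(w, ·)` depends only on finitely many letters. -/
theorem exists_phi_eq {k : ℕ} (hk : 0 < k) (w : Artin k) :
    ∃ N : ℕ, ∀ (z : DeltaFree k) (x : Artin k), (nf hk x).1.take N = z.word.take N →
      phi k w z = phiElt k w x ∧
      Tendsto (fun n => phiElt k w (wordProd k (z.word.take n))) atTop (𝓝 (phiElt k w x)) := by
  obtain ⟨N, hN⟩ := exists_phiElt_stable hk w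
  refine ⟨N, fun z x hx => ?_⟩
  have : Tendsto (fun n => phiElt k w (wordProd k (z.word.take n))) atTop
      (𝓝 (phiElt k w x)) := by
    apply tendsto_phiElt
    filter_upwards [eventually_ge_atTop N] with n hn
    apply hN
    rw [hx, nf_wordProd hk (z.runsLT_take n)]
    exact take_take z.word hn
  exact ⟨this.limUnder_eq, this⟩

theorem exists_phi_eq_take {k : ℕ} (hk : 0 < k) (w : Artin k) :
    ∃ N : ℕ, ∀ n ≥ N, ∀ z : DeltaFree k, phi k w z = phiElt k w (wordProd k (z.word.take n)) := by
  obtain ⟨N, hN⟩ := exists_phi_eq hk w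
  refine ⟨N, fun n hn z => (hN z _ ?_).1⟩
  rw [nf_wordProd hk (z.runsLT_take n)]
  exact take_take z.word hn

theorem phi_eq_of_terminated {k : ℕ} (hk : 0 < k) (w : Artin k) (z : DeltaFree k) {n : ℕ}
    (hn : z.word.get? n = none) : phi k w z = phiElt k w (wordProd k (z.word.take n)) := by
  obtain ⟨N, hN⟩ := exists_phi_eq hk w
  refine (hN z _ ?_).1
  rw [nf_wordProd hk (z.runsLT_take n)]
  apply List.ext_getElem?
  intro i
  rw [List.getElem?_take, Stream'.Seq.getElem?_take, Stream'.Seq.getElem?_take]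
  split_ifs with h1 h2
  · rfl
  · exact (z.word.le_stable (by omega) hn).symm
  · rfl

/-! ### The decomposition of a possibly infinite word into runs -/

/-- The length of the first maximal alternating run of a finite word. -/
def headRun : List Bool → ℕ
  | [] => 0
  | s :: l => leadRun (!s) l + 1

/-- The length of the remaining part of the run at the position `a`. -/
def runAt {k : ℕ} (z : DeltaFree k) (a : ℕ) : ℕ := headRun ((z.word.drop a).take k)

theorem runAt_eq_zero {k : ℕ} (hk : 0 < k) {z : DeltaFree k} {a : ℕ} (h : z.word.get? a = none) :
    runAt z a = 0 := by
  have : (z.word.drop a).take k = [] := by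
    rw [← List.head?_eq_none_iff, List.head?_eq_getElem?, Stream'.Seq.getElem?_take, if_pos hk,
      Stream'.Seq.drop_get?]
    exact h
  rw [runAt, this]; rfl

theorem runAt_eq_leadRun {k : ℕ} (hk : 0 < k) {z : DeltaFree k} {a : ℕ} {s : Bool}
    (h : z.word.get? a = some s) : runAt z a = leadRun s ((z.word.drop a).take k) := by
  have : ((z.word.drop a).take k).head? = some s := by
    rw [List.head?_eq_getElem?, Stream'.Seq.getElem?_take, if_pos hk, Stream'.Seq.drop_get?]
    exact h
  rw [runAt]
  rcases hl : (z.word.drop a).take k with _ | ⟨t, l⟩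
  · simp [hl] at this
  · simp only [hl, List.head?_cons, Option.some.injEq] at this
    subst this
    rw [headRun, leadRun_cons_self]

theorem runAt_lt {k : ℕ} (hk : 0 < k) (z : DeltaFree k) (a : ℕ) : runAt z a < k := by
  rcases h : z.word.get? a with _ | s
  · rwa [runAt_eq_zero hk h]
  · rw [runAt_eq_leadRun hk h]
    exact (z.runsLT_drop_take a k).leadRun_lt hk s

theorem take_runAt {k : ℕ} (hk : 0 < k) {z : DeltaFree k} {a n : ℕ} {s : Bool}
    (h : z.word.get? a = some s) (hn : n ≤ runAt z a) :
    (z.word.drop a).take n = altWord s n := by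
  rw [runAt_eq_leadRun hk h] at hn
  have := take_leadRun s _ n hn
  rwa [take_take] at this
  have := (z.runsLT_drop_take a k).leadRun_lt hk s
  omega

theorem le_runAt {k : ℕ} (hk : 0 < k) {z : DeltaFree k} {a n : ℕ} {s : Bool} (hn : 1 ≤ n)
    (h : (z.word.drop a).take n = altWord s n) : n ≤ runAt z a := by
  have hp := (take_eq_altWord_iff _ _ _ _).1 h
  have hs : z.word.get? a = some s := by simpa using hp 0 hn
  -- `runAt` reads a window of `k` letters only; a longer alternating block would contain Δ.
  have hnk : n ≤ k := by
    by_contra hlt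
    exact z.not_take_drop_eq a s ((take_eq_altWord_iff _ _ _ _).2 fun i hi => hp i (by omega))
  rw [runAt_eq_leadRun hk hs, le_leadRun_iff, ← h, ← take_take _ hnk]
  exact List.take_prefix _ _

theorem one_le_runAt {k : ℕ} (hk : 0 < k) {z : DeltaFree k} {a : ℕ} (h : z.word.get? a ≠ none) :
    1 ≤ runAt z a := by
  obtain ⟨s, hs⟩ := Option.ne_none_iff_exists'.1 h
  apply le_runAt hk le_rfl (s := s)
  rw [take_eq_altWord_iff]
  intro i hi
  obtain rfl : i = 0 := by omega
  simpa using hs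

theorem get?_runAt_ne {k : ℕ} (hk : 0 < k) {z : DeltaFree k} {a : ℕ} {s : Bool}
    (h : z.word.get? a = some s) :
    z.word.get? (a + runAt z a) ≠ some (s ^^ (runAt z a).bodd) := by
  intro h'
  have h1 := take_runAt hk h le_rfl
  have : (z.word.drop a).take (runAt z a + 1) = altWord s (runAt z a + 1) := by
    rw [take_eq_altWord_iff] at h1 ⊢
    intro i hi
    rcases Nat.lt_succ_iff_lt_or_eq.1 hi with hi | rfl
    exacts [h1 i hi, h']
  have := le_runAt hk (by omega) this
  omega

/-- Uniqueness of normal forms turns equality in the group into equality of words. -/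
theorem mem_Mplus_wordProd_iff {k : ℕ} (hk : 0 < k) {l : List Bool} (hl : RunsLT k l) :
    wordProd k l ∈ Mplus k ↔ ∃ s n, 1 ≤ n ∧ n < k ∧ l = altWord s n := by
  constructor
  · rintro ⟨n, h1, h2, s, hs⟩
    refine ⟨s, n, h1, h2, ?_⟩
    have : RunsLT k (altWord s n) := by
      simpa using runsLT_altWord_append (s := s) (l := []) h2 rfl trivial
    have h3 := nf_wordProd hk hl
    rw [hs, alt, nf_wordProd hk this] at h3
    exact (Prod.ext_iff.1 h3).1.symm
  · rintro ⟨s, n, h1, h2, rfl⟩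
    exact ⟨n, h1, h2, s, rfl⟩

theorem length_take_of_get?_ne_none {z : Stream'.Seq Bool} {a n : ℕ} (hn : 1 ≤ n)
    (h : z.get? (a + n - 1) ≠ none) : ((z.drop a).take n).length = n := by
  apply le_antisymm Stream'.Seq.length_take_le
  by_contra hlt
  have : ((z.drop a).take n)[n - 1]? = none := by
    rw [List.getElem?_eq_none_iff]; omega
  rw [Stream'.Seq.getElem?_take, if_pos (by omega), Stream'.Seq.drop_get?] at this
  exact h (by rwa [show a + n - 1 = a + (n - 1) by omega])

theorem segProd_mem_Mplus_iff {k : ℕ} (hk : 0 < k) {z : DeltaFree k} {a b : ℕ} (hab : a < b)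
    (h : z.word.get? (b - 1) ≠ none) :
    segProd k z.word a b ∈ Mplus k ↔ b ≤ a + runAt z a := by
  obtain ⟨n, rfl⟩ : ∃ n, b = a + n := ⟨b - a, by omega⟩
  have hlen := length_take_of_get?_ne_none (by omega) h
  rw [segProd, add_tsub_cancel_left, mem_Mplus_wordProd_iff hk (z.runsLT_drop_take a n)]
  constructor
  · rintro ⟨s, m, h1, h2, h3⟩
    rw [h3, length_altWord] at hlen
    subst hlen
    have := le_runAt hk h1 h3
    omega
  · intro hle
    have hs : z.word.get? a ≠ none := fun hn => h (z.word.le_stable (by omega) hn)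
    obtain ⟨s, hs⟩ := Option.ne_none_iff_exists'.1 hs
    have := runAt_lt hk z a
    exact ⟨s, n, by omega, by omega, take_runAt hk hs (by omega)⟩

theorem get?_runAt_pred {k : ℕ} (hk : 0 < k) {z : DeltaFree k} {a : ℕ} {s : Bool}
    (h : z.word.get? a = some s) :
    z.word.get? (a + runAt z a - 1) = some (s ^^ (runAt z a - 1).bodd) := by
  have h1 : 1 ≤ runAt z a := one_le_runAt hk (by simp [h])
  have := (take_eq_altWord_iff _ _ _ _).1 (take_runAt hk h le_rfl) (runAt z a - 1) (by omega)
  rwa [← Nat.add_sub_assoc h1] at this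

/-- The positions at which the runs of `z` begin. -/
def cuts {k : ℕ} (z : DeltaFree k) : ℕ → ℕ
  | 0 => 0
  | j + 1 => cuts z j + runAt z (cuts z j)

theorem isDecomposition_cuts {k : ℕ} (hk : 0 < k) (z : DeltaFree k) :
    IsDecomposition k z (cuts z) := by
  refine ⟨rfl, fun j => ⟨fun h => ?_, fun h => ?_⟩⟩
  · rw [cuts, runAt_eq_zero hk h, add_zero]
  · have h1 := one_le_runAt hk h
    obtain ⟨s, hs⟩ := Option.ne_none_iff_exists'.1 h
    have h2 : z.word.get? (cuts z (j + 1) - 1) ≠ none := by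
      rw [cuts, get?_runAt_pred hk hs]; simp
    refine ⟨by rw [cuts]; omega, h2, ?_, fun h3 => ?_⟩
    · rw [segProd_mem_Mplus_iff hk (by rw [cuts]; omega) h2, cuts]
    · have h4 := one_le_runAt hk h3
      obtain ⟨t, ht⟩ := Option.ne_none_iff_exists'.1 h3
      have h5 : z.word.get? (cuts z (j + 2) - 1) ≠ none := by
        rw [cuts, get?_runAt_pred hk ht]; simp
      have e1 : cuts z (j + 1) = cuts z j + runAt z (cuts z j) := rfl
      have e2 : cuts z (j + 2) = cuts z (j + 1) + runAt z (cuts z (j + 1)) := rfl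
      rw [segProd_mem_Mplus_iff hk (by omega) h5]
      omega

/-- A substring cannot outrun its run. If it stopped earlier, the next substring would continue the
same alternation, and the product of the two would lie in M⁺, which is forbidden. -/
theorem IsDecomposition.eq_cuts {k : ℕ} (hk : 0 < k) {z : DeltaFree k} {c : ℕ → ℕ}
    (h : IsDecomposition k z c) : c = cuts z := by
  funext j
  induction j with
  | zero => exact h.1
  | succ j ih =>
    rw [cuts, ← ih]
    rcases hz : z.word.get? (c j) with _ | s
    · rw [runAt_eq_zero hk hz, (h.2 j).1 hz, add_zero]
    · obtain ⟨h1, h2, h3, h4⟩ := (h.2 j).2 (by simp [hz])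
      have hle := (segProd_mem_Mplus_iff hk h1 h2).1 h3
      apply le_antisymm hle
      by_contra hlt
      set n := c (j + 1) - c j with hn
      have hcn : c (j + 1) = c j + n := by omega
      have hR := (take_eq_altWord_iff _ _ _ _).1 (take_runAt hk hz le_rfl)
      have hb : z.word.get? (c (j + 1)) = some (s ^^ n.bodd) := by rw [hcn]; exact hR n (by omega)
      have hb' : z.word.get? (c (j + 1)) ≠ none := by simp [hb]
      obtain ⟨h5, h6, h7, -⟩ := (h.2 (j + 1)).2 hb'
      have hle' := (segProd_mem_Mplus_iff hk h5 h6).1 h7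
      apply h4 hb'
      rw [segProd_mem_Mplus_iff hk (by omega) h6]
      set m := c (j + 1 + 1) - c (j + 1) with hm
      have := take_runAt hk hb (n := m) (by omega)
      rw [take_eq_altWord_iff] at this
      have key : (z.word.drop (c j)).take (n + m) = altWord s (n + m) := by
        rw [take_eq_altWord_iff]
        intro i hi
        rcases lt_or_ge i n with hin | hin
        · exact hR i (by omega)
        · obtain ⟨d, rfl⟩ := Nat.exists_eq_add_of_le hin
          have := this d (by omega)
          rw [hcn] at this
          rw [← add_assoc, this, Nat.bodd_add]
          simp
      have := le_runAt hk (by omega) key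
      omega

theorem existsUnique_decomposition {k : ℕ} (hk : 0 < k) (z : DeltaFree k) :
    ∃! c, IsDecomposition k z c :=
  ⟨cuts z, isDecomposition_cuts hk z, fun _ h => h.eq_cuts hk⟩

theorem decomposition_eq {k : ℕ} (hk : 0 < k) (z : DeltaFree k) : decomposition k z = cuts z :=
  (Classical.epsilon_spec (existsUnique_decomposition hk z).exists).eq_cuts hk

/-! ### Counting runs -/

/-- The number of maximal alternating runs of length exactly `n`. -/
def exactCount (n : ℕ) (l : List Bool) : ℕ := runCount n l - runCount (n + 1) l

theorem runCount_eq_add_exactCount {n : ℕ} (hn : 1 ≤ n) (l : List Bool) :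
    runCount n l = runCount (n + 1) l + exactCount n l := by
  have := (runCount_succ_le (l := l) hn).1
  rw [exactCount]; omega

/-- No run crosses the junction, because `l'` does not begin with the letter opposite to the last
one of `l`. The statement on `leadRun` is what the induction needs. -/
theorem runCount_append {l l' : List Bool} (n : ℕ)
    (h : ∀ s, l.getLast? = some s → leadRun (!s) l' = 0) :
    runCount n (l ++ l') = runCount n l + runCount n l' ∧
      (l ≠ [] → ∀ t, leadRun t (l ++ l') = leadRun t l) := by
  induction l with
  | nil => simp
  | cons s l ih =>
    rcases l with _ | ⟨u, l⟩
    · have := h s rfl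
      refine ⟨by simp [runCount_cons, this, add_comm], fun _ t => ?_⟩
      rw [List.cons_append, List.nil_append]
      simp only [leadRun]
      split_ifs with hst
      · subst hst; rw [this]
      · rfl
    · obtain ⟨h1, h2⟩ := ih (by simpa using h)
      have h3 := h2 (by simp)
      refine ⟨?_, fun _ t => ?_⟩
      · rw [List.cons_append, runCount_cons, h1, runCount_cons n s, h3]; ring
      · rw [List.cons_append, leadRun, leadRun, h3]

theorem exactCount_append {l l' : List Bool} {n : ℕ} (hn : 1 ≤ n)
    (h : ∀ s, l.getLast? = some s → leadRun (!s) l' = 0) :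
    exactCount n (l ++ l') = exactCount n l + exactCount n l' := by
  have h1 := (runCount_append n h).1
  have h2 := (runCount_append (n + 1) h).1
  have h3 := runCount_eq_add_exactCount hn l
  have h4 := runCount_eq_add_exactCount hn l'
  rw [exactCount, h1, h2]; omega

theorem exactCount_altWord {n m : ℕ} (hn : 1 ≤ n) (s : Bool) :
    exactCount n (altWord s m) = if m = n then 1 else 0 := by
  have h1 := runCount_altWord_append (s := s) (m := m) (l := []) n rfl
  have h2 := runCount_altWord_append (s := s) (m := m) (l := []) (n + 1) rfl
  simp only [List.append_nil, runCount_nil] at h1 h2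
  rw [exactCount, h1, h2]
  split_ifs <;> omega

theorem getLast?_take {z : Stream'.Seq Bool} {n : ℕ} {s : Bool}
    (h : z.get? n = some s) : (z.take (n + 1)).getLast? = some s := by
  rw [take_add]
  have : (z.drop n).take 1 = [s] := by
    apply List.ext_getElem?
    rintro (_ | i)
    · rw [Stream'.Seq.getElem?_take]; simpa using h
    · rw [Stream'.Seq.getElem?_take]; simp
  rw [this]; simp

/-- A position which is not in the interior of a run. -/
def IsBreak {k : ℕ} (z : DeltaFree k) (n : ℕ) : Prop :=
  z.word.get? n = none ∨ n = 0 ∨ z.word.get? (n - 1) = z.word.get? n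

theorem isBreak_add_runAt {k : ℕ} (hk : 0 < k) (z : DeltaFree k) (a : ℕ) :
    IsBreak z (a + runAt z a) := by
  rcases h : z.word.get? a with _ | s
  · left; rw [runAt_eq_zero hk h]; exact h
  · have h1 := get?_runAt_ne hk h
    have h2 := get?_runAt_pred hk h
    rcases h3 : z.word.get? (a + runAt z a) with _ | t
    · exact Or.inl h3
    · right; right
      rw [h2, h3]
      rw [h3] at h1
      have h4 := one_le_runAt hk (z := z) (a := a) (by simp [h])
      obtain ⟨m, hm⟩ : ∃ m, runAt z a = m + 1 := ⟨runAt z a - 1, by omega⟩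
      rw [hm] at h1 ⊢
      simp only [Nat.bodd_succ, add_tsub_cancel_right] at h1 ⊢
      cases s <;> cases t <;> cases hb : m.bodd <;> simp_all

theorem exists_isBreak {k : ℕ} (hk : 0 < k) (z : DeltaFree k) (n : ℕ) : ∃ m ≥ n, IsBreak z m :=
  ⟨_, Nat.le_add_right n _, isBreak_add_runAt hk z n⟩

theorem isBreak_cuts {k : ℕ} (hk : 0 < k) (z : DeltaFree k) (j : ℕ) : IsBreak z (cuts z j) := by
  cases j with
  | zero => exact Or.inr (Or.inl rfl)
  | succ j => exact isBreak_add_runAt hk z _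

theorem leadRun_of_isBreak {k : ℕ} {z : DeltaFree k} {n : ℕ} (h : IsBreak z n)
    {l : List Bool} (hl : l.head? = z.word.get? n) :
    ∀ s, (z.word.take n).getLast? = some s → leadRun (!s) l = 0 := by
  intro s hs
  rcases l with _ | ⟨t, l⟩
  · rfl
  · simp only [List.head?_cons] at hl
    rcases h with h | rfl | h
    · simp [h] at hl
    · simp at hs
    · rcases n with _ | n
      · simp at hs
      · simp only [add_tsub_cancel_right] at h
        have := getLast?_take (h.trans hl.symm)
        rw [this] at hs
        simp only [Option.some.injEq] at hs
        subst hs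
        simp

theorem exactCount_cuts {k : ℕ} (hk : 0 < k) (z : DeltaFree k) {n : ℕ} (hn : 1 ≤ n) (j : ℕ) :
    exactCount n (z.word.take (cuts z j)) =
      ((Finset.range j).filter fun i => z.word.get? (cuts z i) ≠ none ∧
        cuts z (i + 1) - cuts z i = n).card := by
  induction j with
  | zero => simp [cuts, exactCount]
  | succ j ih =>
    rw [Finset.range_add_one, Finset.filter_insert]
    rcases h : z.word.get? (cuts z j) with _ | s
    · rw [if_neg (by simp), cuts, runAt_eq_zero hk h, add_zero, ih]
    · have e : cuts z (j + 1) - cuts z j = runAt z (cuts z j) := by rw [cuts]; omega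
      have e' : z.word.take (cuts z (j + 1)) =
          z.word.take (cuts z j) ++ altWord s (runAt z (cuts z j)) := by
        rw [cuts, take_add, take_runAt hk h le_rfl]
      have hhead : (altWord s (runAt z (cuts z j))).head? = z.word.get? (cuts z j) := by
        have := one_le_runAt hk (z := z) (a := cuts z j) (by simp [h])
        rw [h, List.head?_eq_getElem?, getElem?_altWord, if_pos (by omega)]
        simp
      rw [e', exactCount_append hn (leadRun_of_isBreak (isBreak_cuts hk z j) hhead), ih,
        exactCount_altWord hn, e]
      split_ifs with h1 h2 h2
      · rw [Finset.card_insert_of_notMem (by simp)]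
      · exact absurd ⟨by simp, h1⟩ h2
      · exact absurd h2.2 h1
      · rfl

theorem numSub_eq {k : ℕ} (hk : 0 < k) (z : DeltaFree k) (n : ℕ) :
    numSub k z n = Set.encard {j : ℕ | z.word.get? (cuts z j) ≠ none ∧
      cuts z (j + 1) - cuts z j = n} := by
  rw [numSub, decomposition_eq hk]

theorem exactCount_cuts_le {k : ℕ} (hk : 0 < k) (z : DeltaFree k) {n : ℕ} (hn : 1 ≤ n) (j : ℕ) :
    (exactCount n (z.word.take (cuts z j)) : ℕ∞) ≤ numSub k z n := by
  rw [exactCount_cuts hk z hn, numSub_eq hk, ← Set.encard_coe_eq_coe_finsetCard]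
  apply Set.encard_le_encard
  intro i hi
  simp only [Finset.coe_filter, Set.mem_ofPred_eq] at hi
  exact hi.2

theorem take_eq_of_terminated {z : Stream'.Seq Bool} {m n : ℕ} (hm : z.get? m = none)
    (hmn : m ≤ n) : z.take n = z.take m := by
  apply List.ext_getElem?
  intro i
  rw [Stream'.Seq.getElem?_take, Stream'.Seq.getElem?_take]
  split_ifs with h1 h2 h2
  · rfl
  · exact z.le_stable (by omega) hm
  · omega
  · rfl

theorem cuts_or_terminated {k : ℕ} (hk : 0 < k) (z : DeltaFree k) (j : ℕ) :
    j ≤ cuts z j ∨ z.word.get? (cuts z j) = none := by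
  induction j with
  | zero => simp
  | succ j ih =>
    by_cases h : z.word.get? (cuts z j) = none
    · right; rwa [cuts, runAt_eq_zero hk h, add_zero]
    · left
      have := one_le_runAt hk h
      rcases ih with ih | ih
      · rw [cuts]; omega
      · exact absurd ih h

/-- Only the prefixes are compared: beyond the end of a finite word every position is a break, while
the cuts stay at the end. -/
theorem exists_cuts_of_isBreak {k : ℕ} (hk : 0 < k) {z : DeltaFree k} {n : ℕ} (h : IsBreak z n) :
    ∃ j, z.word.take n = z.word.take (cuts z j) := by
  have h1 : ∃ j, n < cuts z (j + 1) ∨ z.word.get? (cuts z j) = none := by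
    refine ⟨n, ?_⟩
    by_cases h : z.word.get? (cuts z n) = none
    · exact Or.inr h
    · left
      have := one_le_runAt hk h
      rcases cuts_or_terminated hk z n with h2 | h2
      · rw [cuts]; omega
      · exact absurd h2 h
  classical
  obtain ⟨h2, h3⟩ : (n < cuts z (Nat.find h1 + 1) ∨ z.word.get? (cuts z (Nat.find h1)) = none) ∧
      cuts z (Nat.find h1) ≤ n := by
    refine ⟨Nat.find_spec h1, ?_⟩
    rcases hj : Nat.find h1 with _ | j
    · simp [cuts]
    · have := Nat.find_min h1 (m := j) (by omega)
      push Not at this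
      exact this.1
  set j := Nat.find h1
  refine ⟨j, ?_⟩
  rcases hz : z.word.get? (cuts z j) with _ | s
  · exact take_eq_of_terminated hz h3
  · rcases h2 with h2 | h2
    · obtain ⟨d, hd⟩ := Nat.exists_eq_add_of_le h3
      rcases d with _ | d
      · rw [hd]; rfl
      · exfalso
        rw [cuts] at h2
        have hR := (take_eq_altWord_iff _ _ _ _).1 (take_runAt hk hz le_rfl)
        have h4 := hR (d + 1) (by omega)
        have h5 := hR d (by omega)
        rw [← hd] at h4
        rw [show cuts z j + d = n - 1 by omega] at h5
        rcases h with h | h | h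
        · simp [h] at h4
        · omega
        · rw [h4, h5] at h
          simp only [Option.some.injEq] at h
          cases s <;> cases hb : d.bodd <;> simp [hb] at h
    · simp [h2] at hz

theorem exactCount_le_numSub {k : ℕ} (hk : 0 < k) {z : DeltaFree k} {n N : ℕ} (hn : 1 ≤ n)
    (h : IsBreak z N) : (exactCount n (z.word.take N) : ℕ∞) ≤ numSub k z n := by
  obtain ⟨j, hj⟩ := exists_cuts_of_isBreak hk h
  rw [hj]
  exact exactCount_cuts_le hk z hn j

/-- Any `B + 1` substrings of length `n` would all occur before some cut, whose prefix would then
contain too many runs. -/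
theorem numSub_le {k : ℕ} (hk : 0 < k) {z : DeltaFree k} {n B : ℕ} (hn : 1 ≤ n)
    (h : ∀ N, IsBreak z N → exactCount n (z.word.take N) ≤ B) : numSub k z n ≤ B := by
  rw [numSub_eq hk]
  by_contra hlt
  push Not at hlt
  obtain ⟨t, ht, hc⟩ := Set.exists_subset_encard_eq (Order.add_one_le_of_lt hlt)
  have hfin : t.Finite := Set.finite_of_encard_eq_coe (k := B + 1) (by rw [hc]; simp)
  obtain ⟨M, hM⟩ := hfin.bddAbove
  have h1 := h _ (isBreak_cuts hk z (M + 1))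
  rw [exactCount_cuts hk z hn] at h1
  have h2 : t.encard ≤ B := by
    refine le_trans ?_ (Nat.cast_le.2 h1)
    rw [← Set.encard_coe_eq_coe_finsetCard]
    apply Set.encard_le_encard
    intro i hi
    simp only [Finset.coe_filter, Set.mem_ofPred_eq, Finset.mem_range]
    exact ⟨Nat.lt_succ_of_le (hM hi), ht hi⟩
  rw [hc] at h2
  exact absurd h2 (by exact_mod_cast Nat.not_succ_le_self B)

theorem numSub_of_terminated {k : ℕ} (hk : 0 < k) {z : DeltaFree k} {n N : ℕ} (hn : 1 ≤ n)
    (hN : z.word.get? N = none) : numSub k z n = exactCount n (z.word.take N) := by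
  apply le_antisymm
  · apply numSub_le hk hn
    intro M hM
    obtain ⟨j, hj⟩ := exists_cuts_of_isBreak hk hM
    have hJ : z.word.get? (cuts z (max j N)) = none := by
      rcases cuts_or_terminated hk z (max j N) with h | h
      · exact z.word.le_stable (by omega) hN
      · exact h
    have hJN : z.word.take N = z.word.take (cuts z (max j N)) := by
      rcases le_total N (cuts z (max j N)) with h | h
      · exact (take_eq_of_terminated hN h).symm
      · exact take_eq_of_terminated hJ h
    rw [hj, hJN, exactCount_cuts hk z hn, exactCount_cuts hk z hn]
    exact Finset.card_le_card
      (Finset.filter_subset_filter _ (Finset.range_subset_range.2 (le_max_left _ _)))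
  · exact exactCount_le_numSub hk hn (Or.inl hN)

/-! ### Extended integers -/

/-- An extended real which is an integer or infinite. -/
def IsExtInt (x : EReal) : Prop := x = ⊥ ∨ x = ⊤ ∨ ∃ n : ℤ, x = ((n : ℝ) : EReal)

theorem IsExtInt.add_int {x : EReal} (h : IsExtInt x) (b : ℤ) :
    IsExtInt (x + ((b : ℝ) : EReal)) := by
  rcases h with rfl | rfl | ⟨n, rfl⟩
  · left; simp
  · right; left; simp
  · right; right; exact ⟨n + b, by push_cast; simp⟩

theorem IsExtInt.exists_int_between {x y : EReal} (hx : IsExtInt x) (hy : IsExtInt y)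
    (h : x < y) : ∃ n : ℤ, x ≤ ((n : ℝ) : EReal) ∧ ((n : ℝ) : EReal) < y := by
  rcases hx with rfl | rfl | ⟨m, rfl⟩
  · rcases hy with rfl | rfl | ⟨n, rfl⟩
    · simp at h
    · exact ⟨0, by simp⟩
    · refine ⟨n - 1, bot_le, ?_⟩
      rw [EReal.coe_lt_coe_iff]; push_cast; linarith
  · simp at h
  · exact ⟨m, le_rfl, h⟩

theorem IsExtInt.eq_of_forall_le_iff {x y : EReal} (hx : IsExtInt x) (hy : IsExtInt y)
    (h : ∀ n : ℤ, x ≤ ((n : ℝ) : EReal) ↔ y ≤ ((n : ℝ) : EReal)) : x = y := by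
  rcases lt_trichotomy x y with hlt | rfl | hlt
  · obtain ⟨n, h1, h2⟩ := hx.exists_int_between hy hlt
    exact absurd ((h n).1 h1) (not_le.2 h2)
  · rfl
  · obtain ⟨n, h1, h2⟩ := hy.exists_int_between hx hlt
    exact absurd ((h n).2 h1) (not_le.2 h2)

/-- An integer as an extended integer. -/
def intExt (n : ℤ) : ExtInt := ⟨((n : ℝ) : EReal), Or.inr (Or.inr ⟨n, rfl⟩)⟩

theorem absDiff_top {p : ExtInt} (h : p.1 = ⊤) (b : ℤ) : absDiff p b = b := by
  simp [absDiff, h]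

theorem absDiff_bot {p : ExtInt} (h : p.1 = ⊥) (b : ℤ) : absDiff p b = -b := by
  simp [absDiff, h]

theorem absDiff_int {p : ExtInt} {m : ℤ} (h : p.1 = ((m : ℝ) : EReal)) (b : ℤ) :
    absDiff p b = |(m : ℝ) + b| - |(m : ℝ)| := by
  simp [absDiff, h]

theorem abs_sub_one_sub_abs (m : ℤ) :
    |((m - 1 : ℤ) : ℝ)| - |(m : ℝ)| = if m ≤ 0 then 1 else -1 := by
  rw [← Int.cast_abs, ← Int.cast_abs]
  split_ifs with h
  · rw [abs_of_nonpos h, abs_of_nonpos (show m - 1 ≤ 0 by omega)]; push_cast; ring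
  · rw [abs_of_pos (show 0 < m by omega), abs_of_nonneg (show 0 ≤ m - 1 by omega)]; push_cast; ring

/-- The discrete slope of the absolute value only shows on which side of `n` the number p + b lies.
The values at ±∞ obey the same rule. -/
theorem absDiff_sub_one (p : ExtInt) (b n : ℤ) :
    absDiff p (b - 1 - n) - absDiff p (b - n) =
      if p.1 + ((b : ℝ) : EReal) ≤ ((n : ℝ) : EReal) then 1 else -1 := by
  rcases p.2 with h | h | ⟨m, h⟩
  · rw [absDiff_bot h, absDiff_bot h, h, if_pos (by simp)]; push_cast; ring
  · rw [absDiff_top h, absDiff_top h, h, if_neg (by simp)]; push_cast; ring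
  · rw [absDiff_int h, absDiff_int h, h]
    have := abs_sub_one_sub_abs (m + b - n)
    have e : (((m : ℝ) : EReal) + ((b : ℝ) : EReal) ≤ ((n : ℝ) : EReal)) ↔ m + b - n ≤ 0 := by
      rw [← EReal.coe_add, EReal.coe_le_coe_iff, ← Int.cast_add, Int.cast_le]
      omega
    simp only [e]
    rw [← this]
    push_cast
    ring_nf

/-! ### The defining conditions of `Ω'` -/

theorem enatToEReal_coe (n : ℕ) : enatToEReal n = ((n : ℝ) : EReal) := by
  rw [enatToEReal]
  norm_cast

theorem enatToEReal_mono {m n : ℕ∞} (h : m ≤ n) : enatToEReal m ≤ enatToEReal n := by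
  unfold enatToEReal
  exact_mod_cast h

theorem exactCount_nil (n : ℕ) : exactCount n [] = 0 := rfl

/-- In additive form the two excluded differences need no exception. The break 0 forces `a ≤ b`, and
since `numSub` is finite for a finite word, an infinite difference is impossible there. -/
theorem omegaCond_pair_iff {k : ℕ} (hk : 0 < k) (z : DeltaFree k) {n : ℕ} (hn : 1 ≤ n)
    {a b : EReal} (ha : IsExtInt a) (hb : IsExtInt b) :
    (¬ (a = ⊥ ∧ b = ⊥) → ¬ (a = ⊤ ∧ b = ⊤) → enatToEReal (numSub k z n) ≤ b - a ∧
      (z.word.Terminates → b - a = enatToEReal (numSub k z n))) ↔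
    ∀ N, (IsBreak z N → a + ((exactCount n (z.word.take N) : ℝ) : EReal) ≤ b) ∧
      (z.word.get? N = none → a + ((exactCount n (z.word.take N) : ℝ) : EReal) = b) := by
  have nonneg : (0 : EReal) ≤ enatToEReal (numSub k z n) := by
    exact EReal.coe_ennreal_nonneg _
  have ne_top : ∀ N, z.word.get? N = none → enatToEReal (numSub k z n) ≠ ⊤ := by
    intro N hN
    rw [numSub_of_terminated hk hn hN, enatToEReal_coe]
    exact EReal.coe_ne_top _
  have htop : ∀ c : ℝ, (⊤ : EReal) + (c : EReal) = ⊤ := EReal.top_add_coe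
  have h0 : IsBreak z 0 := Or.inr (Or.inl rfl)
  rcases ha with rfl | rfl | ⟨a, rfl⟩ <;> rcases hb with rfl | rfl | ⟨b, rfl⟩
  · simp
  · have e : (⊤ : EReal) - ⊥ = ⊤ := by simp
    simp only [e, bot_ne_top, top_ne_bot, and_false, false_and, not_false_eq_true, forall_true_left,
      le_top, true_and, EReal.bot_add, implies_true, Stream'.Seq.Terminates, imp_false]
    constructor
    · rintro h N hN
      exact ne_top N hN (h ⟨N, hN⟩).symm
    · rintro h ⟨N, hN⟩
      exact absurd hN (h N)
  · have e : ((b : ℝ) : EReal) - ⊥ = ⊤ := by simp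
    simp only [e, EReal.coe_ne_bot, bot_ne_top, and_false, false_and, not_false_eq_true,
      forall_true_left, le_top, bot_le, true_and, EReal.bot_add, implies_true,
      Stream'.Seq.Terminates, (EReal.coe_ne_bot _).symm, imp_false]
    constructor
    · rintro h N hN
      exact ne_top N hN (h ⟨N, hN⟩).symm
    · rintro h ⟨N, hN⟩
      exact absurd hN (h N)
  · have e : (⊥ : EReal) - ⊤ = ⊥ := by simp
    constructor
    · intro h
      have := (h (by simp) (by simp)).1
      rw [e] at this
      exact absurd (nonneg.trans this) (by simp)
    · intro h
      have := (h 0).1 h0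
      rw [htop] at this
      simp at this
  · simp only [htop]
    simp
  · have e : ((b : ℝ) : EReal) - ⊤ = ⊥ := by simp
    constructor
    · intro h
      have := (h (by simp) (by simp)).1
      rw [e] at this
      exact absurd (nonneg.trans this) (by simp)
    · intro h
      have := (h 0).1 h0
      rw [htop] at this
      simp at this
  · have e : ⊥ - ((a : ℝ) : EReal) = ⊥ := by simp
    constructor
    · intro h
      have := (h (by simp) (by simp)).1
      rw [e] at this
      exact absurd (nonneg.trans this) (by simp)
    · intro h
      have := (h 0).1 h0
      rw [← EReal.coe_add] at this
      exact absurd this (by rw [le_bot_iff]; exact EReal.coe_ne_bot _)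
  · have e : ⊤ - ((a : ℝ) : EReal) = ⊤ := by simp
    constructor
    · intro h N
      refine ⟨fun _ => le_top, fun hN => ?_⟩
      have := (h (by simp) (by simp)).2 ⟨N, hN⟩
      rw [e] at this
      exact absurd this.symm (ne_top N hN)
    · intro h _ _
      rw [e]
      refine ⟨le_top, ?_⟩
      rintro ⟨N, hN⟩
      have := (h N).2 hN
      rw [← EReal.coe_add] at this
      exact absurd this (EReal.coe_ne_top _)
  · have e : ((b : ℝ) : EReal) - ((a : ℝ) : EReal) = (((b : ℝ) - (a : ℝ) : ℝ) : EReal) := by simp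
    constructor
    · intro h N
      obtain ⟨h1, h2⟩ := h (by simp) (by simp)
      rw [e] at h1 h2
      constructor
      · intro hN
        have := (enatToEReal_mono (exactCount_le_numSub hk hn hN)).trans h1
        rw [enatToEReal_coe, EReal.coe_le_coe_iff] at this
        rw [← EReal.coe_add, EReal.coe_le_coe_iff]
        linarith
      · intro hN
        have := h2 ⟨N, hN⟩
        rw [numSub_of_terminated hk hn hN, enatToEReal_coe, EReal.coe_eq_coe_iff] at this
        rw [← EReal.coe_add, EReal.coe_eq_coe_iff]
        linarith
    · intro h _ _
      rw [e]
      have key : ∀ N, IsBreak z N → (exactCount n (z.word.take N) : ℤ) ≤ b - a := by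
        intro N hN
        have := (h N).1 hN
        rw [← EReal.coe_add, EReal.coe_le_coe_iff] at this
        have : (((exactCount n (z.word.take N) : ℤ) : ℝ)) ≤ ((b - a : ℤ) : ℝ) := by
          push_cast; linarith
        exact_mod_cast this
      obtain ⟨B, hB⟩ := Int.eq_ofNat_of_zero_le ((Int.natCast_nonneg _).trans (key 0 h0))
      constructor
      · have h1 : numSub k z n ≤ B := numSub_le hk hn fun N hN => by
          have := key N hN
          rw [hB] at this
          exact_mod_cast this
        refine (enatToEReal_mono h1).trans ?_
        rw [enatToEReal_coe, EReal.coe_le_coe_iff]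
        have : ((b - a : ℤ) : ℝ) = ((B : ℤ) : ℝ) := by rw [hB]
        push_cast at this
        linarith
      · rintro ⟨N, hN⟩
        have := (h N).2 hN
        rw [← EReal.coe_add, EReal.coe_eq_coe_iff] at this
        rw [numSub_of_terminated hk hn hN, enatToEReal_coe, EReal.coe_eq_coe_iff]
        linarith

/-- The defining conditions of `Ω'`, in terms of finite prefixes. -/
theorem omegaCond_iff {k : ℕ} (hk : 0 < k) (x : (Fin k → ExtInt) × DeltaFree k) :
    OmegaCond k x ↔ ∀ (i : ℕ) (hi : i + 1 < k) (N : ℕ),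
      (IsBreak x.2 N → (x.1 ⟨i, by omega⟩).1 +
        ((exactCount (k - (i + 1)) (x.2.word.take N) : ℝ) : EReal) ≤ (x.1 ⟨i + 1, hi⟩).1) ∧
      (x.2.word.get? N = none → (x.1 ⟨i, by omega⟩).1 +
        ((exactCount (k - (i + 1)) (x.2.word.take N) : ℝ) : EReal) = (x.1 ⟨i + 1, hi⟩).1) := by
  unfold OmegaCond
  refine forall_congr' fun i => forall_congr' fun hi => ?_
  exact omegaCond_pair_iff hk x.2 (by omega) (x.1 ⟨i, by omega⟩).2 (x.1 ⟨i + 1, hi⟩).2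

/-! ### Topology -/

theorem eventually_get?_eq {k : ℕ} (z : DeltaFree k) (n : ℕ) :
    ∀ᶠ y in 𝓝 z, y.word.get? n = z.word.get? n := by
  let : TopologicalSpace (Option Bool) := ⊥
  have : DiscreteTopology (Option Bool) := ⟨rfl⟩
  have h : Continuous fun y : DeltaFree k => y.word.get? n :=
    (continuous_apply n).comp (continuous_induced_dom
      (f := fun (z : DeltaFree k) (n : ℕ) => z.word.get? n))
  exact h.continuousAt.eventually (p := (· = z.word.get? n)) (by simp [nhds_discrete])

theorem eventually_forall_get?_eq {k : ℕ} (z : DeltaFree k) (n : ℕ) :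
    ∀ᶠ y in 𝓝 z, ∀ j ≤ n, y.word.get? j = z.word.get? j := by
  have := (Finset.range (n + 1)).eventually_all.2 fun j _ => eventually_get?_eq z j
  filter_upwards [this] with y hy j hj
  exact hy j (Finset.mem_range.2 (by omega))

theorem take_eq_of_forall {z z' : Stream'.Seq Bool} {n : ℕ}
    (h : ∀ j < n, z.get? j = z'.get? j) : z.take n = z'.take n := by
  apply List.ext_getElem?
  intro i
  rw [Stream'.Seq.getElem?_take, Stream'.Seq.getElem?_take]
  split_ifs with hi
  exacts [h i hi, rfl]

theorem isBreak_congr {k : ℕ} {z z' : DeltaFree k} {n : ℕ}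
    (h : ∀ j ≤ n, z.word.get? j = z'.word.get? j) : IsBreak z n ↔ IsBreak z' n := by
  unfold IsBreak
  rw [h n le_rfl, h (n - 1) (by omega)]

/-- For fixed `i` and `N` the prefix condition involves the letters up to position `N` only, which
are locally constant, and it is a closed condition on p. -/
theorem isClosed_omegaCond {k : ℕ} (hk : 0 < k) : IsClosed {x | OmegaCond k x} := by
  simp only [omegaCond_iff hk, Set.ofPred_forall]
  refine isClosed_iInter fun i => isClosed_iInter fun hi => isClosed_iInter fun N => ?_
  have cont : ∀ c : ℝ, Continuous fun x : (Fin k → ExtInt) × DeltaFree k =>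
      (x.1 ⟨i, by omega⟩).1 + (c : EReal) := by
    intro c
    have h1 : Continuous fun x : EReal => x + (c : EReal) := by
      rw [continuous_iff_continuousAt]
      intro x
      have h := EReal.continuousAt_add (p := (x, (c : EReal))) (Or.inr (by simp)) (Or.inr (by simp))
      exact h.comp (f := fun x : EReal => (x, (c : EReal)))
        (continuousAt_id.prodMk continuousAt_const)
    exact h1.comp (continuous_subtype_val.comp ((continuous_apply _).comp continuous_fst))
  have cont' : Continuous fun x : (Fin k → ExtInt) × DeltaFree k => (x.1 ⟨i + 1, hi⟩).1 :=
    continuous_subtype_val.comp ((continuous_apply _).comp continuous_fst)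
  rw [Set.ofPred_and]
  apply IsClosed.inter
  · rw [← isOpen_compl_iff, isOpen_iff_mem_nhds]
    intro x hx
    simp only [Set.mem_compl_iff, Set.mem_ofPred_eq, Classical.not_imp] at hx
    obtain ⟨h1, h2⟩ := hx
    have h3 := (eventually_forall_get?_eq x.2 N)
    have h3' := (continuous_snd (X := Fin k → ExtInt)).tendsto x |>.eventually h3
    have h4 : ∀ᶠ y in 𝓝 x, ¬ ((y.1 ⟨i, by omega⟩).1 +
        ((exactCount (k - (i + 1)) (x.2.word.take N) : ℝ) : EReal) ≤ (y.1 ⟨i + 1, hi⟩).1) :=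
      (isClosed_le (cont _) cont').isOpen_compl.mem_nhds h2
    filter_upwards [h3', h4] with y hy hy'
    simp only [Set.mem_compl_iff, Set.mem_ofPred_eq, Classical.not_imp]
    rw [isBreak_congr hy, take_eq_of_forall fun j hj => hy j hj.le]
    exact ⟨h1, hy'⟩
  · rw [← isOpen_compl_iff, isOpen_iff_mem_nhds]
    intro x hx
    simp only [Set.mem_compl_iff, Set.mem_ofPred_eq, Classical.not_imp] at hx
    obtain ⟨h1, h2⟩ := hx
    have h3 := (eventually_forall_get?_eq x.2 N)
    have h3' := (continuous_snd (X := Fin k → ExtInt)).tendsto x |>.eventually h3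
    have h4 : ∀ᶠ y in 𝓝 x, ¬ ((y.1 ⟨i, by omega⟩).1 +
        ((exactCount (k - (i + 1)) (x.2.word.take N) : ℝ) : EReal) = (y.1 ⟨i + 1, hi⟩).1) :=
      (isClosed_eq (cont _) cont').isOpen_compl.mem_nhds h2
    filter_upwards [h3', h4] with y hy hy'
    simp only [Set.mem_compl_iff, Set.mem_ofPred_eq, Classical.not_imp]
    rw [hy N le_rfl, take_eq_of_forall fun j hj => hy j hj.le]
    exact ⟨h1, hy'⟩

theorem isClosed_isExtInt :
    IsClosed {x : EReal | x = ⊥ ∨ x = ⊤ ∨ ∃ n : ℤ, x = ((n : ℝ) : EReal)} := by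
  rw [← isOpen_compl_iff]
  have h1 : IsOpen ((Set.range ((↑) : ℤ → ℝ))ᶜ) :=
    Int.isClosedEmbedding_coe_real.isClosed_range.isOpen_compl
  have h2 := EReal.isOpenEmbedding_coe.isOpenMap _ h1
  convert h2 using 1
  ext x
  simp only [Set.mem_compl_iff, Set.mem_ofPred_eq, Set.mem_image, Set.mem_range, not_or, not_exists]
  constructor
  · rintro ⟨h1, h2, h3⟩
    refine ⟨x.toReal, ?_, EReal.coe_toReal h2 h1⟩
    intro n hn
    apply h3 n
    rw [hn, EReal.coe_toReal h2 h1]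
  · rintro ⟨y, hy, rfl⟩
    refine ⟨EReal.coe_ne_bot _, EReal.coe_ne_top _, fun n hn => hy n ?_⟩
    exact (EReal.coe_injective hn).symm

instance instCompactSpaceExtInt : CompactSpace ExtInt :=
  isCompact_iff_compactSpace.1 isClosed_isExtInt.isCompact

/-- Inside the compact product of copies of `Option Bool` two kinds of closed conditions cut out Z:
an ended word stays ended, and no `k` consecutive letters alternate. -/
theorem compactSpace_deltaFree {k : ℕ} (hk : 0 < k) : CompactSpace (DeltaFree k) := by
  let : TopologicalSpace (Option Bool) := ⊥
  have : DiscreteTopology (Option Bool) := ⟨rfl⟩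
  set f : DeltaFree k → ℕ → Option Bool := fun z n => z.word.get? n with hf
  have hind : IsInducing f := ⟨rfl⟩
  rw [← isCompact_univ_iff, hind.isCompact_iff, Set.image_univ]
  apply IsClosed.isCompact
  have hr : Set.range f = (⋂ n, {g | g n = none → g (n + 1) = none}) ∩
      ⋂ a, ⋂ s, {g : ℕ → Option Bool | ¬ ∀ i < k, g (a + i) = some (s ^^ i.bodd)} := by
    ext g
    simp only [Set.mem_range, Set.mem_inter_iff, Set.mem_iInter, Set.mem_ofPred_eq]
    constructor
    · rintro ⟨z, rfl⟩
      refine ⟨fun n h => z.word.2 h, fun a s h => z.not_take_drop_eq a s ?_⟩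
      rwa [take_eq_altWord_iff]
    · rintro ⟨h1, h2⟩
      refine ⟨DeltaFree.ofForall hk ⟨g, fun {n} h => h1 n h⟩ ?_, rfl⟩
      intro a s h
      exact h2 a s ((take_eq_altWord_iff _ a k s).1 h)
  rw [hr]
  have hdisc : ∀ (n : ℕ) (S : Set (Option Bool)), IsClosed {g : ℕ → Option Bool | g n ∈ S} :=
    fun n S => (isClosed_discrete S).preimage (continuous_apply n)
  have hdisc' : ∀ (n : ℕ) (S : Set (Option Bool)), IsOpen {g : ℕ → Option Bool | g n ∈ S} :=
    fun n S => (isOpen_discrete S).preimage (continuous_apply n)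
  apply IsClosed.inter
  · refine isClosed_iInter fun n => ?_
    simp only [imp_iff_not_or]
    exact (hdisc n {none}ᶜ).union (hdisc (n + 1) {none})
  · refine isClosed_iInter fun a => isClosed_iInter fun s => ?_
    rw [← isOpen_compl_iff]
    have : ({g : ℕ → Option Bool | ¬ ∀ i < k, g (a + i) = some (s ^^ i.bodd)})ᶜ =
        ⋂ i ∈ Finset.range k, {g | g (a + i) ∈ ({some (s ^^ i.bodd)} : Set (Option Bool))} := by
      ext g; simp
    rw [this]
    exact isOpen_biInter_finset fun i _ => hdisc' _ _

theorem compactSpace_omegaPre {k : ℕ} (hk : 0 < k) : CompactSpace (OmegaPre k) := by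
  have := compactSpace_deltaFree hk
  exact isCompact_iff_compactSpace.1 (isClosed_omegaCond hk).isCompact

/-! ### Continuity of `ψ` -/

theorem absDiff_of_near {p : ExtInt} {b P : ℤ} {n : ℕ} (hb : |b| ≤ n) (h1 : p.1 = ⊤ → n ≤ P)
    (h2 : p.1 = ⊥ → P ≤ -n) (h3 : ∀ m : ℤ, p.1 = ((m : ℝ) : EReal) → P = m) :
    absDiff p b = |(P : ℝ) + b| - |(P : ℝ)| := by
  have hb' := abs_le.1 hb
  rcases p.2 with h | h | ⟨m, h⟩
  · have := h2 h
    rw [absDiff_bot h, ← Int.cast_add, ← Int.cast_abs, ← Int.cast_abs, abs_of_nonpos (by omega),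
      abs_of_nonpos (by omega)]
    push_cast; ring
  · have := h1 h
    rw [absDiff_top h, ← Int.cast_add, ← Int.cast_abs, ← Int.cast_abs, abs_of_nonneg (by omega),
      abs_of_nonneg (by omega)]
    push_cast; ring
  · rw [absDiff_int h, h3 m h]

/-- Finite points are isolated, and beyond ±|b| adding `b` does not change the sign, so the
difference already has its limiting value. -/
theorem eventually_absDiff_eq (p : ExtInt) (b : ℤ) : ∀ᶠ q in 𝓝 p, absDiff q b = absDiff p b := by
  have hc : Continuous fun q : ExtInt => q.1 := continuous_subtype_val
  rcases p.2 with h | h | ⟨m, h⟩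
  · have : ∀ᶠ q : ExtInt in 𝓝 p, q.1 < (((-|b| : ℤ) : ℝ) : EReal) :=
      hc.continuousAt.eventually (gt_mem_nhds (by simp only [h]; exact EReal.bot_lt_coe _))
    filter_upwards [this] with q hq
    rw [absDiff_bot h]
    rcases q.2 with h' | h' | ⟨n, h'⟩
    · rw [absDiff_bot h']
    · rw [h'] at hq; simp at hq
    · rw [h', EReal.coe_lt_coe_iff, Int.cast_lt] at hq
      have h1 := neg_abs_le b
      have h2 := le_abs_self b
      rw [absDiff_int h', ← Int.cast_add, ← Int.cast_abs, ← Int.cast_abs,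
        abs_of_nonpos (show n + b ≤ 0 by omega), abs_of_nonpos (show n ≤ 0 by omega)]
      push_cast; ring
  · have : ∀ᶠ q : ExtInt in 𝓝 p, (((|b| : ℤ) : ℝ) : EReal) < q.1 :=
      hc.continuousAt.eventually (lt_mem_nhds (by simp only [h]; exact EReal.coe_lt_top _))
    filter_upwards [this] with q hq
    rw [absDiff_top h]
    rcases q.2 with h' | h' | ⟨n, h'⟩
    · rw [h'] at hq; simp at hq
    · rw [absDiff_top h']
    · rw [h', EReal.coe_lt_coe_iff, Int.cast_lt] at hq
      have h1 := neg_abs_le b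
      have h2 := le_abs_self b
      rw [absDiff_int h', ← Int.cast_add, ← Int.cast_abs, ← Int.cast_abs,
        abs_of_nonneg (show 0 ≤ n + b by omega), abs_of_nonneg (show 0 ≤ n by omega)]
      push_cast; ring
  · have h1 : ∀ᶠ q : ExtInt in 𝓝 p, (((m - 1 : ℤ) : ℝ) : EReal) < q.1 :=
      hc.continuousAt.eventually (lt_mem_nhds (by
        simp only [h]; rw [EReal.coe_lt_coe_iff, Int.cast_lt]; omega))
    have h2 : ∀ᶠ q : ExtInt in 𝓝 p, q.1 < (((m + 1 : ℤ) : ℝ) : EReal) :=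
      hc.continuousAt.eventually (gt_mem_nhds (by
        simp only [h]; rw [EReal.coe_lt_coe_iff, Int.cast_lt]; omega))
    filter_upwards [h1, h2] with q hq1 hq2
    rcases q.2 with h' | h' | ⟨n, h'⟩
    · rw [h'] at hq1; simp at hq1
    · rw [h'] at hq2; simp at hq2
    · rw [h', EReal.coe_lt_coe_iff, Int.cast_lt] at hq1 hq2
      obtain rfl : n = m := by omega
      rw [absDiff_int h', absDiff_int h]

theorem eventually_phi_eq {k : ℕ} (hk : 0 < k) (w : Artin k) (z : DeltaFree k) :
    ∀ᶠ y in 𝓝 z, phi k w y = phi k w z := by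
  obtain ⟨N, hN⟩ := exists_phi_eq_take hk w
  filter_upwards [eventually_forall_get?_eq z N] with y hy
  rw [hN N le_rfl, hN N le_rfl, take_eq_of_forall fun j hj => hy j hj.le]

/-- The function `ψ_{p,z}` as a continuous function on the discrete group `A_k`. -/
def psiMap (k : ℕ) (x : OmegaPre k) : C(Artin k, ℝ) where
  toFun := psi k x
  continuous_toFun := continuous_of_discreteTopology

theorem continuous_psiMap {k : ℕ} (hk : 0 < k) : Continuous (psiMap k) := by
  rw [← ContinuousMap.homeoFnOfDiscrete.comp_continuous_iff, continuous_pi_iff]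
  intro w
  rw [continuous_iff_continuousAt]
  intro x
  have h1 : ∀ᶠ y : OmegaPre k in 𝓝 x, phi k w y.1.2 = phi k w x.1.2 :=
    (continuous_snd.comp continuous_subtype_val).continuousAt.eventually
      (eventually_phi_eq hk w x.1.2)
  have h2 : ∀ᶠ y : OmegaPre k in 𝓝 x, ∀ i,
      absDiff (y.1.1 i) (phi k w x.1.2 i) = absDiff (x.1.1 i) (phi k w x.1.2 i) := by
    rw [eventually_all]
    intro i
    have hc : Continuous fun y : OmegaPre k => y.1.1 i :=
      (continuous_apply i).comp (continuous_fst.comp continuous_subtype_val)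
    exact hc.continuousAt.eventually (eventually_absDiff_eq (x.1.1 i) (phi k w x.1.2 i))
  have h3 : ∀ᶠ y : OmegaPre k in 𝓝 x, psi k y w = psi k x w := by
    filter_upwards [h1, h2] with y hy hy'
    unfold psi
    exact Finset.sum_congr rfl fun i _ => by rw [hy, hy' i]
  exact (tendsto_congr' h3).2 tendsto_const_nhds

/-! ### Invariance of `ψ` under the identifications -/

/-- Each generator adds one to the coordinate sum of π, which is thus the exponent sum. Consequently
the sum of φ(w,z) does not depend on `z`, and this makes ψ constant on the two collapsed classes. -/
theorem sum_piVec_mul {k : ℕ} (hk : 0 < k) (g x : Artin k) :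
    ∑ i, piVec k (g * x) i = ∑ i, piVec k g i + ∑ i, piVec k x i := by
  have step : ∀ (s : Bool) (y : Artin k), ∑ i, piVec k (gen k s * y) i = ∑ i, piVec k y i + 1 := by
    intro s y
    rw [piVec_gen_mul hk]
    simp [Finset.sum_add_distrib]
  induction g using artin_induction with
  | one => simp [piVec_one hk]
  | mul s g ih => rw [mul_assoc, step, step, ih]; ring
  | inv_mul s g ih =>
    have h1 := step s ((gen k s)⁻¹ * g)
    have h2 := step s ((gen k s)⁻¹ * (g * x))
    rw [mul_inv_cancel_left] at h1 h2
    rw [mul_assoc]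
    linarith

theorem sum_phi {k : ℕ} (hk : 0 < k) (w : Artin k) (z : DeltaFree k) :
    ∑ i, phi k w z i = ∑ i, piVec k w⁻¹ i := by
  obtain ⟨N, hN⟩ := exists_phi_eq_take hk w
  rw [hN N le_rfl]
  simp only [phiElt, Pi.sub_apply, Finset.sum_sub_distrib]
  rw [sum_piVec_mul hk]; ring

theorem psi_congr {k : ℕ} (hk : 0 < k) {x y : OmegaPre k} (h : (omegaSetoid k).r x y) :
    psiMap k x = psiMap k y := by
  rcases h with rfl | ⟨h1, h2⟩
  · rfl
  · ext w
    change psi k x w = psi k y w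
    unfold psi
    rw [← h1]
    have hs : ∑ i, (phi k w x.1.2 i : ℝ) = ∑ i, (phi k w y.1.2 i : ℝ) := by
      rw [← Int.cast_sum, ← Int.cast_sum, sum_phi hk, sum_phi hk]
    rcases h2 with h2 | h2
    · simp only [absDiff_top (h2 _)]
      exact hs
    · simp only [absDiff_bot (h2 _), Finset.sum_neg_distrib]
      rw [hs]

/-! ### Density -/

theorem psi_eq_distFun {k : ℕ} (hk : 1 < k) (x : OmegaPre k) {w g : Artin k} {n : ℕ}
    (hφ : phi k w x.1.2 = phiElt k w g) (hn : ∀ i, |phi k w x.1.2 i| ≤ n)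
    (h1 : ∀ i, (x.1.1 i).1 = ⊤ → n ≤ piVec k g i) (h2 : ∀ i, (x.1.1 i).1 = ⊥ → piVec k g i ≤ -n)
    (h3 : ∀ i, ∀ m : ℤ, (x.1.1 i).1 = ((m : ℝ) : EReal) → piVec k g i = m) :
    distFun k g w = psi k x w := by
  rw [distFun_apply hk, psi]
  refine Finset.sum_congr rfl fun i _ => ?_
  rw [absDiff_of_near (hn i) (h1 i) (h2 i) (h3 i), hφ]

/-! ### Approximating points of Ω' by group elements. -/

theorem runsLT_iff {k : ℕ} {l : List Bool} : RunsLT k l ↔ ∀ n ≥ k, runCount n l = 0 := by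
  refine ⟨fun h n hn => h.runCount_eq_zero hn, fun h => ?_⟩
  induction l with
  | nil => trivial
  | cons s l ih =>
    refine ⟨?_, ih fun n hn => ?_⟩
    · by_contra hlt
      have := h (leadRun (!s) l + 1) (by omega)
      rw [runCount_cons, if_pos rfl] at this
      omega
    · have := h n hn
      rw [runCount_cons] at this
      omega

theorem RunsLT.append {k : ℕ} {l l' : List Bool} (hl : RunsLT k l) (hl' : RunsLT k l')
    (h : ∀ s, l.getLast? = some s → leadRun (!s) l' = 0) : RunsLT k (l ++ l') := by
  rw [runsLT_iff] at *
  intro n hn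
  rw [(runCount_append n h).1, hl n hn, hl' n hn]

theorem runsLT_altWord {k m : ℕ} (hm : m < k) (s : Bool) : RunsLT k (altWord s m) := by
  simpa using runsLT_altWord_append (s := s) (l := []) hm rfl trivial

/-- A word without `Δ` can be extended so as to have prescribed numbers of runs. -/
theorem exists_extension {k : ℕ} {l : List Bool} (hl : RunsLT k l) {e : ℕ → ℕ}
    (he : ∀ j, 1 ≤ j → j < k → exactCount j l ≤ e j) :
    ∃ l', RunsLT k l' ∧ l <+: l' ∧ ∀ j, 1 ≤ j → j < k → exactCount j l' = e j := by
  induction hD : ∑ j ∈ Finset.Ico 1 k, (e j - exactCount j l) generalizing l with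
  | zero =>
    refine ⟨l, hl, List.prefix_rfl, fun j h1 h2 => ?_⟩
    have := (Finset.sum_eq_zero_iff.1 hD) j (Finset.mem_Ico.2 ⟨h1, h2⟩)
    have := he j h1 h2
    omega
  | succ D ih =>
    obtain ⟨j, hj, hj'⟩ := Finset.exists_ne_zero_of_sum_ne_zero (by rw [hD]; omega)
    obtain ⟨h1, h2⟩ := Finset.mem_Ico.1 hj
    -- The new run starts by repeating the last letter of `l`, so it stays separate; for empty `l`
    -- any letter will do.
    obtain ⟨t, ht⟩ : ∃ t, ∀ s, l.getLast? = some s → s = t := by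
      rcases l.getLast? with _ | s
      · exact ⟨true, by simp⟩
      · exact ⟨s, by simp⟩
    have hb : ∀ s, l.getLast? = some s → leadRun (!s) (altWord t j) = 0 := by
      intro s hs
      obtain ⟨d, rfl⟩ : ∃ d, j = d + 1 := ⟨j - 1, by omega⟩
      rw [ht s hs, altWord_succ, leadRun_not_cons]
    have hc : ∀ i, 1 ≤ i → exactCount i (l ++ altWord t j) =
        exactCount i l + if j = i then 1 else 0 := by
      intro i hi
      rw [exactCount_append hi hb, exactCount_altWord hi]
    obtain ⟨l', h3, h4, h5⟩ := ih (hl.append (runsLT_altWord h2 t) hb) (by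
      intro i hi hik
      rw [hc i hi]
      have := he i hi hik
      split_ifs with hji
      · subst hji; omega
      · omega) (by
      rw [← Finset.add_sum_erase _ _ hj] at hD ⊢
      rw [hc j h1, if_pos rfl]
      have : ∑ i ∈ (Finset.Ico 1 k).erase j, (e i - exactCount i (l ++ altWord t j)) =
          ∑ i ∈ (Finset.Ico 1 k).erase j, (e i - exactCount i l) := by
        refine Finset.sum_congr rfl fun i hi => ?_
        obtain ⟨hne, hi⟩ := Finset.mem_erase.1 hi
        rw [hc i (Finset.mem_Ico.1 hi).1, if_neg (Ne.symm hne), add_zero]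
      rw [this]
      omega)
    exact ⟨l', h3, (List.prefix_append _ _).trans h4, h5⟩

theorem piVec_ofNF {k : ℕ} (hk : 0 < k) {l : List Bool} (hl : RunsLT k l) (r : ℤ) (i : Fin k) :
    piVec k (ofNF k (l, r)) i = r + runCount (k - i) l := by
  rw [piVec_eq hk, nf_ofNF hk hl]

/-- A vector of partial sums is `π` of the group element `l Δ^r`, if the differences of its
coordinates are the numbers of runs of `l`. -/
theorem piVec_ofNF_eq {k : ℕ} (hk : 0 < k) {l : List Bool} (hl : RunsLT k l) {P : Fin k → ℤ}
    (h : ∀ (i : ℕ) (hi : i + 1 < k),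
      P ⟨i, by omega⟩ + exactCount (k - (i + 1)) l = P ⟨i + 1, hi⟩) (i : Fin k) :
    piVec k (ofNF k (l, P ⟨0, hk⟩)) i = P i := by
  rw [piVec_ofNF hk hl]
  obtain ⟨i, hi⟩ := i
  induction i with
  | zero => simp [hl.runCount_eq_zero]
  | succ i ih =>
    have h1 := ih (by omega)
    have h2 := runCount_eq_add_exactCount (n := k - (i + 1)) (by omega) l
    rw [show k - (i + 1) + 1 = k - i by omega] at h2
    rw [← h i hi, ← h1]
    simp only [h2]
    push_cast; ring

theorem exists_near_of_not_terminates {k : ℕ} (hk : 0 < k) (x : OmegaPre k) (n : ℕ) :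
    ∃ N ≥ n, IsBreak x.1.2 N ∧ ∃ P : Fin k → ℤ,
      (∀ (i : ℕ) (hi : i + 1 < k), P ⟨i, by omega⟩ +
        exactCount (k - (i + 1)) (x.1.2.word.take N) ≤ P ⟨i + 1, hi⟩) ∧
      (∀ i, (x.1.1 i).1 = ⊤ → n ≤ P i) ∧ (∀ i, (x.1.1 i).1 = ⊥ → P i ≤ -n) ∧
      ∀ i, ∀ m : ℤ, (x.1.1 i).1 = ((m : ℝ) : EReal) → P i = m := by
  obtain ⟨N, hN, hbr⟩ := exists_isBreak hk x.1.2 n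
  refine ⟨N, hN, hbr, ?_⟩
  have hcond := (omegaCond_iff hk x.1).1 x.2
  set p : Fin k → EReal := fun i => (x.1.1 i).1 with hp
  set e : ℕ → ℕ := fun i => exactCount (k - (i + 1)) (x.1.2.word.take N) with he
  have hext : ∀ i, ∃ m : ℤ, ∀ m' : ℤ, p i = ((m' : ℝ) : EReal) → m = m' := by
    intro i
    rcases (x.1.1 i).2 with h | h | ⟨m, h⟩
    · exact ⟨0, fun m' h' => by simp only [hp] at h'; rw [h] at h'; simp at h'⟩
    · exact ⟨0, fun m' h' => by simp only [hp] at h'; rw [h] at h'; simp at h'⟩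
    · refine ⟨m, fun m' h' => ?_⟩
      simp only [hp] at h'
      rw [h] at h'
      exact_mod_cast EReal.coe_injective h'
  choose q hq using hext
  -- `c` dominates the required size `n`, all finite coordinates and all run counts of the prefix.
  set c : ℤ := n + ∑ i, |q i| + ∑ i ∈ Finset.range k, (e i : ℤ) with hc
  have hs1 : 0 ≤ ∑ i, |q i| := Finset.sum_nonneg fun _ _ => abs_nonneg _
  have hs2 : 0 ≤ ∑ i ∈ Finset.range k, (e i : ℤ) :=
    Finset.sum_nonneg fun _ _ => Int.natCast_nonneg _
  have hcq : ∀ i, |q i| ≤ c := by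
    intro i
    have := Finset.single_le_sum (f := fun i => |q i|) (fun _ _ => abs_nonneg _) (Finset.mem_univ i)
    omega
  have hce : ∀ i, i < k → (e i : ℤ) ≤ c := by
    intro i hi
    have := Finset.single_le_sum (f := fun i => (e i : ℤ)) (fun _ _ => Int.natCast_nonneg _)
      (Finset.mem_range.2 hi)
    omega
  have hcn : (n : ℤ) ≤ c := by omega
  have hc0 : 0 ≤ c := by omega
  classical
  -- Infinite coordinates become ramps of slope `c`, so that every gap next to one of them is at
  -- least `c` and leaves room for the runs already present.
  set P : Fin k → ℤ := fun i => if p i = ⊤ then c * (i + 1) else if p i = ⊥ then -(c * (k - i))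
    else q i with hP
  have hPtop : ∀ i, p i = ⊤ → P i = c * (i + 1) := fun i h => by simp only [hP]; rw [if_pos h]
  have hPbot : ∀ i, p i = ⊥ → P i = -(c * (k - i)) := fun i h => by
    simp only [hP]; rw [if_neg (by rw [h]; simp), if_pos h]
  have hPint : ∀ i, ∀ m : ℤ, p i = ((m : ℝ) : EReal) → P i = m := fun i m h => by
    simp only [hP]
    rw [if_neg (by rw [h]; exact EReal.coe_ne_top _), if_neg (by rw [h]; exact EReal.coe_ne_bot _)]
    exact hq i m h
  have hPint' : ∀ i, ∀ m : ℤ, p i = ((m : ℝ) : EReal) → |P i| ≤ c := fun i m h => by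
    rw [hPint i m h, ← hq i m h]; exact hcq i
  refine ⟨P, ?_, ?_, ?_, hPint⟩
  · intro i hi
    have h1 := (hcond i hi N).1 hbr
    have h2 := hce i (by omega)
    change P ⟨i, by omega⟩ + e i ≤ P ⟨i + 1, hi⟩
    change p ⟨i, by omega⟩ + ((e i : ℝ) : EReal) ≤ p ⟨i + 1, hi⟩ at h1
    set j : Fin k := ⟨i, by omega⟩ with hj
    set j' : Fin k := ⟨i + 1, hi⟩ with hj'
    have hjv : (j : ℕ) = i := rfl
    have hjv' : (j' : ℕ) = i + 1 := rfl
    have hki : (i : ℤ) + 2 ≤ k := by omega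
    have hi0 : (0 : ℤ) ≤ i := by omega
    rcases (x.1.1 j).2 with h | h | ⟨m, h⟩ <;> rcases (x.1.1 j').2 with h' | h' | ⟨m', h'⟩ <;>
      change p j = _ at h <;> change p j' = _ at h'
    · rw [hPbot _ h, hPbot _ h', hjv, hjv']; push_cast; nlinarith
    · rw [hPbot _ h, hPtop _ h', hjv, hjv']; push_cast; nlinarith
    · have := (abs_le.1 (hPint' _ _ h')).1
      rw [hPbot _ h, hjv]; nlinarith
    · rw [h, h', EReal.top_add_coe] at h1; simp at h1
    · rw [hPtop _ h, hPtop _ h', hjv, hjv']; push_cast; nlinarith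
    · rw [h, h', EReal.top_add_coe, top_le_iff] at h1
      exact absurd h1 (EReal.coe_ne_top _)
    · rw [h, h', ← EReal.coe_add, le_bot_iff] at h1; exact absurd h1 (EReal.coe_ne_bot _)
    · have := (abs_le.1 (hPint' _ _ h)).2
      rw [hPtop _ h', hjv']; push_cast; nlinarith
    · rw [hPint _ _ h, hPint _ _ h']
      rw [h, h', ← EReal.coe_add, EReal.coe_le_coe_iff] at h1
      exact_mod_cast h1
  · intro i h
    rw [hPtop i h]
    have : (0 : ℤ) ≤ (i : ℕ) := by omega
    nlinarith
  · intro i h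
    rw [hPbot i h]
    have : ((i : ℕ) : ℤ) + 1 ≤ k := by have := i.2; omega
    nlinarith

/-- For a finite word all gaps are prescribed, so p is determined by its coordinate 0: all
coordinates are finite or all are the same infinity, and only one integer has to be chosen. -/
theorem exists_near_of_terminated {k : ℕ} (hk : 0 < k) (x : OmegaPre k) (n : ℕ) {N : ℕ}
    (hN : x.1.2.word.get? N = none) :
    ∃ P : Fin k → ℤ,
      (∀ (i : ℕ) (hi : i + 1 < k), P ⟨i, by omega⟩ +
        exactCount (k - (i + 1)) (x.1.2.word.take N) = P ⟨i + 1, hi⟩) ∧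
      (∀ i, (x.1.1 i).1 = ⊤ → n ≤ P i) ∧ (∀ i, (x.1.1 i).1 = ⊥ → P i ≤ -n) ∧
      ∀ i, ∀ m : ℤ, (x.1.1 i).1 = ((m : ℝ) : EReal) → P i = m := by
  have hcond := (omegaCond_iff hk x.1).1 x.2
  set l := x.1.2.word.take N with hl
  have hrun : RunsLT k l := x.1.2.runsLT_take N
  have hval : ∀ (r : ℤ) (i : ℕ) (hi : i + 1 < k),
      r + (runCount (k - i) l : ℤ) + exactCount (k - (i + 1)) l = r + runCount (k - (i + 1)) l := by
    intro r i hi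
    have h2 := runCount_eq_add_exactCount (n := k - (i + 1)) (by omega) l
    rw [show k - (i + 1) + 1 = k - i by omega] at h2
    rw [h2]; push_cast; ring
  have hp : ∀ i (hi : i < k), (x.1.1 ⟨i, hi⟩).1 =
      (x.1.1 ⟨0, hk⟩).1 + ((runCount (k - i) l : ℝ) : EReal) := by
    intro i hi
    induction i with
    | zero =>
      rw [tsub_zero, hrun.runCount_eq_zero le_rfl, Nat.cast_zero, EReal.coe_zero, add_zero]
    | succ i ih =>
      rw [← (hcond i hi N).2 hN, ih (by omega), add_assoc, ← EReal.coe_add]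
      congr 2
      have := hval 0 i hi
      simp only [zero_add] at this
      exact_mod_cast this
  rcases (x.1.1 ⟨0, hk⟩).2 with h0 | h0 | ⟨m, h0⟩
  -- `runCount 1` is the largest of the run counts that occur, so every coordinate is at most `-n`.
  · refine ⟨fun i => -n - runCount 1 l + runCount (k - i) l, fun i hi => hval _ i hi, ?_, ?_, ?_⟩
    · intro i h
      rw [hp i i.2, h0, EReal.bot_add] at h
      simp at h
    · intro i _
      have := runCount_anti (l := l) (m := 1) (n := k - i) le_rfl (by omega)
      simp only
      omega
    · intro i m h
      rw [hp i i.2, h0, EReal.bot_add] at h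
      exact absurd h.symm (EReal.coe_ne_bot _)
  · refine ⟨fun i => n + runCount (k - i) l, fun i hi => hval _ i hi, ?_, ?_, ?_⟩
    · intro i _
      simp only
      omega
    · intro i h
      rw [hp i i.2, h0, EReal.top_add_coe] at h
      simp at h
    · intro i m h
      rw [hp i i.2, h0, EReal.top_add_coe] at h
      exact absurd h.symm (EReal.coe_ne_top _)
  · refine ⟨fun i => m + runCount (k - i) l, fun i hi => hval _ i hi, ?_, ?_, ?_⟩
    · intro i h
      rw [hp i i.2, h0, ← EReal.coe_add] at h
      exact absurd h (EReal.coe_ne_top _)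
    · intro i h
      rw [hp i i.2, h0, ← EReal.coe_add] at h
      exact absurd h (EReal.coe_ne_bot _)
    · intro i m' h
      rw [hp i i.2, h0, ← EReal.coe_add, EReal.coe_eq_coe_iff] at h
      exact_mod_cast h

theorem exists_near {k : ℕ} (hk : 0 < k) (x : OmegaPre k) (n : ℕ) :
    ∃ g : Artin k, (nf hk g).1.take n = x.1.2.word.take n ∧
      (∀ i, (x.1.1 i).1 = ⊤ → n ≤ piVec k g i) ∧ (∀ i, (x.1.1 i).1 = ⊥ → piVec k g i ≤ -n) ∧
      ∀ i, ∀ m : ℤ, (x.1.1 i).1 = ((m : ℝ) : EReal) → piVec k g i = m := by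
  by_cases hz : x.1.2.word.Terminates
  · obtain ⟨N, hN⟩ := hz
    obtain ⟨P, h0, h1, h2, h3⟩ := exists_near_of_terminated hk x n
      (N := max n N) (x.1.2.word.le_stable (le_max_right _ _) hN)
    have hrun := x.1.2.runsLT_take (max n N)
    have hP := piVec_ofNF_eq hk hrun h0
    refine ⟨_, ?_, fun i h => (hP i).symm ▸ h1 i h, fun i h => (hP i).symm ▸ h2 i h,
      fun i m h => (hP i).symm ▸ h3 i m h⟩
    rw [nf_ofNF hk hrun]
    exact take_take _ (le_max_left _ _)
  · obtain ⟨N, hN, hbr, P, h0, h1, h2, h3⟩ := exists_near_of_not_terminates hk x n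
    -- `Q` merely extends `P` to all of ℕ; the gaps of `P` are the numbers of runs that the extended
    -- word must have.
    set Q : ℕ → ℤ := fun i => if h : i < k then P ⟨i, h⟩ else 0 with hQ
    obtain ⟨l, hrun, hpre, hl⟩ := exists_extension (x.1.2.runsLT_take N)
      (e := fun j => (Q (k - j) - Q (k - j - 1)).toNat) (by
        intro j hj1 hj2
        have := h0 (k - j - 1) (by omega)
        simp only [hQ]
        rw [dif_pos (by omega), dif_pos (by omega)]
        simp only [show k - j - 1 + 1 = k - j by omega, show k - (k - j) = j by omega] at this
        omega)
    have hP := piVec_ofNF_eq hk hrun (P := P) (by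
      intro i hi
      have h4 := hl (k - (i + 1)) (by omega) (by omega)
      have h5 := h0 i hi
      simp only [hQ] at h4
      rw [dif_pos (by omega), dif_pos (by omega)] at h4
      simp only [show k - (k - (i + 1)) = i + 1 by omega, add_tsub_cancel_right] at h4
      rw [h4]
      omega)
    refine ⟨_, ?_, fun i h => (hP i).symm ▸ h1 i h, fun i h => (hP i).symm ▸ h2 i h,
      fun i m h => (hP i).symm ▸ h3 i m h⟩
    rw [nf_ofNF hk hrun]
    obtain ⟨t, rfl⟩ := hpre
    have hlen : n ≤ (x.1.2.word.take N).length := by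
      rcases Nat.eq_zero_or_pos N with rfl | hN0
      · omega
      · have := length_take_of_get?_ne_none (z := x.1.2.word) (a := 0) hN0
          fun h => hz ⟨_, h⟩
        rw [Stream'.Seq.drop_zero] at this
        omega
    simp only
    rw [List.take_append_of_le_length hlen, take_take _ hN]

/-- For each fixed `w` the approximation is eventually exact: once enough letters agree φ is
correct, and once the large coordinates exceed |φ| they behave as infinite ones. -/
theorem psiMap_mem_closure {k : ℕ} (hk : 1 < k) (x : OmegaPre k) :
    psiMap k x ∈ horoCompactification k := by
  have hk0 : 0 < k := by omega
  choose g hg using exists_near hk0 x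
  have key : Tendsto (fun n => distFun k (g n)) atTop (𝓝 (psiMap k x)) := by
    rw [ContinuousMap.homeoFnOfDiscrete.isInducing.tendsto_nhds_iff, tendsto_pi_nhds]
    intro w
    obtain ⟨N, hN⟩ := exists_phi_eq hk0 w
    have : ∀ᶠ n in atTop, distFun k (g n) w = psi k x w := by
      filter_upwards [eventually_ge_atTop (max N (∑ i, (phi k w x.1.2 i).natAbs))] with n hn
      obtain ⟨h0, h1, h2, h3⟩ := hg n
      refine psi_eq_distFun hk x (hN x.1.2 (g n) ?_).1 (fun i => ?_) h1 h2 h3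
      · have := congrArg (List.take N) h0
        rwa [List.take_take, min_eq_left (by omega), take_take _ (by omega)] at this
      · have := Finset.single_le_sum (f := fun i => (phi k w x.1.2 i).natAbs)
          (fun _ _ => Nat.zero_le _) (Finset.mem_univ i)
        rw [Int.abs_eq_natAbs]
        omega
    exact (tendsto_congr' this).2 tendsto_const_nhds
  exact mem_closure_of_tendsto key (Eventually.of_forall fun n => ⟨g n, rfl⟩)

/-! ### Group elements and `Ω₀` -/

/-- The point of `Ω'` that corresponds to a group element. -/
def ofGroup {k : ℕ} (hk : 0 < k) (g : Artin k) : OmegaPre k :=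
  ⟨(fun i => intExt (piVec k g i), finiteWord hk (nf hk g).1 (runsLT_nf hk g)), by
    rw [omegaCond_iff hk]
    intro i hi N
    set z := finiteWord hk (nf hk g).1 (runsLT_nf hk g) with hz
    have key : ∀ N, z.word.get? N = none → (intExt (piVec k g ⟨i, by omega⟩)).1 +
        ((exactCount (k - (i + 1)) (z.word.take N) : ℝ) : EReal) =
          (intExt (piVec k g ⟨i + 1, hi⟩)).1 := by
      intro N hN
      have ht : z.word.take N = (nf hk g).1 := by
        change (Stream'.Seq.ofList _).take N = _
        change (Stream'.Seq.ofList _).get? N = none at hN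
        rw [Stream'.Seq.ofList_get?, List.getElem?_eq_none_iff] at hN
        rw [take_ofList, List.take_of_length_le hN]
      rw [ht, intExt, intExt, ← EReal.coe_add, EReal.coe_eq_coe_iff, piVec_eq hk, piVec_eq hk]
      have h2 := runCount_eq_add_exactCount (n := k - (i + 1)) (by omega) (nf hk g).1
      rw [show k - (i + 1) + 1 = k - i by omega] at h2
      simp only [h2]
      push_cast; ring
    refine ⟨fun hN => ?_, key N⟩
    obtain ⟨M, hM⟩ := finiteWord_terminates hk (nf hk g).1 (runsLT_nf hk g)
    rw [← key M hM]
    gcongr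
    have h1 := exactCount_le_numSub hk (z := z) (n := k - (i + 1)) (by omega) hN
    rw [numSub_of_terminated hk (by omega) hM] at h1
    exact_mod_cast h1⟩

theorem psiMap_ofGroup {k : ℕ} (hk : 1 < k) (g : Artin k) :
    psiMap k (ofGroup (by omega) g) = distFun k g := by
  have hk0 : 0 < k := by omega
  ext w
  obtain ⟨N, hN⟩ := exists_phi_eq hk0 w
  refine (psi_eq_distFun hk (ofGroup hk0 g) (w := w) (g := g)
    (n := ∑ i, (phi k w (ofGroup hk0 g).1.2 i).natAbs) (hN _ g ?_).1 (fun i => ?_) ?_ ?_ ?_).symm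
  · exact (take_ofList _ _).symm
  · rw [Int.abs_eq_natAbs]
    exact_mod_cast Finset.single_le_sum (f := fun i => (phi k w (ofGroup hk0 g).1.2 i).natAbs)
      (fun _ _ => Nat.zero_le _) (Finset.mem_univ i)
  · intro i h
    exact absurd h (EReal.coe_ne_top _)
  · intro i h
    exact absurd h (EReal.coe_ne_bot _)
  · intro i m h
    exact_mod_cast EReal.coe_injective h

theorem ofGroup_mem_Omega0 {k : ℕ} (hk : 0 < k) (g : Artin k) :
    Quotient.mk (omegaSetoid k) (ofGroup hk g) ∈ Omega0 k := by
  have hz := finiteWord_terminates hk _ (runsLT_nf hk g)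
  refine ⟨_, rfl, fun i => ⟨_, rfl⟩, hz, fun i hi => ?_⟩
  exact ((ofGroup hk g).2 i hi (fun h => EReal.coe_ne_bot _ h.1)
    (fun h => EReal.coe_ne_top _ h.1)).2 hz

theorem exists_distFun_eq {k : ℕ} (hk : 1 < k) {x : OmegaPre k}
    (hp : ∀ i, ∃ n : ℤ, (x.1.1 i).1 = ((n : ℝ) : EReal)) (hz : x.1.2.word.Terminates) :
    ∃ g, distFun k g = psiMap k x := by
  have hk0 : 0 < k := by omega
  obtain ⟨N, hN⟩ := hz
  obtain ⟨P, h0, h1, h2, h3⟩ := exists_near_of_terminated hk0 x 0 hN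
  have hrun := x.1.2.runsLT_take N
  have hP := piVec_ofNF_eq hk0 hrun h0
  refine ⟨ofNF k (x.1.2.word.take N, P ⟨0, hk0⟩), ?_⟩
  ext w
  refine psi_eq_distFun hk x (n := ∑ i, (phi k w x.1.2 i).natAbs) ?_ (fun i => ?_) ?_ ?_ ?_
  · rw [phi_eq_of_terminated hk0 w x.1.2 hN, ofNF, phiElt_right_mul_garside_zpow hk0]
  · rw [Int.abs_eq_natAbs]
    exact_mod_cast Finset.single_le_sum (f := fun i => (phi k w x.1.2 i).natAbs)
      (fun _ _ => Nat.zero_le _) (Finset.mem_univ i)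
  · intro i h
    obtain ⟨n, hn⟩ := hp i
    rw [hn] at h
    exact absurd h (EReal.coe_ne_top _)
  · intro i h
    obtain ⟨n, hn⟩ := hp i
    rw [hn] at h
    exact absurd h (EReal.coe_ne_bot _)
  · intro i m h
    rw [hP, h3 i m h]

/-! ### Injectivity -/

theorem phi_mul_garside_zpow {k : ℕ} (hk : 0 < k) (w : Artin k) (n : ℤ) (z : DeltaFree k)
    (i : Fin k) : phi k (w * garside k ^ n) z i = phi k w z i - n := by
  obtain ⟨N, hN⟩ := exists_phi_eq_take hk w
  obtain ⟨N', hN'⟩ := exists_phi_eq_take hk (w * garside k ^ n)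
  rw [hN _ (le_max_left N N'), hN' _ (le_max_right N N'), phiElt_mul_garside_zpow hk]

theorem psi_mul_garside_zpow {k : ℕ} (hk : 0 < k) (x : OmegaPre k) (w : Artin k) (n : ℤ) :
    psi k x (w * garside k ^ n) = ∑ i, absDiff (x.1.1 i) (phi k w x.1.2 i - n) := by
  unfold psi
  simp only [phi_mul_garside_zpow hk]

/-- The coordinates of `p + φ(w, z)`. -/
def shifted {k : ℕ} (x : OmegaPre k) (w : Artin k) (i : Fin k) : EReal :=
  (x.1.1 i).1 + ((phi k w x.1.2 i : ℝ) : EReal)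

theorem isExtInt_shifted {k : ℕ} (x : OmegaPre k) (w : Artin k) (i : Fin k) :
    IsExtInt (shifted x w i) :=
  IsExtInt.add_int (x.1.1 i).2 _

open Classical in
/-- `1` for `q ≤ n` and `-1` otherwise. -/
def sign (q : EReal) (n : ℤ) : ℝ := if q ≤ ((n : ℝ) : EReal) then 1 else -1

theorem psi_sub_psi {k : ℕ} (hk : 0 < k) (x : OmegaPre k) (w w' : Artin k) (n : ℤ)
    {S : Finset (Fin k)} (h : ∀ i, phi k w' x.1.2 i = phi k w x.1.2 i - if i ∈ S then 1 else 0) :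
    psi k x (w' * garside k ^ n) - psi k x (w * garside k ^ n) =
      ∑ i ∈ S, sign (shifted x w i) n := by
  rw [psi_mul_garside_zpow hk, psi_mul_garside_zpow hk, ← Finset.sum_sub_distrib,
    ← Finset.sum_subset (Finset.subset_univ S)]
  · refine Finset.sum_congr rfl fun i hi => ?_
    rw [h, if_pos hi, absDiff_sub_one]
    unfold sign shifted
    congr
  · intro i _ hi
    rw [h, if_neg hi, sub_zero, sub_self]

/-- One more factor Δ lowers all coordinates by one, so the increment of ψ is a sum of signs over
all coordinates. -/
theorem sum_sign_eq {k : ℕ} (hk : 0 < k) {x y : OmegaPre k} (h : psi k x = psi k y)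
    (w : Artin k) (n : ℤ) :
    ∑ i, sign (shifted x w i) n = ∑ i, sign (shifted y w i) n := by
  have h1 : ∀ x : OmegaPre k, psi k x (w * garside k ^ (1 : ℤ) * garside k ^ n) -
      psi k x (w * garside k ^ n) = ∑ i, sign (shifted x w i) n := by
    intro x
    apply psi_sub_psi hk
    intro i
    rw [phi_mul_garside_zpow hk]; simp
  rw [← h1, ← h1, h]

theorem exists_threshold {k : ℕ} {q : Fin k → EReal} (hq : Monotone q) (n : ℤ) :
    ∃ s ≤ k, ∀ i : Fin k, q i ≤ ((n : ℝ) : EReal) ↔ (i : ℕ) < s := by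
  classical
  by_cases h : ∃ i : ℕ, ∃ hi : i < k, ¬ q ⟨i, hi⟩ ≤ ((n : ℝ) : EReal)
  · obtain ⟨hs, hs'⟩ := Nat.find_spec h
    refine ⟨Nat.find h, hs.le, fun i => ⟨fun hi => ?_, fun hi => ?_⟩⟩
    · by_contra hlt
      exact hs' ((hq (show (⟨Nat.find h, hs⟩ : Fin k) ≤ i from not_lt.1 hlt)).trans hi)
    · have := Nat.find_min h hi
      push Not at this
      exact this i.2
  · push Not at h
    exact ⟨k, le_rfl, fun i => ⟨fun _ => i.2, fun _ => h i i.2⟩⟩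

theorem sum_threshold (k s : ℕ) (hs : s ≤ k) :
    ∑ i : Fin k, (if (i : ℕ) < s then (1 : ℝ) else -1) = 2 * s - k := by
  rw [Fin.sum_univ_eq_sum_range (fun i => if i < s then (1 : ℝ) else -1)]
  obtain ⟨d, rfl⟩ := Nat.exists_eq_add_of_le hs
  rw [Finset.sum_range_add]
  have h1 : ∑ i ∈ Finset.range s, (if i < s then (1 : ℝ) else -1) = s := by
    rw [Finset.sum_congr rfl fun i hi => if_pos (Finset.mem_range.1 hi)]; simp
  have h2 : ∑ i ∈ Finset.range d, (if s + i < s then (1 : ℝ) else -1) = -d := by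
    rw [Finset.sum_congr rfl fun i _ => if_neg (by omega)]; simp
  rw [h1, h2]; push_cast; ring

/-- The sum of signs gives the number of coordinates at most `n`; by monotonicity they form an
initial segment, so it is known which ones they are. -/
theorem eq_of_sum_sign_eq {k : ℕ} {q q' : Fin k → EReal} (hq : Monotone q) (hq' : Monotone q')
    (he : ∀ i, IsExtInt (q i)) (he' : ∀ i, IsExtInt (q' i))
    (h : ∀ n : ℤ, ∑ i, sign (q i) n = ∑ i, sign (q' i) n) : q = q' := by
  funext i
  refine (he i).eq_of_forall_le_iff (he' i) fun n => ?_
  obtain ⟨s, hs, h1⟩ := exists_threshold hq n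
  obtain ⟨s', hs', h2⟩ := exists_threshold hq' n
  have := h n
  simp only [sign, h1, h2] at this
  rw [sum_threshold k s hs, sum_threshold k s' hs'] at this
  have : (s : ℝ) = s' := by linarith
  have : s = s' := by exact_mod_cast this
  rw [h1, h2, this]

/-- The conditions that define `Ω'` carry over to `p + φ(w, z)` and the rest of `z`, if `w` is a
prefix of `z`. -/
theorem shifted_prefix {k : ℕ} (hk : 0 < k) (x : OmegaPre k) (m : ℕ) :
    ∃ M, ∀ N ≥ M, ∀ (i : ℕ) (hi : i + 1 < k),
      (IsBreak x.1.2 N → shifted x (wordProd k (x.1.2.word.take m)) ⟨i, by omega⟩ +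
        ((exactCount (k - (i + 1)) ((x.1.2.word.drop m).take (N - m)) : ℝ) : EReal) ≤
          shifted x (wordProd k (x.1.2.word.take m)) ⟨i + 1, hi⟩) ∧
      (x.1.2.word.get? N = none → shifted x (wordProd k (x.1.2.word.take m)) ⟨i, by omega⟩ +
        ((exactCount (k - (i + 1)) ((x.1.2.word.drop m).take (N - m)) : ℝ) : EReal) =
          shifted x (wordProd k (x.1.2.word.take m)) ⟨i + 1, hi⟩) := by
  obtain ⟨M, hM⟩ := exists_phi_eq_take hk (wordProd k (x.1.2.word.take m))
  refine ⟨max M m, fun N hN i hi => ?_⟩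
  have hcond := (omegaCond_iff hk x.1).1 x.2 i hi N
  have hsplit : x.1.2.word.take N =
      x.1.2.word.take m ++ (x.1.2.word.drop m).take (N - m) := by
    rw [← take_add]; congr 1; omega
  set u := x.1.2.word.take m with hu
  set y := (x.1.2.word.drop m).take (N - m) with hy
  set l := x.1.2.word.take N with hl
  -- Multiplying the prefix `l` by the inverse of `u` leaves exactly the word `y`, so adding φ
  -- replaces the run counts of `l` by those of `y`.
  have hφ : ∀ i, phi k (wordProd k u) x.1.2 i = (runCount (k - i) y : ℤ) - runCount (k - i) l := by
    intro i
    rw [hM N (by omega) x.1.2, phiElt, ← hl, hsplit, wordProd_append, inv_mul_cancel_left,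
      Pi.sub_apply, ← wordProd_append, ← hsplit, piVec_eq hk, piVec_eq hk,
      nf_wordProd hk (x.1.2.runsLT_take N), nf_wordProd hk (x.1.2.runsLT_drop_take m (N - m))]
    simp [hy, hl]
  have e1 := runCount_eq_add_exactCount (n := k - (i + 1)) (by omega) y
  have e2 := runCount_eq_add_exactCount (n := k - (i + 1)) (by omega) l
  rw [show k - (i + 1) + 1 = k - i by omega] at e1 e2
  have key : (phi k (wordProd k u) x.1.2 ⟨i, by omega⟩ : ℝ) + exactCount (k - (i + 1)) y =
      exactCount (k - (i + 1)) l + phi k (wordProd k u) x.1.2 ⟨i + 1, hi⟩ := by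
    rw [hφ, hφ]
    simp only [e1, e2]
    push_cast; ring
  unfold shifted
  rw [add_assoc, ← EReal.coe_add, key, EReal.coe_add, ← add_assoc]
  refine ⟨fun h => ?_, fun h => ?_⟩
  · gcongr
    exact hcond.1 h
  · rw [hcond.2 h]

theorem monotone_of_step {k : ℕ} {q : Fin k → EReal}
    (h : ∀ (i : ℕ) (hi : i + 1 < k), q ⟨i, by omega⟩ ≤ q ⟨i + 1, hi⟩) : Monotone q := by
  have : ∀ (d i : ℕ) (hi : i + d < k), q ⟨i, by omega⟩ ≤ q ⟨i + d, hi⟩ := by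
    intro d
    induction d with
    | zero => intro i hi; exact le_rfl
    | succ d ih => intro i hi; exact (ih i (by omega)).trans (h (i + d) (by omega))
  rintro ⟨i, hi⟩ ⟨j, hj⟩ hij
  obtain ⟨d, rfl⟩ := Nat.exists_eq_add_of_le (show i ≤ j from hij)
  exact this d i hj

theorem monotone_shifted_prefix {k : ℕ} (hk : 0 < k) (x : OmegaPre k) (m : ℕ) :
    Monotone (shifted x (wordProd k (x.1.2.word.take m))) := by
  obtain ⟨M, hM⟩ := shifted_prefix hk x m
  obtain ⟨N, hN, hbr⟩ := exists_isBreak hk x.1.2 M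
  apply monotone_of_step
  intro i hi
  refine le_trans ?_ ((hM N hN i hi).1 hbr)
  conv_lhs => rw [← add_zero (shifted _ _ _)]
  gcongr
  exact_mod_cast Nat.zero_le _

/-- The effect on `π` of removing the first run. -/
theorem phi_run {k : ℕ} (hk : 0 < k) (z : DeltaFree k) {m : ℕ} {s : Bool}
    (hs : z.word.get? m = some s) (i : Fin k) :
    phi k (wordProd k (z.word.take m) * alt k s (runAt z m)) z i =
      phi k (wordProd k (z.word.take m)) z i - if k - runAt z m ≤ i then 1 else 0 := by
  obtain ⟨M, hM⟩ := exists_phi_eq_take hk (wordProd k (z.word.take m))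
  obtain ⟨M', hM'⟩ := exists_phi_eq_take hk (wordProd k (z.word.take m) * alt k s (runAt z m))
  set L := runAt z m with hL
  set N := max (max M M') (m + L) with hN
  rw [hM N (by omega), hM' N (by omega), phiElt_mul, Pi.add_apply]
  have hsplit : z.word.take N = z.word.take m ++ (z.word.drop m).take (N - m) := by
    rw [← take_add]; congr 1; omega
  have hsplit' : (z.word.drop m).take (N - m) =
      altWord s L ++ ((z.word.drop m).drop L).take (N - m - L) := by
    rw [← take_runAt hk hs le_rfl, ← take_add]; congr 1; omega
  have hrest : leadRun (s ^^ L.bodd) (((z.word.drop m).drop L).take (N - m - L)) = 0 := by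
    by_contra hne
    obtain ⟨l', hl'⟩ := exists_cons_of_leadRun_pos hne
    have h1 := congrArg (fun l => l[0]?) hl'
    simp only [Stream'.Seq.getElem?_take, Stream'.Seq.drop_get?, List.getElem?_cons_zero,
      add_zero] at h1
    split_ifs at h1
    exact get?_runAt_ne hk hs h1
  have hrun := z.runsLT_drop_take m (N - m)
  rw [hsplit, wordProd_append, inv_mul_cancel_left]
  have : phiElt k (alt k s L) (wordProd k ((z.word.drop m).take (N - m))) i =
      -if k - L ≤ i then 1 else 0 := by
    rw [phiElt, Pi.sub_apply, piVec_eq hk, piVec_eq hk, nf_wordProd hk hrun]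
    rw [hsplit'] at hrun ⊢
    rw [wordProd_append, alt, inv_mul_cancel_left, nf_wordProd hk (runsLT_append_right hrun),
      runCount_altWord_append _ hrest]
    have hL1 := runAt_lt hk z m
    have hi := i.2
    split_ifs <;> first | omega | (push_cast; ring)
  rw [this]; ring

/-- The inverse of the block is an alternating block of length `k - L` times Δ⁻¹. The factor Δ⁻¹
lowers every coordinate, and the new run, which merges with nothing, restores those from index `L`
on. -/
theorem phi_of_leadRun_eq_zero {k : ℕ} (hk : 0 < k) (z : DeltaFree k) {m L : ℕ} {s : Bool}
    (hL : 1 ≤ L) (hLk : L < k) (hs : z.word.get? m = some (!s)) (i : Fin k) :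
    phi k (wordProd k (z.word.take m) * alt k s L) z i =
      phi k (wordProd k (z.word.take m)) z i - if (i : ℕ) < L then 1 else 0 := by
  obtain ⟨M, hM⟩ := exists_phi_eq_take hk (wordProd k (z.word.take m))
  obtain ⟨M', hM'⟩ := exists_phi_eq_take hk (wordProd k (z.word.take m) * alt k s L)
  set N := max (max M M') (m + 1) with hN
  rw [hM N (by omega), hM' N (by omega), phiElt_mul, Pi.add_apply]
  have hsplit : z.word.take N = z.word.take m ++ (z.word.drop m).take (N - m) := by
    rw [← take_add]; congr 1; omega
  rw [hsplit, wordProd_append, inv_mul_cancel_left]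
  have hrun := z.runsLT_drop_take m (N - m)
  have hlead : leadRun s ((z.word.drop m).take (N - m)) = 0 := by
    by_contra hne
    obtain ⟨l', hl'⟩ := exists_cons_of_leadRun_pos hne
    have h1 := congrArg (fun l => l[0]?) hl'
    simp only [Stream'.Seq.getElem?_take, Stream'.Seq.drop_get?, List.getElem?_cons_zero,
      add_zero] at h1
    rw [if_pos (by omega), hs] at h1
    simp at h1
  set y := (z.word.drop m).take (N - m) with hy
  have hinv : (alt k s L)⁻¹ = alt k (s ^^ L.bodd) (k - L) * garside k ^ (-1 : ℤ) := by
    rw [inv_eq_iff_mul_eq_one, ← mul_assoc, alt, alt, ← wordProd_append, ← altWord_add,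
      Nat.add_sub_cancel' hLk.le, ← alt, alt_eq_garside]
    simp
  have hnf : nf hk (garside k ^ (-1 : ℤ) * wordProd k y) = (twist k y, -1) := by
    rw [nf_garside_zpow_mul, nf_wordProd hk hrun]
    simp [twistPow]
  have hb : ((s ^^ L.bodd) ^^ (k - L).bodd) = (s ^^ k.bodd) := by
    conv_rhs => rw [show k = L + (k - L) by omega, Nat.bodd_add]
    simp
  have hlead' : leadRun ((s ^^ L.bodd) ^^ (k - L).bodd)
      (nf hk (garside k ^ (-1 : ℤ) * wordProd k y)).1 = 0 := by
    rw [hnf, hb, leadRun_twist, hlead]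
  have : phiElt k (alt k s L) (wordProd k y) i = -if (i : ℕ) < L then 1 else 0 := by
    rw [phiElt, Pi.sub_apply, piVec_eq hk, piVec_eq hk, nf_wordProd hk hrun, hinv, mul_assoc,
      nf_alt_mul hk (by omega) hlead', runCount_altWord_append _ hlead', hnf, runCount_twist]
    have hi := i.2
    simp only
    split_ifs <;> omega
  rw [this]; ring

/-- Signs decrease along a monotone vector, so the first `L` sum to at least as much as the last
`L`; strictness holds because `n` separates the two end coordinates. -/
theorem sum_sign_lt {k L : ℕ} {q : Fin k → EReal} (hq : Monotone q) (hL : 1 ≤ L) (hLk : L < k)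
    {n : ℤ} (h0 : q ⟨0, by omega⟩ ≤ ((n : ℝ) : EReal))
    (h1 : ((n : ℝ) : EReal) < q ⟨k - 1, by omega⟩) :
    ∑ i ∈ Finset.univ.filter (fun i : Fin k => k - L ≤ i), sign (q i) n <
      ∑ i ∈ Finset.univ.filter (fun i : Fin k => (i : ℕ) < L), sign (q i) n := by
  obtain ⟨s, hsk, hs⟩ := exists_threshold hq n
  have hs0 : 0 < s := (hs _).1 h0
  have hs1 : s ≤ k - 1 := by
    by_contra hlt
    exact absurd ((hs ⟨k - 1, by omega⟩).2 (by simp only; omega)) (not_le.2 h1)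
  simp only [sign, hs, Finset.sum_filter]
  rw [Fin.sum_univ_eq_sum_range (fun i => if k - L ≤ i then (if i < s then (1 : ℝ) else -1) else 0),
    Fin.sum_univ_eq_sum_range (fun i => if i < L then (if i < s then (1 : ℝ) else -1) else 0)]
  have e1 : ∑ i ∈ Finset.range k, (if k - L ≤ i then (if i < s then (1 : ℝ) else -1) else 0) =
      ∑ i ∈ Finset.range L, (if k - L + i < s then (1 : ℝ) else -1) := by
    conv_lhs => rw [show k = (k - L) + L by omega, Finset.sum_range_add]
    rw [Finset.sum_eq_zero, zero_add]
    · refine Finset.sum_congr rfl fun i _ => ?_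
      rw [if_pos (by omega)]
    · intro i hi
      have := Finset.mem_range.1 hi
      rw [if_neg (by omega)]
  have e2 : ∑ i ∈ Finset.range k, (if i < L then (if i < s then (1 : ℝ) else -1) else 0) =
      ∑ i ∈ Finset.range L, (if i < s then (1 : ℝ) else -1) := by
    conv_lhs => rw [show k = L + (k - L) by omega, Finset.sum_range_add]
    rw [Finset.sum_congr rfl fun i hi => if_pos (Finset.mem_range.1 hi), add_eq_left]
    refine Finset.sum_eq_zero fun i _ => ?_
    rw [if_neg (by omega)]
  rw [e1, e2]
  apply Finset.sum_lt_sum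
  · intro i _
    split_ifs <;> first | omega | norm_num
  -- At this index the first block is still below the threshold `s`, while the index shifted by `k -
  -- L ≥ 1` has reached it; this uses `s ≤ k - 1`.
  · refine ⟨min (s - 1) (L - 1), Finset.mem_range.2 (by omega), ?_⟩
    rw [if_neg (by omega), if_pos (by omega)]
    norm_num

theorem eq_nil_of_exactCount_eq_zero {k : ℕ} {l : List Bool} (hl : RunsLT k l)
    (h : ∀ j, 1 ≤ j → j < k → exactCount j l = 0) : l = [] := by
  rcases l with _ | ⟨s, l⟩
  · rfl
  · have h1 := (runCount_succ_le (l := s :: l) (n := leadRun s (s :: l)) (by simp)).2 s rfl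
    have h2 := h (leadRun s (s :: l)) (by simp) (by simpa using hl.1)
    rw [exactCount] at h2
    omega

theorem shifted_one {k : ℕ} (hk : 0 < k) (x : OmegaPre k) (i : Fin k) :
    shifted x 1 i = (x.1.1 i).1 := by
  obtain ⟨N, hN⟩ := exists_phi_eq_take hk (1 : Artin k)
  rw [shifted, hN N le_rfl, phiElt_one]
  simp

/-- If all coordinates of `p + φ(w, z)` are the same integer for a prefix `w` of `z`, then
`z = w`. -/
theorem get?_eq_none_of_shifted_const {k : ℕ} (hk : 0 < k) (x : OmegaPre k) {m : ℕ} {c : ℤ}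
    (h : ∀ i, shifted x (wordProd k (x.1.2.word.take m)) i = ((c : ℝ) : EReal)) :
    x.1.2.word.get? m = none := by
  obtain ⟨M, hM⟩ := shifted_prefix hk x m
  obtain ⟨N, hN, hbr⟩ := exists_isBreak hk x.1.2 (max M (m + 1))
  have hnil : (x.1.2.word.drop m).take (N - m) = [] := by
    apply eq_nil_of_exactCount_eq_zero (x.1.2.runsLT_drop_take m (N - m))
    intro j hj hjk
    have := (hM N (by omega) (k - j - 1) (by omega)).1 hbr
    rw [h, h, ← EReal.coe_add, EReal.coe_le_coe_iff, show k - (k - j - 1 + 1) = j by omega] at this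
    have h2 : ((exactCount j ((x.1.2.word.drop m).take (N - m)) : ℕ) : ℝ) ≤ 0 := by linarith
    exact Nat.le_zero.1 (by exact_mod_cast h2)
  have := congrArg (fun l => l[0]?) hnil
  simp only [Stream'.Seq.getElem?_take, Stream'.Seq.drop_get?, add_zero, List.getElem?_nil] at this
  rwa [if_pos (by omega)] at this

/-- If `z` is a finite word `w`, then all coordinates of `p + φ(w, z)` agree. -/
theorem shifted_const_of_get?_eq_none {k : ℕ} (hk : 0 < k) (x : OmegaPre k) {m : ℕ}
    (h : x.1.2.word.get? m = none) (i : Fin k) :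
    shifted x (wordProd k (x.1.2.word.take m)) i =
      shifted x (wordProd k (x.1.2.word.take m)) ⟨0, hk⟩ := by
  obtain ⟨M, hM⟩ := shifted_prefix hk x m
  obtain ⟨i, hi⟩ := i
  induction i with
  | zero => rfl
  | succ i ih =>
    rw [← ih (by omega), ← (hM (max M m) (le_max_left _ _) i hi).2
      (x.1.2.word.le_stable (le_max_right _ _) h)]
    have : (x.1.2.word.drop m).take (max M m - m) = [] := by
      have h0 : (x.1.2.word.drop m).get? 0 = none := by simpa using h
      rw [take_eq_of_terminated h0 (Nat.zero_le _)]
      rfl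
    rw [this]
    simp [exactCount_nil]

theorem ext_word {k : ℕ} {z z' : DeltaFree k} (h : ∀ n, z.word.get? n = z'.word.get? n) :
    z = z' := by
  obtain ⟨w, hw⟩ := z
  obtain ⟨w', hw'⟩ := z'
  obtain rfl : w = w' := Stream'.Seq.ext h
  rfl

/-- The test element appends to the common prefix the run with which `x` continues. For `x` this
lowers the last L coordinates, for `y` the first L, and `sum_sign_lt` tells the increments of ψ
apart. -/
theorem psi_ne_of_first_letters {k : ℕ} (hk : 0 < k) {x y : OmegaPre k} {m : ℕ} {s : Bool}
    (htake : x.1.2.word.take m = y.1.2.word.take m)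
    (hsh : shifted x (wordProd k (x.1.2.word.take m)) = shifted y (wordProd k (y.1.2.word.take m)))
    (hs : x.1.2.word.get? m = some s) (hs' : y.1.2.word.get? m = some (!s))
    (hlt : shifted x (wordProd k (x.1.2.word.take m)) ⟨0, hk⟩ <
      shifted x (wordProd k (x.1.2.word.take m)) ⟨k - 1, by omega⟩) : psi k x ≠ psi k y := by
  intro hψ
  obtain ⟨n, hn1, hn2⟩ := (isExtInt_shifted _ _ _).exists_int_between (isExtInt_shifted _ _ _) hlt
  set L := runAt x.1.2 m with hL
  have hL1 : 1 ≤ L := one_le_runAt hk (by simp [hs])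
  have hLk : L < k := runAt_lt hk _ _
  set u := wordProd k (x.1.2.word.take m) with hu
  have h1 := psi_sub_psi hk x u (u * alt k s L) n
    (S := Finset.univ.filter fun i : Fin k => k - L ≤ i) (by
      intro i; rw [hu, phi_run hk x.1.2 hs i]; simp [hL])
  have h2 := psi_sub_psi hk y u (u * alt k s L) n
    (S := Finset.univ.filter fun i : Fin k => (i : ℕ) < L) (by
      intro i
      rw [hu, htake, phi_of_leadRun_eq_zero hk y.1.2 hL1 hLk hs' i]; simp)
  have hlt' := sum_sign_lt (monotone_shifted_prefix hk x m) hL1 hLk hn1 hn2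
  rw [← hu, ← h1, hψ, h2, hsh, ← htake] at hlt'
  exact lt_irrefl _ hlt'

theorem rel_of_psi_eq {k : ℕ} (hk : 0 < k) {x y : OmegaPre k} (h : psi k x = psi k y) :
    (omegaSetoid k).r x y := by
  have sh : ∀ m, x.1.2.word.take m = y.1.2.word.take m →
      shifted x (wordProd k (x.1.2.word.take m)) = shifted y (wordProd k (y.1.2.word.take m)) := by
    intro m hm
    refine eq_of_sum_sign_eq (monotone_shifted_prefix hk x m) (monotone_shifted_prefix hk y m)
      (isExtInt_shifted _ _) (isExtInt_shifted _ _) fun n => ?_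
    rw [← hm]
    exact sum_sign_eq hk h _ n
  have hp : x.1.1 = y.1.1 := by
    have := sh 0 rfl
    rw [Stream'.Seq.take_zero, Stream'.Seq.take_zero, wordProd_nil] at this
    funext i
    apply Subtype.ext
    rw [← shifted_one hk x, ← shifted_one hk y, this]
  by_cases hz : x.1.2 = y.1.2
  · exact Or.inl (Subtype.ext (Prod.ext hp hz))
  right
  refine ⟨hp, ?_⟩
  have hdiff : ∃ m, x.1.2.word.get? m ≠ y.1.2.word.get? m := by
    by_contra hcon
    push Not at hcon
    exact hz (ext_word hcon)
  classical
  set m := Nat.find hdiff with hm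
  have hm1 : x.1.2.word.get? m ≠ y.1.2.word.get? m := Nat.find_spec hdiff
  have htake : x.1.2.word.take m = y.1.2.word.take m :=
    take_eq_of_forall fun j hj => not_not.1 (Nat.find_min hdiff hj)
  have hsh := sh m htake
  have hmono := monotone_shifted_prefix hk x m
  set q := shifted x (wordProd k (x.1.2.word.take m)) with hq
  by_cases hlt : q ⟨0, hk⟩ < q ⟨k - 1, by omega⟩
  · exfalso
    rcases hs : x.1.2.word.get? m with _ | s
    · rw [hq, shifted_const_of_get?_eq_none hk x hs ⟨k - 1, by omega⟩] at hlt
      exact lt_irrefl _ hlt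
    rcases hs' : y.1.2.word.get? m with _ | t
    · rw [hsh, shifted_const_of_get?_eq_none hk y hs' ⟨k - 1, by omega⟩] at hlt
      exact lt_irrefl _ hlt
    · have hst : t = !s := by
        rw [hs, hs'] at hm1
        cases s <;> cases t <;> simp_all
      subst hst
      exact psi_ne_of_first_letters hk htake hsh hs hs' hlt h
  -- Here monotonicity makes all coordinates equal. Adding integers preserves infinite values, so an
  -- infinite constant comes from a constant p; a finite one forces both words to end at position
  -- `m`.
  · have hconst : ∀ i, q i = q ⟨0, hk⟩ := by
      intro i
      apply le_antisymm
      · exact (hmono (show i ≤ ⟨k - 1, by omega⟩ by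
          have := i.2; rw [Fin.le_def]; simp only; omega)).trans (not_lt.1 hlt)
      · exact hmono (by rw [Fin.le_def]; simp)
    have hpq : ∀ i, q i = (x.1.1 i).1 +
        ((phi k (wordProd k (x.1.2.word.take m)) x.1.2 i : ℝ) : EReal) := fun _ => rfl
    rcases isExtInt_shifted x (wordProd k (x.1.2.word.take m)) ⟨0, hk⟩ with h0 | h0 | ⟨c, h0⟩
    · right
      intro i
      have h1 := hconst i
      rw [hq, h0, ← hq, hpq] at h1
      rcases (x.1.1 i).2 with h2 | h2 | ⟨a, h2⟩
      · exact h2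
      · rw [h2, EReal.top_add_coe] at h1; simp at h1
      · rw [h2, ← EReal.coe_add] at h1; exact absurd h1 (EReal.coe_ne_bot _)
    · left
      intro i
      have h1 := hconst i
      rw [hq, h0, ← hq, hpq] at h1
      rcases (x.1.1 i).2 with h2 | h2 | ⟨a, h2⟩
      · rw [h2, EReal.bot_add] at h1; simp at h1
      · exact h2
      · rw [h2, ← EReal.coe_add] at h1; exact absurd h1 (EReal.coe_ne_top _)
    · exfalso
      have h1 : ∀ i, q i = ((c : ℝ) : EReal) := fun i => (hconst i).trans h0
      have h2 := get?_eq_none_of_shifted_const hk x h1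
      have h3 := get?_eq_none_of_shifted_const hk y (m := m) (fun i => by rw [← hsh]; exact h1 i)
      exact hm1 (h2.trans h3.symm)

/-! ### The homeomorphism -/

/-- The map that `ψ` induces on `Ω`. -/
def psiQuot {k : ℕ} (hk : 1 < k) : Omega k → horoCompactification k :=
  Quotient.lift (fun x => ⟨psiMap k x, psiMap_mem_closure hk x⟩) fun _ _ h =>
    Subtype.ext (psi_congr (by omega) h)

theorem continuous_psiQuot {k : ℕ} (hk : 1 < k) : Continuous (psiQuot hk) :=
  Continuous.quotient_lift ((continuous_psiMap (by omega)).subtype_mk _) _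

theorem injective_psiQuot {k : ℕ} (hk : 1 < k) : Function.Injective (psiQuot hk) := by
  rintro ⟨x⟩ ⟨y⟩ h
  apply Quotient.sound
  have h1 : psiMap k x = psiMap k y := congrArg Subtype.val h
  exact rel_of_psi_eq (by omega) (congrArg (fun f : C(Artin k, ℝ) => (f : Artin k → ℝ)) h1)

/-- The image of the compact space Ω' is closed and contains every distance function, hence also the
closure of their set. -/
theorem surjective_psiQuot {k : ℕ} (hk : 1 < k) : Function.Surjective (psiQuot hk) := by
  have := compactSpace_omegaPre (k := k) (by omega)
  have hclosed : IsClosed (Set.range (psiMap k)) :=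
    (isCompact_range (continuous_psiMap (by omega))).isClosed
  rintro ⟨f, hf⟩
  have hsub : horoCompactification k ⊆ Set.range (psiMap k) := by
    apply closure_minimal _ hclosed
    rintro _ ⟨g, rfl⟩
    exact ⟨_, psiMap_ofGroup hk g⟩
  obtain ⟨x, rfl⟩ := hsub hf
  exact ⟨Quotient.mk _ x, rfl⟩

end DihedralArtin

end

open DihedralArtin Filter Topology
theorem theorem2p7 (k : ℕ) (hk : 3 ≤ k) :
    -- the notions entering the definition of `ψ` are well defined
    (∀ x : Artin k, ∃! f, IsLeftNormalForm k x f) ∧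
    (∀ z : DeltaFree k, ∃! c, IsDecomposition k z c) ∧
    (∀ (w : Artin k) (z : DeltaFree k), ∃ v : Fin k → ℤ,
      Tendsto (fun n => phiElt k w (wordProd k (z.word.take n))) atTop (𝓝 v)) ∧
    -- `ψ` induces a homeomorphism, under which `Ω₀` corresponds to the group elements
    ∃ h : Omega k ≃ₜ horoCompactification k,
      (∀ (x : OmegaPre k) (w : Artin k),
        (h (Quotient.mk (omegaSetoid k) x) : C(Artin k, ℝ)) w = psi k x w) ∧
      (fun q : Omega k => (h q : C(Artin k, ℝ))) '' Omega0 k = Set.range (distFun k) := by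
  have hk0 : 0 < k := by omega
  have hk1 : 1 < k := by omega
  refine ⟨existsUnique_leftNormalForm hk0, existsUnique_decomposition hk0, fun w z => ?_, ?_⟩
  · obtain ⟨N, hN⟩ := exists_phi_eq hk0 w
    refine ⟨_, (hN z (wordProd k (z.word.take N)) ?_).2⟩
    rw [nf_wordProd hk0 (z.runsLT_take N)]
    exact take_take _ le_rfl
  · have := compactSpace_omegaPre hk0
    let e : Omega k ≃ horoCompactification k :=
      Equiv.ofBijective (psiQuot hk1) ⟨injective_psiQuot hk1, surjective_psiQuot hk1⟩
    have he : Continuous e := continuous_psiQuot hk1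
    refine ⟨he.homeoOfEquivCompactToT2, fun x w => rfl, ?_⟩
    ext f
    constructor
    · rintro ⟨q, ⟨x, rfl, hp, hz, -⟩, rfl⟩
      obtain ⟨g, hg⟩ := exists_distFun_eq hk1 hp hz
      exact ⟨g, hg⟩
    · rintro ⟨g, rfl⟩
      exact ⟨_, ofGroup_mem_Omega0 hk0 g, psiMap_ofGroup hk1 g⟩
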